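/- Let $d\ge 2$, $N\ge 1$, $T>0$. For $\theta=(V,B,W,U,b)\in L^\infty\big((0,T);(\mathbb{R}^{d\times d})^4\times\mathbb{R}^d\big)$ consider the Cauchy problem on the unit sphere $\mathbb{S}^{d-1}$ $$\partial_t\mu(t)+\mathrm{div}\big(\mu(t)\,\mathsf v[\mu(t)](t,\cdot)\big)=0,\qquad \mu(0)=\mu_0,$$ $$\mathsf v[\mu](t,x)=(I_d-xx^\top)\Big(V(t)\,\mathscr A_{B(t)}[\mu](x)+W(t)\,(U(t)x+b(t))_+\Big),\qquad \mathscr A_{B}[\mu](x)=\frac{\int e^{\langle Bx,y\rangle}\,y\,\mu(dy)}{\int e^{\langle Bx,y\rangle}\,\mu(dy)},$$ where $(\cdot)_+$ is the componentwise positive part and solutions are weak solutions in $C^0([0,T];\mathscr P(\mathbb{S}^{d-1}))$ (weak topology). Let $\mu_0^1,\dots,\mu_0^N\in\mathscr P(\mathbb{S}^{d-1})$ be pairwise distinct with $\bigcup_i\mathrm{supp}\,\mu_0^i\ne\mathbb{S}^{d-1}$. Let $\nu_0^i$ be the circle marginal of $\mu_0^i$, i.e. the image of the restriction of $\mu_0^i$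 to $\{(x_1,x_2)\ne 0\}$ under $x\mapsto (x_1,x_2)/\|(x_1,x_2)\|\in\mathbb{S}^1$. Suppose that $\partial\,\mathrm{supp}\,\nu_0^i\cap\partial\,\mathrm{supp}\,\nu_0^j=\varnothing$ for $i\ne j$ (boundaries in $\mathbb{S}^1$). Then there exists $\theta\in L^\infty((0,T);(\mathbb{R}^{d\times d})^4\times\mathbb{R}^d)$ such that, for every $i$, the Cauchy problem with data $\mu_0^i$ has a unique weak solution $\mu^i$, and $$\mathrm{supp}\,\mu^i(T)\cap\mathrm{supp}\,\mu^j(T)=\varnothing\qquad\text{for } i\ne j.$$ Moreover, $\theta$ can be chosen so that attention is only used with a nonzero $B$ and with $W$ in feedback form, and is so used: for almost every $t\in(0,T)$, either $V(t)=0$, or the following property (F) holds for some $k\in\{1,\dots,N\}$, $\lambda>0$ and $a,z\in\mathbb{S}^{d-1}$; and on some nonempty open subinterval of $(0,T)$, (F) holds at every $t$ with fixed $k,\lambda,a,z$, with $B(t)$ constant and $z\in\mathrm{supp}\,\mu^k(t)$. (F): $V(t)=\lambda I_d$, $B(t)\neq 0$, $b(t)=0$, $U(t)=\mathbf 1a^\top$,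 $\langle a,z\rangle>0$, $\langle a,x\rangle<0$ for all $x\in\mathrm{supp}\,\mu^j(t)$ and all $j\ne k$, and $$\langle a,z\rangle_+\,W(t)\mathbf 1+V(t)\,\mathscr A_{B(t)}[\mu^k(t)](z)=\lambda z .$$ -/

import Mathlib

open MeasureTheory Set Filter Topology
open scoped RealInnerProductSpace ContDiff ENNReal

noncomputable section

namespace Transformer

/-- The Euclidean space `ℝ^d`. -/
abbrev E (d : ℕ) := EuclideanSpace ℝ (Fin d)

/-- The unit sphere of `ℝ^d`. -/
abbrev S (d : ℕ) := Metric.sphere (0 : E d) 1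

/-- The vector `(1, …, 1)`. -/
def ones (d : ℕ) : E d := WithLp.toLp 2 (fun _ => 1)

/-- Matrix-vector product on `ℝ^d`. -/
def mulV {d : ℕ} (M : Matrix (Fin d) (Fin d) ℝ) (x : E d) : E d :=
  WithLp.toLp 2 (M.mulVec x.ofLp)

/-- The componentwise positive part (ReLU). -/
def relu {d : ℕ} (x : E d) : E d := WithLp.toLp 2 (fun i => max (x i) 0)

/-- The projection `I - x xᵀ`; for `x` in the sphere, the orthogonal projection onto the
tangent space at `x`. -/
def tanProj {d : ℕ} (x y : E d) : E d := y - ⟪x, y⟫ • x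

/-- A parameter value `(V, B, W, U, b)`. -/
structure Params (d : ℕ) where
  V : Matrix (Fin d) (Fin d) ℝ
  B : Matrix (Fin d) (Fin d) ℝ
  W : Matrix (Fin d) (Fin d) ℝ
  U : Matrix (Fin d) (Fin d) ℝ
  b : E d

/-- `θ ∈ L^∞((0,T); Θ)`: every entry is measurable and essentially bounded on `(0,T)`. -/
def IsLinfty {d : ℕ} (T : ℝ) (θ : ℝ → Params d) : Prop :=
  (∀ i j, MemLp (fun t => (θ t).V i j) ∞ (volume.restrict (Ioo 0 T))) ∧
  (∀ i j, MemLp (fun t => (θ t).B i j) ∞ (volume.restrict (Ioo 0 T))) ∧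
  (∀ i j, MemLp (fun t => (θ t).W i j) ∞ (volume.restrict (Ioo 0 T))) ∧
  (∀ i j, MemLp (fun t => (θ t).U i j) ∞ (volume.restrict (Ioo 0 T))) ∧
  (∀ i, MemLp (fun t => (θ t).b i) ∞ (volume.restrict (Ioo 0 T)))

/-- Self-attention
`A_B[μ](x) = ∫ e^{⟨Bx,y⟩} y μ(dy) / ∫ e^{⟨Bx,y⟩} μ(dy)`. -/
def attention {d : ℕ} (B : Matrix (Fin d) (Fin d) ℝ) (μ : ProbabilityMeasure (S d)) (x : E d) :
    E d :=
  (∫ y : S d, Real.exp ⟪mulV B x, (y : E d)⟫ ∂(μ : Measure (S d)))⁻¹ •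
    ∫ y : S d, Real.exp ⟪mulV B x, (y : E d)⟫ • (y : E d) ∂(μ : Measure (S d))

/-- The Transformer vector field
`v[μ](x) = (I - x xᵀ)(V A_B[μ](x) + W (U x + b)_+)`. -/
def vField {d : ℕ} (p : Params d) (μ : ProbabilityMeasure (S d)) (x : E d) : E d :=
  tanProj x (mulV p.V (attention p.B μ x) + mulV p.W (relu (mulV p.U x + p.b)))

/-- `μ ∈ C⁰([0,T]; P(S^{d-1}))` (weak topology) is a weak solution of
`∂ₜμ + div(μ v[μ]) = 0`, `μ(0) = μ₀`. Smooth functions on the sphere are the restrictions of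
smooth functions on `ℝ^d`; since `v` is tangent to the sphere, the pairing of the spherical
gradient with `v` is the ambient derivative in the direction `v`. -/
structure IsWeakSolution {d : ℕ} (T : ℝ) (θ : ℝ → Params d) (μ₀ : ProbabilityMeasure (S d))
    (μ : ℝ → ProbabilityMeasure (S d)) : Prop where
  continuousOn : ContinuousOn μ (Icc 0 T)
  init : μ 0 = μ₀
  weak : ∀ φ : E d → ℝ, ContDiff ℝ ∞ φ → ∀ t ∈ Icc 0 T,
    (∫ x : S d, φ x ∂(μ t : Measure (S d))) - ∫ x : S d, φ x ∂(μ₀ : Measure (S d)) =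
      ∫ s in (0 : ℝ)..t, ∫ x : S d,
        fderiv ℝ φ (x : E d) (vField (θ s) (μ s) (x : E d)) ∂(μ s : Measure (S d))

/-- The support of a probability measure on the sphere. -/
def supp {d : ℕ} (μ : ProbabilityMeasure (S d)) : Set (S d) := (μ : Measure (S d)).support

/-- The first two coordinates of `x ∈ ℝ^d`, for `d ≥ 2`. -/
def firstTwo {d : ℕ} (hd : 2 ≤ d) (x : E d) : E 2 :=
  WithLp.toLp 2 (fun i => x (Fin.castLE hd i))

/-- A fixed point of the circle, `(1, 0)`. -/
def basePoint : S 2 := ⟨EuclideanSpace.single 0 1, by simp⟩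

/-- The azimuthal hyperspherical coordinate, as a point of the circle:
`x ↦ (x₁,x₂)/‖(x₁,x₂)‖`. The value where `x₁ = x₂ = 0` is irrelevant below. -/
def azimuth {d : ℕ} (hd : 2 ≤ d) (x : S d) : S 2 :=
  if h : firstTwo hd (x : E d) = 0 then basePoint
  else ⟨‖firstTwo hd (x : E d)‖⁻¹ • firstTwo hd (x : E d), by
    simp [norm_smul, h]⟩

/-- The circle marginal of `μ`: the other hyperspherical angles are integrated out, that is,
the part of `μ` off the set `{x₁ = x₂ = 0}` (where the azimuth is undefined) is pushed forward
by the azimuth. It is a probability measure exactly when `μ` does not charge that set. -/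
def circleMarginal {d : ℕ} (hd : 2 ≤ d) (μ : ProbabilityMeasure (S d)) : Measure (S 2) :=
  ((μ : Measure (S d)).restrict {x | firstTwo hd (x : E d) ≠ 0}).map (azimuth hd)

lemma continuous_firstTwo {d : ℕ} (hd : 2 ≤ d) : Continuous (firstTwo hd) := by
  unfold firstTwo
  fun_prop

/-- The azimuth is measurable, so the push-forward in `circleMarginal` is the genuine one. -/
lemma measurable_azimuth {d : ℕ} (hd : 2 ≤ d) : Measurable (azimuth hd) := by
  classical
  have hf : Measurable fun x : S d => firstTwo hd (x : E d) :=
    ((continuous_firstTwo hd).comp continuous_subtype_val).measurable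
  have hs : MeasurableSet {x : S d | firstTwo hd (x : E d) = 0} :=
    hf (measurableSet_singleton (0 : E 2))
  refine Measurable.subtype_mk (p := fun y : E 2 => y ∈ Metric.sphere (0 : E 2) 1)
    (f := fun x => (azimuth hd x : E 2)) (h := fun x => (azimuth hd x).2) ?_
  have : (fun x => (azimuth hd x : E 2)) = fun x : S d =>
      if firstTwo hd (x : E d) = 0 then (basePoint : E 2)
      else ‖firstTwo hd (x : E d)‖⁻¹ • firstTwo hd (x : E d) := by
    funext x
    unfold azimuth
    split_ifs <;> rfl
  rw [this]
  exact Measurable.ite hs measurable_const (hf.norm.inv.smul hf)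

/-- The parameter value `p` acts, on the family `μ` of measures, in feedback form against
attention at the point `z` for the `k`-th measure: `V = λ I` with `λ > 0`, `B ≠ 0`, `b = 0`,
`U = 𝟏 aᵀ` where the half-space `⟨a, ·⟩ > 0` contains `z` and misses the supports of all the
other measures, and `W` is determined by the current state through
`⟨a,z⟩_+ W𝟏 + V A_B[μ^k](z) = λ z`. -/
structure IsFeedback {d N : ℕ} (p : Params d) (μ : Fin N → ProbabilityMeasure (S d))
    (k : Fin N) (lam : ℝ) (a z : S d) : Prop where
  lam_pos : 0 < lam
  V_eq : p.V = lam • (1 : Matrix (Fin d) (Fin d) ℝ)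
  B_ne : p.B ≠ 0
  U_eq : p.U = Matrix.of (fun _ j => (a : E d) j)
  b_eq : p.b = 0
  pos : 0 < ⟪(a : E d), (z : E d)⟫
  neg : ∀ j, j ≠ k → ∀ x ∈ supp (μ j), ⟪(a : E d), (x : E d)⟫ < 0
  law : max ⟪(a : E d), (z : E d)⟫ 0 • mulV p.W (ones d) +
    mulV p.V (attention p.B (μ k) (z : E d)) = lam • (z : E d)

end Transformer

end

/-! The time interval is cut into three phases of equal length.

Boost. Some point `-c` lies outside all supports. A constant perceptron (`V = 0`) generates the
conformal flow `boost`, which sends everything to `c`; after parameter `s` the data lie within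
`O(e^{-s})` of `c`. Rescaled by `e^s`, the tangential coordinates converge to the stereographic
projection from `-c`. The stereographic images are compactly supported because `-c` is in the hole,
and they are pairwise distinct. A compactly supported measure is determined by the germ of its
Laplace transform, so a generic direction `η` separates all the transforms (`exists_direction`,
`tendsto_laplace_boost`).

Clustering. With `ξ = e^s η`, take `V = λI` and `B = ξ cᵀ`, so that `Bx ≈ ξ` near `c`. To leading
order `q = ⟪ξ, x⟫` obeys `q' = λ(m - q)`, where `m` is the mean of `q` under the Gibbs density
`e^q`. Differences of `q` contract like `e^{-λt}`, whereas `∫ e^q` is conserved because `∫ e^q (m -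
q) = 0`. Each measure therefore concentrates, in the coordinate `q`, at the logarithm of its own
Laplace transform, and these values are distinct (`abs_inner_flow_sub_log_le`,
`exists_steers_disjoint`). The half-space of the feedback is the one around `-c`, where there are no
data, so the ReLU stays off on the supports.

Attention at a point of a support. The supports are now disjoint and lie in an open hemisphere. A
lowest point `z` of their union is separated from the other supports by a linear half-space. The
feedback at `z` fixes `z`, and with a small gain it moves points too little to spoil disjointness
(`exists_steers_attention`).

In a feedback phase the control depends on the state. `exists_closedLoop` solves for all the flows
at once, as an ODE with bounded Lipschitz field in `Fin N → C(S d, E d)`, and reads the control off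
the solution. Uniqueness of weak solutions (`IsWeakSolution.unique`) is a Grönwall estimate for a
Kantorovich–Rubinstein distance with mollified test functions: an explicit Euler step replaces
characteristics. -/

noncomputable section

namespace Transformer

/-! ### Calculus of uniformly bounded Lipschitz families. -/

/-- A family `x ↦ f x w` of bounded Lipschitz maps, with constants uniform in `w`. -/
def UBL {X Ω F : Type*} [PseudoMetricSpace X] [NormedAddCommGroup F] (f : X → Ω → F) : Prop :=
  ∃ C : ℝ, 0 ≤ C ∧ ∀ w, (∀ x, ‖f x w‖ ≤ C) ∧ ∀ x y, ‖f x w - f y w‖ ≤ C * dist x y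

namespace UBL

variable {X Y Ω Ω' F G : Type*} [PseudoMetricSpace X] [PseudoMetricSpace Y]
  [NormedAddCommGroup F] [NormedAddCommGroup G]

lemma of_bounds {f : X → Ω → F} (M K : ℝ) (h₁ : ∀ w x, ‖f x w‖ ≤ M)
    (h₂ : ∀ w x y, ‖f x w - f y w‖ ≤ K * dist x y) : UBL f := by
  refine ⟨max (max M K) 0, le_max_right _ _, fun w => ⟨fun x => (h₁ w x).trans ?_, fun x y =>
    (h₂ w x y).trans ?_⟩⟩
  · exact (le_max_left M K).trans (le_max_left _ _)
  · exact mul_le_mul_of_nonneg_right ((le_max_right M K).trans (le_max_left _ _)) dist_nonneg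

lemma comp_param {f : X → Ω → F} (hf : UBL f) (σ : Ω' → Ω) : UBL fun x w => f x (σ w) := by
  obtain ⟨C, hC, h⟩ := hf
  exact ⟨C, hC, fun w => h (σ w)⟩

lemma comp_lip {f : X → Ω → F} (hf : UBL f) {g : Y → Ω → X} (K : ℝ)
    (hg : ∀ w x y, dist (g x w) (g y w) ≤ K * dist x y) : UBL fun y w => f (g y w) w := by
  obtain ⟨C, hC, h⟩ := hf
  refine of_bounds C (C * K) (fun w x => (h w).1 _) fun w x y => ?_
  calc _ ≤ C * dist (g x w) (g y w) := (h w).2 _ _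
    _ ≤ C * (K * dist x y) := by gcongr; exact hg w x y
    _ = _ := by ring

lemma const {c : Ω → F} (M : ℝ) (h : ∀ w, ‖c w‖ ≤ M) : UBL fun (_ : X) w => c w :=
  of_bounds M 0 (fun w _ => h w) (by simp)

lemma add {f g : X → Ω → F} (hf : UBL f) (hg : UBL g) : UBL fun x w => f x w + g x w := by
  obtain ⟨C, hC, h⟩ := hf
  obtain ⟨D, hD, k⟩ := hg
  refine of_bounds (C + D) (C + D) (fun w x => (norm_add_le _ _).trans
    (add_le_add ((h w).1 x) ((k w).1 x))) fun w x y => ?_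
  calc _ = ‖(f x w - f y w) + (g x w - g y w)‖ := by congr 1; abel
    _ ≤ C * dist x y + D * dist x y := (norm_add_le _ _).trans
      (add_le_add ((h w).2 x y) ((k w).2 x y))
    _ = _ := by ring

lemma neg {f : X → Ω → F} (hf : UBL f) : UBL fun x w => -f x w := by
  obtain ⟨C, hC, h⟩ := hf
  refine ⟨C, hC, fun w => ⟨fun x => by simpa using (h w).1 x, fun x y => ?_⟩⟩
  rw [← norm_neg]
  simpa [sub_eq_add_neg, add_comm] using (h w).2 x y

lemma sub {f g : X → Ω → F} (hf : UBL f) (hg : UBL g) : UBL fun x w => f x w - g x w := by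
  simpa only [sub_eq_add_neg] using hf.add hg.neg

/-- Bounded Lipschitz families are stable under bounded bi-additive operations. -/
lemma bilin {H : Type*} [NormedAddCommGroup H] {f : X → Ω → F} {g : X → Ω → G} (hf : UBL f)
    (hg : UBL g) (β : F → G → H) (hβ : ∀ u v, ‖β u v‖ ≤ ‖u‖ * ‖v‖)
    (hl : ∀ u u' v, β u v - β u' v = β (u - u') v)
    (hr : ∀ u v v', β u v - β u v' = β u (v - v')) : UBL fun x w => β (f x w) (g x w) := by
  obtain ⟨C, hC, h⟩ := hf
  obtain ⟨D, hD, k⟩ := hg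
  refine of_bounds (C * D) (2 * C * D) (fun w x => (hβ _ _).trans
    (mul_le_mul ((h w).1 x) ((k w).1 x) (norm_nonneg _) hC)) fun w x y => ?_
  calc _ = ‖β (f x w - f y w) (g x w) + β (f y w) (g x w - g y w)‖ := by
        rw [← hl, ← hr]; congr 1; abel
    _ ≤ ‖f x w - f y w‖ * ‖g x w‖ + ‖f y w‖ * ‖g x w - g y w‖ :=
        (norm_add_le _ _).trans (add_le_add (hβ _ _) (hβ _ _))
    _ ≤ C * dist x y * D + C * (D * dist x y) := by
        have := (h w).2 x y
        have := (k w).2 x y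
        have := (h w).1 y
        have := (k w).1 x
        gcongr
    _ = _ := by ring

lemma smul [NormedSpace ℝ F] {f : X → Ω → ℝ} {g : X → Ω → F} (hf : UBL f) (hg : UBL g) :
    UBL fun x w => f x w • g x w :=
  hf.bilin hg (fun a v => a • v) (fun a v => (norm_smul a v).le)
    (fun _ _ _ => (sub_smul _ _ _).symm) (fun _ _ _ => (smul_sub _ _ _).symm)

lemma inner [InnerProductSpace ℝ F] {f g : X → Ω → F} (hf : UBL f) (hg : UBL g) :
    UBL fun x w => ⟪f x w, g x w⟫ :=
  hf.bilin hg (fun u v => ⟪u, v⟫) (fun u v => norm_inner_le_norm u v)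
    (fun _ _ _ => (inner_sub_left _ _ _).symm) (fun _ _ _ => (inner_sub_right _ _ _).symm)

/-- Composition with maps that are linear, or just Lipschitz with a value at `0`. -/
lemma post {f : X → Ω → F} (hf : UBL f) (T : Ω → F → G) (K M : ℝ) (hK : 0 ≤ K)
    (h₀ : ∀ w, ‖T w 0‖ ≤ M) (hT : ∀ w u v, ‖T w u - T w v‖ ≤ K * ‖u - v‖) :
    UBL fun x w => T w (f x w) := by
  obtain ⟨C, hC, h⟩ := hf
  refine of_bounds (K * C + M) (K * C) (fun w x => ?_) fun w x y => ?_
  · calc _ = ‖(T w (f x w) - T w 0) + T w 0‖ := by simp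
      _ ≤ K * ‖f x w - 0‖ + M := (norm_add_le _ _).trans (add_le_add (hT _ _ _) (h₀ w))
      _ ≤ K * C + M := by
        have := (h w).1 x
        rw [sub_zero]; gcongr
  · calc _ ≤ K * ‖f x w - f y w‖ := hT _ _ _
      _ ≤ K * (C * dist x y) := by gcongr; exact (h w).2 x y
      _ = _ := by ring

lemma exp_sub_exp_le {a b M : ℝ} (ha : a ≤ M) (hb : b ≤ M) :
    |Real.exp a - Real.exp b| ≤ Real.exp M * |a - b| := by
  wlog hab : b ≤ a generalizing a b
  · rw [abs_sub_comm, abs_sub_comm a]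
    exact this hb ha (le_of_not_ge hab)
  rw [abs_of_nonneg (sub_nonneg.2 (Real.exp_le_exp.2 hab)), abs_of_nonneg (sub_nonneg.2 hab)]
  have h1 : Real.exp b = Real.exp a * Real.exp (b - a) := by rw [← Real.exp_add]; congr 1; ring
  have h2 := Real.add_one_le_exp (b - a)
  have h3 := Real.exp_le_exp.2 ha
  have h4 := Real.exp_pos a
  calc _ = Real.exp a * (1 - Real.exp (b - a)) := by rw [h1]; ring
    _ ≤ Real.exp a * (a - b) := mul_le_mul_of_nonneg_left (by linarith) h4.le
    _ ≤ _ := mul_le_mul_of_nonneg_right h3 (by linarith)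

lemma exp {f : X → Ω → ℝ} (hf : UBL f) : UBL fun x w => Real.exp (f x w) := by
  obtain ⟨C, hC, h⟩ := hf
  have hb : ∀ w x, f x w ≤ C := fun w x => (le_abs_self _).trans ((h w).1 x)
  refine of_bounds (Real.exp C) (Real.exp C * C) (fun w x => ?_) fun w x y => ?_
  · rw [Real.norm_eq_abs, Real.abs_exp]
    exact Real.exp_le_exp.2 (hb w x)
  · calc _ ≤ Real.exp C * |f x w - f y w| := exp_sub_exp_le (hb w x) (hb w y)
      _ ≤ Real.exp C * (C * dist x y) := by gcongr; exact (h w).2 x y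
      _ = _ := by ring

lemma inv {f : X → Ω → ℝ} (hf : UBL f) (m : ℝ) (hm : 0 < m) (hfm : ∀ w x, m ≤ f x w) :
    UBL fun x w => (f x w)⁻¹ := by
  obtain ⟨C, hC, h⟩ := hf
  refine of_bounds m⁻¹ (m⁻¹ * m⁻¹ * C) (fun w x => ?_) fun w x y => ?_
  · have := hm.trans_le (hfm w x)
    rw [Real.norm_eq_abs, abs_of_pos (inv_pos.2 this)]
    exact inv_anti₀ hm (hfm w x)
  · have hx := hm.trans_le (hfm w x)
    have hy := hm.trans_le (hfm w y)
    have e : (f x w)⁻¹ - (f y w)⁻¹ = (f x w)⁻¹ * (f y w)⁻¹ * (f y w - f x w) := by field_simp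
    rw [e, norm_mul, norm_mul, Real.norm_of_nonneg (inv_pos.2 hx).le,
      Real.norm_of_nonneg (inv_pos.2 hy).le, norm_sub_rev]
    have h1 := inv_anti₀ hm (hfm w x)
    have h2 := inv_anti₀ hm (hfm w y)
    have h3 := (h w).2 x y
    calc _ ≤ m⁻¹ * m⁻¹ * (C * dist x y) := by gcongr
      _ = _ := by ring

/-- Averaging a uniformly bounded Lipschitz family against probability measures. -/
lemma integral [NormedSpace ℝ F] {S : Type*} [MeasurableSpace S] {f : X → Ω × S → F}
    (hf : UBL f) (μ : Ω → Measure S) [∀ w, IsProbabilityMeasure (μ w)]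
    (hm : ∀ x w, AEStronglyMeasurable (fun s => f x (w, s)) (μ w)) :
    UBL fun x w => ∫ s, f x (w, s) ∂(μ w) := by
  obtain ⟨C, hC, h⟩ := hf
  have hi : ∀ x w, Integrable (fun s => f x (w, s)) (μ w) := fun x w =>
    Integrable.of_bound (hm x w) C (.of_forall fun s => (h (w, s)).1 x)
  refine ⟨C, hC, fun w => ⟨fun x => ?_, fun x y => ?_⟩⟩
  · simpa using norm_integral_le_of_norm_le_const (μ := μ w) (.of_forall fun s => (h (w, s)).1 x)
  · rw [← integral_sub (hi x w) (hi y w)]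
    simpa using norm_integral_le_of_norm_le_const (μ := μ w)
      (.of_forall fun s => (h (w, s)).2 x y)

end UBL

/-! ### The radial retraction, and Lipschitz bounds for the Transformer field. -/

/-- The radial retraction of a normed space onto its closed unit ball. -/
def retr {F : Type*} [NormedAddCommGroup F] [NormedSpace ℝ F] (x : F) : F := (max 1 ‖x‖)⁻¹ • x

section retr
variable {F : Type*} [NormedAddCommGroup F] [NormedSpace ℝ F]

lemma norm_retr_le (x : F) : ‖retr x‖ ≤ 1 := by
  have : (0:ℝ) < max 1 ‖x‖ := lt_max_of_lt_left one_pos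
  rw [retr, norm_smul, norm_inv, Real.norm_of_nonneg this.le]
  rw [inv_mul_le_one₀ this]
  exact le_max_right _ _

lemma retr_of_norm_le {x : F} (hx : ‖x‖ ≤ 1) : retr x = x := by simp [retr, max_eq_left hx]

lemma dist_retr_le (x y : F) : ‖retr x - retr y‖ ≤ 2 * ‖x - y‖ := by
  have hx : (1:ℝ) ≤ max 1 ‖x‖ := le_max_left _ _
  have hy : (1:ℝ) ≤ max 1 ‖y‖ := le_max_left _ _
  have hyy : ‖y‖ ≤ max 1 ‖y‖ := le_max_right _ _
  have hd : |max 1 ‖x‖ - max 1 ‖y‖| ≤ ‖x - y‖ := by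
    refine (abs_max_sub_max_le_max _ _ _ _).trans ?_
    simpa using abs_norm_sub_norm_le x y
  set a := max 1 ‖x‖
  set b := max 1 ‖y‖
  -- Each summand has norm at most `‖x - y‖`; hence the constant 2, valid in every normed space.
  have e : retr x - retr y = a⁻¹ • (x - y) + (a⁻¹ * b⁻¹ * (b - a)) • y := by
    have : a⁻¹ * b⁻¹ * (b - a) = a⁻¹ - b⁻¹ := by field_simp
    rw [this]
    simp only [retr, smul_sub, sub_smul]
    abel
  rw [e]
  have h1 : ‖a⁻¹ • (x - y)‖ ≤ ‖x - y‖ := by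
    rw [norm_smul, norm_inv, Real.norm_of_nonneg (by linarith)]
    exact mul_le_of_le_one_left (norm_nonneg _) (inv_le_one_of_one_le₀ hx)
  have h2 : ‖(a⁻¹ * b⁻¹ * (b - a)) • y‖ ≤ ‖x - y‖ := by
    rw [norm_smul, norm_mul, norm_mul, norm_inv, norm_inv, Real.norm_of_nonneg (by linarith : 0 ≤ a),
      Real.norm_of_nonneg (by linarith : 0 ≤ b), Real.norm_eq_abs, abs_sub_comm]
    calc _ ≤ a⁻¹ * b⁻¹ * ‖x - y‖ * b := by gcongr
      _ = a⁻¹ * ‖x - y‖ := by field_simp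
      _ ≤ _ := mul_le_of_le_one_left (norm_nonneg _) (inv_le_one_of_one_le₀ hx)
  linarith [norm_add_le (a⁻¹ • (x - y)) ((a⁻¹ * b⁻¹ * (b - a)) • y)]

lemma continuous_retr : Continuous (retr : F → F) :=
  (LipschitzWith.of_dist_le_mul (K := 2) fun x y => by
    simpa [dist_eq_norm] using dist_retr_le x y).continuous

lemma UBL_retr {Ω : Type*} : UBL fun (x : F) (_ : Ω) => retr x :=
  UBL.of_bounds 1 2 (fun _ x => norm_retr_le x)
    fun _ x y => by rw [dist_eq_norm]; exact dist_retr_le x y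

end retr

section algebra
variable {d : ℕ}

lemma norm_le_sum_abs (x : E d) : ‖x‖ ≤ ∑ i, |x i| := by
  have : x = ∑ i, x i • EuclideanSpace.single i (1:ℝ) := by
    ext j
    simp [Pi.single_apply]
  conv_lhs => rw [this]
  refine (norm_sum_le _ _).trans (le_of_eq ?_)
  simp [norm_smul]

lemma mulV_apply (M : Matrix (Fin d) (Fin d) ℝ) (x : E d) (i : Fin d) :
    mulV M x i = ∑ j, M i j * x j := by
  simp [mulV, Matrix.mulVec, dotProduct]

lemma norm_mulV_le {R : ℝ} (hR : 0 ≤ R) {M : Matrix (Fin d) (Fin d) ℝ} (hM : ∀ i j, |M i j| ≤ R)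
    (x : E d) : ‖mulV M x‖ ≤ (d * d * R) * ‖x‖ := by
  refine (norm_le_sum_abs _).trans ?_
  calc ∑ i, |mulV M x i| ≤ ∑ i : Fin d, ∑ j : Fin d, R * ‖x‖ := by
        refine Finset.sum_le_sum fun i _ => ?_
        rw [mulV_apply]
        refine (Finset.abs_sum_le_sum_abs _ _).trans (Finset.sum_le_sum fun j _ => ?_)
        rw [abs_mul]
        have := PiLp.norm_apply_le x j
        rw [Real.norm_eq_abs] at this
        exact mul_le_mul (hM i j) this (abs_nonneg _) hR
    _ = _ := by simp; ring

lemma mulV_sub (M : Matrix (Fin d) (Fin d) ℝ) (x y : E d) : mulV M (x - y) = mulV M x - mulV M y := by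
  simp [mulV, Matrix.mulVec_sub]

@[simp] lemma mulV_zero (M : Matrix (Fin d) (Fin d) ℝ) : mulV M 0 = 0 := by simp [mulV]

@[simp] lemma zero_mulV (x : E d) : mulV (0 : Matrix (Fin d) (Fin d) ℝ) x = 0 := by simp [mulV]

lemma smul_one_mulV (c : ℝ) (x : E d) : mulV (c • (1 : Matrix (Fin d) (Fin d) ℝ)) x = c • x := by
  simp [mulV, Matrix.smul_mulVec]

lemma norm_relu_sub_le (x y : E d) : ‖relu x - relu y‖ ≤ ‖x - y‖ := by
  rw [EuclideanSpace.norm_eq, EuclideanSpace.norm_eq]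
  gcongr with i
  simp only [relu, PiLp.sub_apply, Real.norm_eq_abs]
  simpa using abs_max_sub_max_le_max (x i) 0 (y i) 0

@[simp] lemma relu_zero : relu (0 : E d) = 0 := by
  ext i; simp [relu]

lemma tanProj_add (x y z : E d) : tanProj x (y + z) = tanProj x y + tanProj x z := by
  simp only [tanProj, inner_add_right, add_smul]; abel

lemma tanProj_sub (x y z : E d) : tanProj x (y - z) = tanProj x y - tanProj x z := by
  simp only [tanProj, inner_sub_right, sub_smul]; abel

lemma tanProj_smul (x y : E d) (c : ℝ) : tanProj x (c • y) = c • tanProj x y := by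
  simp only [tanProj, inner_smul_right, smul_sub, smul_smul]

lemma norm_coe (x : S d) : ‖(x : E d)‖ = 1 := by simp

lemma inner_tanProj_self {x : E d} (hx : ‖x‖ = 1) (y : E d) : ⟪x, tanProj x y⟫ = 0 := by
  simp [tanProj, inner_sub_right, inner_smul_right, hx]

lemma norm_tanProj_le_of_unit {x : E d} (hx : ‖x‖ = 1) (y : E d) : ‖tanProj x y‖ ≤ ‖y‖ := by
  have h := norm_add_sq_real (tanProj x y) (⟪x, y⟫ • x)
  have h1 : tanProj x y + ⟪x, y⟫ • x = y := by simp [tanProj]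
  rw [h1, inner_smul_right, real_inner_comm x (tanProj x y), inner_tanProj_self hx] at h
  nlinarith [norm_nonneg y, norm_nonneg (tanProj x y), sq_nonneg ‖⟪x, y⟫ • x‖]

lemma tanProj_self {x : E d} (hx : ‖x‖ = 1) : tanProj x x = 0 := by
  simp [tanProj, hx]

lemma UBL.tanProj {X Ω : Type*} [PseudoMetricSpace X] {f g : X → Ω → E d} (hf : UBL f)
    (hg : UBL g) : UBL fun x w => Transformer.tanProj (f x w) (g x w) :=
  hg.sub ((hf.inner hg).smul hf)

lemma UBL.mulV {X Ω : Type*} [PseudoMetricSpace X] {f : X → Ω → E d} (hf : UBL f)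
    (M : Ω → Matrix (Fin d) (Fin d) ℝ) (R : ℝ) (hM : ∀ w i j, |M w i j| ≤ R) :
    UBL fun x w => Transformer.mulV (M w) (f x w) := by
  have hM' : ∀ w i j, |M w i j| ≤ max R 0 := fun w i j => (hM w i j).trans (le_max_left _ _)
  exact hf.post (fun w v => Transformer.mulV (M w) v) (d * d * max R 0) 0 (by positivity)
    (fun w => by simp) fun w u v => by
      rw [← mulV_sub]; exact norm_mulV_le (le_max_right _ _) (hM' w) _

lemma UBL.relu {X Ω : Type*} [PseudoMetricSpace X] {f : X → Ω → E d} (hf : UBL f) :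
    UBL fun x w => Transformer.relu (f x w) :=
  hf.post (fun _ v => Transformer.relu v) 1 0 zero_le_one (by simp) fun _ u v => by
    simpa using norm_relu_sub_le u v

end algebra

/-- All the entries of the parameter value are bounded by `R`. -/
structure Params.BoundedBy {d : ℕ} (R : ℝ) (p : Params d) : Prop where
  V : ∀ i j, |p.V i j| ≤ R
  B : ∀ i j, |p.B i j| ≤ R
  W : ∀ i j, |p.W i j| ≤ R
  U : ∀ i j, |p.U i j| ≤ R
  b : ∀ i, |p.b i| ≤ R

/-- The tilted mean `∫ e^{⟨ξ,Y⟩} Y dμ / ∫ e^{⟨ξ,Y⟩} dμ` of a vector-valued map. -/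
def tilt {d : ℕ} {S' : Type*} [MeasurableSpace S'] (μ : Measure S') (Y : S' → E d) (ξ : E d) :
    E d :=
  (∫ y, Real.exp ⟪ξ, Y y⟫ ∂μ)⁻¹ • ∫ y, Real.exp ⟪ξ, Y y⟫ • Y y ∂μ

section tilt
variable {d : ℕ}

lemma attention_eq_tilt (B : Matrix (Fin d) (Fin d) ℝ) (μ : ProbabilityMeasure (S d)) (x : E d) :
    attention B μ x = tilt (μ : Measure (S d)) (fun y : S d => (y : E d)) (mulV B x) := rfl

variable {S' : Type*} [MeasurableSpace S'] {X Ω : Type*} [PseudoMetricSpace X]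

/-- A quotient of averages of bounded Lipschitz families. The denominator stays above `exp (-C)`,
where `C` bounds the exponent, uniformly in the parameter and in the measure. -/
lemma UBL.tilt {f : X → Ω → E d} {g : X → Ω × S' → E d} (hf : UBL f) (hg : UBL g)
    (μ : Ω → Measure S') [∀ w, IsProbabilityMeasure (μ w)]
    (hm : ∀ x w, AEStronglyMeasurable (fun s => g x (w, s)) (μ w)) :
    UBL fun x w => Transformer.tilt (μ w) (fun s => g x (w, s)) (f x w) := by
  have h1 : UBL fun x (q : Ω × S') => ⟪f x q.1, g x q⟫ := (hf.comp_param Prod.fst).inner hg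
  have hme : ∀ x w, AEStronglyMeasurable (fun s => Real.exp ⟪f x w, g x (w, s)⟫) (μ w) :=
    fun x w => Real.continuous_exp.comp_aestronglyMeasurable
      (aestronglyMeasurable_const.inner (hm x w))
  have h2 := h1.exp.integral μ hme
  have h3 := (h1.exp.smul hg).integral μ fun x w => (hme x w).smul (hm x w)
  obtain ⟨D, hD, h'⟩ := h1.exp
  obtain ⟨C, hC, h⟩ := h1
  refine (h2.inv (Real.exp (-C)) (Real.exp_pos _) fun w x => ?_).smul h3
  have : ∫ _s, Real.exp (-C) ∂(μ w) ≤ ∫ s, Real.exp ⟪f x w, g x (w, s)⟫ ∂(μ w) := by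
    refine integral_mono (integrable_const _) (Integrable.of_bound (hme x w) D
      (.of_forall fun s => (h' (w, s)).1 x)) fun s => ?_
    exact Real.exp_le_exp.2 (neg_le_of_abs_le ((h (w, s)).1 x))
  simpa using this

end tilt

/-- Bounded parameter values, paired with a probability measure. -/
abbrev BState (d : ℕ) (R : ℝ) :=
  {p : Params d // p.BoundedBy R} × ProbabilityMeasure (S d)

/-- Precomposing with `retr` extends the field from the sphere to `ℝ^d` without changing it there.
The constants depend on `R` and `d` only; the uniformity in the measure is what the uniqueness proof
needs. -/
lemma UBL_vField {d : ℕ} (R : ℝ) :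
    UBL fun (x : E d) (w : BState d R) => vField w.1.1 w.2 (retr x) := by
  have hr : UBL fun (x : E d) (_ : BState d R) => retr x := UBL_retr
  have hb : UBL fun (_ : E d) (w : BState d R) => w.1.1.b :=
    UBL.const (∑ _i : Fin d, R) fun w => (norm_le_sum_abs _).trans
      (Finset.sum_le_sum fun i _ => w.1.2.b i)
  have hA : UBL fun (x : E d) (w : BState d R) =>
      tilt (w.2 : Measure (S d)) (fun y : S d => (y : E d)) (mulV w.1.1.B (retr x)) :=
    (hr.mulV (fun w => w.1.1.B) R fun w => w.1.2.B).tilt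
      (g := fun _ q => ((q.2 : S d) : E d)) (UBL.const 1 fun q => (norm_coe q.2).le)
      (fun w => (w.2 : Measure (S d)))
      fun _ _ => continuous_subtype_val.measurable.aestronglyMeasurable
  exact hr.tanProj ((hA.mulV (fun w => w.1.1.V) R fun w => w.1.2.V).add
    ((((hr.mulV (fun w => w.1.1.U) R fun w => w.1.2.U).add hb).relu).mulV (fun w => w.1.1.W) R
      fun w => w.1.2.W))

end Transformer

end

/-! ### Joint continuity of the field, and integrability of the weak formulation. -/

noncomputable section

namespace Transformer

section continuity
variable {d : ℕ} {Z : Type*} [TopologicalSpace Z]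

/-- Compactness of `K` makes `z ↦ f z` continuous for the sup norm, so replacing `f z` by `f z₀`
costs a uniformly small error; weak continuity of `ν` handles the fixed integrand `f z₀`. -/
lemma continuous_integral_of_continuous_real {K : Type*} [TopologicalSpace K] [CompactSpace K]
    [MeasurableSpace K] [BorelSpace K] {f : Z → K → ℝ}
    (hf : Continuous (Function.uncurry f)) {ν : Z → ProbabilityMeasure K} (hν : Continuous ν) :
    Continuous fun z => ∫ y, f z y ∂(ν z : Measure K) := by
  let g : C(Z, C(K, ℝ)) := ContinuousMap.curry ⟨Function.uncurry f, hf⟩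
  have hi : ∀ (k : C(K, ℝ)) (μ : ProbabilityMeasure K), Integrable k (μ : Measure K) := fun k μ =>
    Integrable.of_bound k.continuous.aestronglyMeasurable ‖k‖ (.of_forall k.norm_coe_le_norm)
  refine continuous_iff_continuousAt.2 fun z₀ => ?_
  have h1 : Tendsto (fun z => ∫ y, f z₀ y ∂(ν z : Measure K)) (𝓝 z₀)
      (𝓝 (∫ y, f z₀ y ∂(ν z₀ : Measure K))) :=
    ProbabilityMeasure.tendsto_iff_forall_integral_tendsto.1 (hν.tendsto z₀)
      (BoundedContinuousFunction.mkOfCompact (g z₀))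
  have h2 : Tendsto (fun z => ‖g z - g z₀‖) (𝓝 z₀) (𝓝 0) := by
    have : Continuous fun z => ‖g z - g z₀‖ := by fun_prop
    simpa using this.tendsto z₀
  have h3 : Tendsto (fun z => (∫ y, f z y ∂(ν z : Measure K)) - ∫ y, f z₀ y ∂(ν z : Measure K))
      (𝓝 z₀) (𝓝 0) := by
    refine squeeze_zero_norm (fun z => ?_) h2
    have : (∫ y, f z y ∂(ν z : Measure K)) - ∫ y, f z₀ y ∂(ν z : Measure K)
        = ∫ y, (g z - g z₀) y ∂(ν z : Measure K) := (integral_sub (hi (g z) _) (hi (g z₀) _)).symm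
    rw [this]
    simpa using norm_integral_le_of_norm_le_const (μ := (ν z : Measure K))
      (.of_forall (g z - g z₀).norm_coe_le_norm)
  simpa [ContinuousAt] using h3.add h1

lemma continuous_integral_of_continuous {K : Type*} [TopologicalSpace K] [CompactSpace K]
    [MeasurableSpace K] [BorelSpace K] {f : Z → K → E d}
    (hf : Continuous (Function.uncurry f)) {ν : Z → ProbabilityMeasure K} (hν : Continuous ν) :
    Continuous fun z => ∫ y, f z y ∂(ν z : Measure K) := by
  have hi : ∀ z, Integrable (f z) (ν z : Measure K) := fun z =>
    have hc : Continuous (f z) := hf.comp (Continuous.prodMk_right z)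
    let k : C(K, E d) := ⟨f z, hc⟩
    Integrable.of_bound hc.aestronglyMeasurable ‖k‖ (.of_forall k.norm_coe_le_norm)
  refine (PiLp.continuous_toLp 2 (fun _ : Fin d => ℝ)).comp (continuous_pi fun i => ?_)
  have h := fun z => (EuclideanSpace.proj (𝕜 := ℝ) i).integral_comp_comm (hi z)
  simp only [EuclideanSpace.coe_proj] at h
  simp only [← h]
  exact continuous_integral_of_continuous_real (f := fun z y => f z y i)
    ((EuclideanSpace.proj (𝕜 := ℝ) i).continuous.comp hf) hν

lemma continuous_mulV {M : Z → Matrix (Fin d) (Fin d) ℝ} {x : Z → E d}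
    (hM : ∀ i j, Continuous fun z => M z i j) (hx : Continuous x) :
    Continuous fun z => mulV (M z) (x z) := by
  have hM' : Continuous M := continuous_pi fun i => continuous_pi fun j => hM i j
  unfold mulV
  fun_prop

lemma continuous_relu : Continuous (relu : E d → E d) := by
  unfold relu
  fun_prop

/-- Entrywise continuity of a map into the parameter space. -/
structure ContinuousParams (p : Z → Params d) : Prop where
  V : ∀ i j, Continuous fun z => (p z).V i j
  B : ∀ i j, Continuous fun z => (p z).B i j
  W : ∀ i j, Continuous fun z => (p z).W i j
  U : ∀ i j, Continuous fun z => (p z).U i j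
  b : ∀ i, Continuous fun z => (p z).b i

lemma ContinuousParams.comp {Z' : Type*} [TopologicalSpace Z'] {p : Z → Params d}
    (hp : ContinuousParams p) {g : Z' → Z} (hg : Continuous g) :
    ContinuousParams fun z => p (g z) :=
  ⟨fun i j => (hp.V i j).comp hg, fun i j => (hp.B i j).comp hg, fun i j => (hp.W i j).comp hg,
    fun i j => (hp.U i j).comp hg, fun i => (hp.b i).comp hg⟩

lemma continuous_attention {B : Z → Matrix (Fin d) (Fin d) ℝ}
    (hB : ∀ i j, Continuous fun z => B z i j) {ν : Z → ProbabilityMeasure (S d)}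
    (hν : Continuous ν) {x : Z → E d} (hx : Continuous x) :
    Continuous fun z => attention (B z) (ν z) (x z) := by
  have hBx := continuous_mulV hB hx
  have hc : Continuous fun q : Z × S d => Real.exp ⟪mulV (B q.1) (x q.1), (q.2 : E d)⟫ := by
    have : Continuous fun q : Z × S d => mulV (B q.1) (x q.1) := hBx.comp continuous_fst
    fun_prop
  refine Continuous.smul (Continuous.inv₀ (continuous_integral_of_continuous_real hc hν) fun z => ?_)
    (continuous_integral_of_continuous (f := fun z (y : S d) =>
      Real.exp ⟪mulV (B z) (x z), (y : E d)⟫ • (y : E d)) ?_ hν)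
  · have hcz : Continuous fun y : S d => Real.exp ⟪mulV (B z) (x z), (y : E d)⟫ := by fun_prop
    refine (integral_exp_pos (Integrable.of_bound hcz.aestronglyMeasurable
      ‖(⟨_, hcz⟩ : C(S d, ℝ))‖ (.of_forall (⟨_, hcz⟩ : C(S d, ℝ)).norm_coe_le_norm))).ne'
  · exact hc.smul (continuous_subtype_val.comp continuous_snd)

lemma continuous_vField {p : Z → Params d} (hp : ContinuousParams p)
    {ν : Z → ProbabilityMeasure (S d)} (hν : Continuous ν) {x : Z → E d} (hx : Continuous x) :
    Continuous fun z => vField (p z) (ν z) (x z) := by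
  have hb : Continuous fun z => (p z).b :=
    (PiLp.continuous_toLp 2 (fun _ : Fin d => ℝ)).comp (continuous_pi hp.b)
  have h1 := continuous_mulV hp.V (continuous_attention hp.B hν hx)
  have h2 := continuous_mulV hp.W (continuous_relu.comp ((continuous_mulV hp.U hx).add hb))
  have h3 : Continuous fun z => mulV (p z).V (attention (p z).B (ν z) (x z)) +
      mulV (p z).W (relu (mulV (p z).U (x z) + (p z).b)) := h1.add h2
  unfold vField tanProj
  fun_prop

/-- The pairing of `∇φ` with the flux `ν v[ν]`. -/
def pairing (φ : E d → ℝ) (p : Params d) (ν : ProbabilityMeasure (S d)) : ℝ :=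
  ∫ x : S d, fderiv ℝ φ (x : E d) (vField p ν (x : E d)) ∂(ν : Measure (S d))

lemma continuous_pairing {φ : E d → ℝ} (hφ : ContDiff ℝ ∞ φ) {p : Z → Params d}
    (hp : ContinuousParams p) {ν : Z → ProbabilityMeasure (S d)} (hν : Continuous ν) :
    Continuous fun z => pairing φ (p z) (ν z) := by
  have hφ' : Continuous (fderiv ℝ φ) := hφ.continuous_fderiv (by simp)
  refine continuous_integral_of_continuous_real (f := fun z (x : S d) =>
    fderiv ℝ φ (x : E d) (vField (p z) (ν z) (x : E d))) ?_ hν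
  have h1 : Continuous fun q : Z × S d => vField (p q.1) (ν q.1) (q.2 : E d) :=
    continuous_vField (hp.comp continuous_fst) (hν.comp continuous_fst)
      (continuous_subtype_val.comp continuous_snd)
  exact (hφ'.comp (continuous_subtype_val.comp continuous_snd)).clm_apply h1

end continuity

section integrability
variable {d : ℕ} {T : ℝ}

lemma IsLinfty.exists_boundedBy {θ : ℝ → Params d} (h : IsLinfty T θ) :
    ∃ R, 0 ≤ R ∧ ∀ᵐ t ∂(volume.restrict (Ioo 0 T)), (θ t).BoundedBy R := by
  have key : ∀ f : ℝ → ℝ, MemLp f ∞ (volume.restrict (Ioo 0 T)) →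
      ∃ C, 0 ≤ C ∧ ∀ᵐ t ∂(volume.restrict (Ioo 0 T)), |f t| ≤ C := fun f hf => by
    refine ⟨lpNorm f ∞ (volume.restrict (Ioo 0 T)), lpNorm_nonneg, ?_⟩
    simpa using ae_le_lpNorm_exponent_top hf
  obtain ⟨hV, hB, hW, hU, hb⟩ := h
  choose cV pV aV using fun i j => key _ (hV i j)
  choose cB pB aB using fun i j => key _ (hB i j)
  choose cW pW aW using fun i j => key _ (hW i j)
  choose cU pU aU using fun i j => key _ (hU i j)
  choose cb pb ab using fun i => key _ (hb i)
  have le2 : ∀ c : Fin d → Fin d → ℝ, (∀ i j, 0 ≤ c i j) → ∀ i j, c i j ≤ ∑ i, ∑ j, c i j :=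
    fun c hc i j => (Finset.single_le_sum (f := fun j => c i j) (fun j _ => hc i j)
      (Finset.mem_univ j)).trans (Finset.single_le_sum (f := fun i => ∑ j, c i j)
      (fun i _ => Finset.sum_nonneg fun j _ => hc i j) (Finset.mem_univ i))
  have nn : ∀ c : Fin d → Fin d → ℝ, (∀ i j, 0 ≤ c i j) → 0 ≤ ∑ i, ∑ j, c i j := fun c hc =>
    Finset.sum_nonneg fun i _ => Finset.sum_nonneg fun j _ => hc i j
  have nV := nn cV pV
  have nB := nn cB pB
  have nW := nn cW pW
  have nU := nn cU pU
  have nb : 0 ≤ ∑ i, cb i := Finset.sum_nonneg fun i _ => pb i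
  refine ⟨(∑ i, ∑ j, cV i j) + (∑ i, ∑ j, cB i j) + (∑ i, ∑ j, cW i j) + (∑ i, ∑ j, cU i j) +
    ∑ i, cb i, by positivity, ?_⟩
  filter_upwards [ae_all_iff.2 fun i => ae_all_iff.2 (aV i), ae_all_iff.2 fun i => ae_all_iff.2 (aB i),
    ae_all_iff.2 fun i => ae_all_iff.2 (aW i), ae_all_iff.2 fun i => ae_all_iff.2 (aU i),
    ae_all_iff.2 ab] with t h1 h2 h3 h4 h5
  refine ⟨fun i j => ?_, fun i j => ?_, fun i j => ?_, fun i j => ?_, fun i => ?_⟩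
  · linarith [h1 i j, le2 cV pV i j]
  · linarith [h2 i j, le2 cB pB i j]
  · linarith [h3 i j, le2 cW pW i j]
  · linarith [h4 i j, le2 cU pU i j]
  · linarith [h5 i, Finset.single_le_sum (f := cb) (fun i _ => pb i) (Finset.mem_univ i)]

lemma aestronglyMeasurable_pairing {θ : ℝ → Params d} (h : IsLinfty T θ)
    {ν : ℝ → ProbabilityMeasure (S d)} (hν : ContinuousOn ν (Icc 0 T)) {φ : E d → ℝ}
    (hφ : ContDiff ℝ ∞ φ) :
    AEStronglyMeasurable (fun t => pairing φ (θ t) (ν t)) (volume.restrict (Ioo 0 T)) := by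
  -- The pairing is a continuous function of the parameter entries and the measure together;
  -- measurability in time follows by composition.
  let M := Fin d → Fin d → ℝ
  let Z := (M × M × M × M × (Fin d → ℝ)) × ProbabilityMeasure (S d)
  let p : Z → Params d := fun z => ⟨Matrix.of z.1.1, Matrix.of z.1.2.1, Matrix.of z.1.2.2.1,
    Matrix.of z.1.2.2.2.1, WithLp.toLp 2 z.1.2.2.2.2⟩
  have hp : ContinuousParams p := by
    constructor <;> intros <;> simp only [p, Matrix.of_apply] <;> fun_prop
  have hc := continuous_pairing hφ hp (continuous_snd : Continuous fun z : Z => z.2)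
  have mat : ∀ f : ℝ → Matrix (Fin d) (Fin d) ℝ,
      (∀ i j, MemLp (fun t => f t i j) ∞ (volume.restrict (Ioo 0 T))) →
      AEStronglyMeasurable (fun t i j => f t i j) (volume.restrict (Ioo 0 T)) := fun f hf =>
    (aemeasurable_pi_lambda _ fun i => aemeasurable_pi_lambda _ fun j =>
      (hf i j).1.aemeasurable).aestronglyMeasurable
  have hb : AEStronglyMeasurable (fun t i => (θ t).b i) (volume.restrict (Ioo 0 T)) :=
    (aemeasurable_pi_lambda _ fun i => (h.2.2.2.2 i).1.aemeasurable).aestronglyMeasurable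
  have hν' : AEStronglyMeasurable ν (volume.restrict (Ioo 0 T)) :=
    (hν.mono Ioo_subset_Icc_self).aestronglyMeasurable measurableSet_Ioo
  exact hc.comp_aestronglyMeasurable (((mat _ h.1).prodMk ((mat _ h.2.1).prodMk
    ((mat _ h.2.2.1).prodMk ((mat _ h.2.2.2.1).prodMk hb)))).prodMk hν')

lemma exists_norm_vField_le (R : ℝ) :
    ∃ C, 0 ≤ C ∧ ∀ p : Params d, p.BoundedBy R → ∀ (ν : ProbabilityMeasure (S d)) (x : S d),
      ‖vField p ν (x : E d)‖ ≤ C := by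
  obtain ⟨C, hC, h⟩ := UBL_vField (d := d) R
  refine ⟨C, hC, fun p hp ν x => ?_⟩
  have := (h (⟨p, hp⟩, ν)).1 (x : E d)
  beta_reduce at this
  rwa [retr_of_norm_le (norm_coe x).le] at this

lemma abs_pairing_le {C M : ℝ} {φ : E d → ℝ} (hφ : ∀ x : S d, ‖fderiv ℝ φ (x : E d)‖ ≤ M) {p : Params d}
    {ν : ProbabilityMeasure (S d)} (h : ∀ x : S d, ‖vField p ν (x : E d)‖ ≤ C) (hM : 0 ≤ M) :
    |pairing φ p ν| ≤ M * C := by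
  have := norm_integral_le_of_norm_le_const (μ := (ν : Measure (S d)))
    (f := fun x : S d => fderiv ℝ φ (x : E d) (vField p ν (x : E d))) (C := M * C)
    (.of_forall fun x => ((fderiv ℝ φ (x : E d)).le_opNorm _).trans
      (mul_le_mul (hφ x) (h x) (norm_nonneg _) hM))
  simpa [pairing] using this

lemma exists_norm_fderiv_le {φ : E d → ℝ} (hφ : ContDiff ℝ ∞ φ) :
    ∃ M, 0 ≤ M ∧ ∀ x : S d, ‖fderiv ℝ φ (x : E d)‖ ≤ M := by
  have hφ' : Continuous fun x : S d => fderiv ℝ φ (x : E d) :=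
    (hφ.continuous_fderiv (by simp)).comp continuous_subtype_val
  let k : C(S d, E d →L[ℝ] ℝ) := ⟨_, hφ'⟩
  exact ⟨‖k‖, norm_nonneg k, k.norm_coe_le_norm⟩

lemma intervalIntegrable_pairing {θ : ℝ → Params d} (h : IsLinfty T θ)
    {ν : ℝ → ProbabilityMeasure (S d)} (hν : ContinuousOn ν (Icc 0 T)) {φ : E d → ℝ}
    (hφ : ContDiff ℝ ∞ φ) {a b : ℝ} (ha : a ∈ Icc 0 T) (hb : b ∈ Icc 0 T) :
    IntervalIntegrable (fun t => pairing φ (θ t) (ν t)) volume a b := by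
  obtain ⟨R, hR, hθ⟩ := h.exists_boundedBy
  obtain ⟨C, hC, hv⟩ := exists_norm_vField_le (d := d) R
  obtain ⟨M, hM, hφM⟩ := exists_norm_fderiv_le hφ
  have h0T : (0:ℝ) ≤ T := ha.1.trans ha.2
  have hi : IntegrableOn (fun t => pairing φ (θ t) (ν t)) (Ioo 0 T) :=
    Integrable.of_bound (aestronglyMeasurable_pairing h hν hφ) (M * C) (by
      filter_upwards [hθ] with t ht using abs_pairing_le hφM (hv _ ht (ν t)) hM)
  have : IntervalIntegrable (fun t => pairing φ (θ t) (ν t)) volume 0 T := by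
    rwa [intervalIntegrable_iff_integrableOn_Ioo_of_le h0T]
  exact this.mono_set (by rw [uIcc_of_le h0T]; exact uIcc_subset_Icc ha hb)

end integrability

end Transformer

end

/-! ### Mollified Lipschitz test functions. -/

noncomputable section

namespace Transformer

section mollifier
variable {d : ℕ} (b : ContDiffBump (0 : E d))

/-- Mollification of a function by a normalised bump. -/
def moll (u : E d → ℝ) : E d → ℝ :=
  convolution (b.normed volume) u (ContinuousLinearMap.lsmul ℝ ℝ) volume

lemma moll_apply (u : E d → ℝ) (x : E d) :
    moll b u x = ∫ t, b.normed volume t * u (x - t) := rfl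

lemma integrable_moll {u : E d → ℝ} (hu : Continuous u) (x : E d) :
    Integrable fun t => b.normed volume t * u (x - t) :=
  (b.continuous_normed.mul (hu.comp (continuous_const.sub continuous_id))).integrable_of_hasCompactSupport
    (b.hasCompactSupport_normed.mul_right)

lemma contDiff_moll {u : E d → ℝ} (hu : Continuous u) : ContDiff ℝ ∞ (moll b u) :=
  b.hasCompactSupport_normed.contDiff_convolution_left _ b.contDiff_normed hu.locallyIntegrable

/-- Comparing a mollification with a translate of another one. -/
lemma abs_moll_sub_moll_le {u v : E d → ℝ} (hu : Continuous u) (hv : Continuous v) {x y : E d}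
    {K : ℝ} (h : ∀ t, ‖t‖ ≤ b.rOut → |u (x - t) - v (y - t)| ≤ K) :
    |moll b u x - moll b v y| ≤ K := by
  rw [moll_apply, moll_apply, ← integral_sub (integrable_moll b hu x) (integrable_moll b hv y)]
  have hb : ∫ t : E d, b.normed volume t * K = K := by
    rw [integral_mul_const, b.integral_normed, one_mul]
  rw [← Real.norm_eq_abs]
  refine (norm_integral_le_of_norm_le (g := fun t => b.normed volume t * K)
    (b.integrable_normed.mul_const K) (.of_forall fun t => ?_)).trans hb.le
  rw [← mul_sub, norm_mul, Real.norm_of_nonneg (b.nonneg_normed t)]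
  by_cases ht : ‖t‖ ≤ b.rOut
  · exact mul_le_mul_of_nonneg_left (h t ht) (b.nonneg_normed t)
  · have : b.normed volume t = 0 := by
      rw [← Function.notMem_support, b.support_normed_eq, mem_ball_zero_iff]
      exact fun hlt => ht hlt.le
    simp [this]

lemma abs_moll_sub_le {u : E d → ℝ} (hu : LipschitzWith 1 u) (x : E d) :
    |moll b u x - u x| ≤ b.rOut := by
  have h0 : moll b (fun _ => u x) x = u x := by
    rw [moll_apply, integral_mul_const, b.integral_normed, one_mul]
  rw [← h0]
  refine abs_moll_sub_moll_le b hu.continuous continuous_const fun t ht => ?_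
  have := hu.dist_le_mul (x - t) x
  rw [Real.dist_eq] at this
  refine this.trans ?_
  simpa [dist_eq_norm] using ht

lemma lipschitzWith_moll {u : E d → ℝ} (hu : LipschitzWith 1 u) : LipschitzWith 1 (moll b u) :=
  LipschitzWith.of_dist_le_mul fun x y => by
    rw [Real.dist_eq]
    refine abs_moll_sub_moll_le b hu.continuous hu.continuous fun t _ => ?_
    simpa [Real.dist_eq] using hu.dist_le_mul (x - t) (y - t)

lemma moll_const_mul (c : ℝ) (u : E d → ℝ) (x : E d) :
    moll b (fun y => c * u y) x = c * moll b u x := by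
  rw [moll_apply, moll_apply, ← integral_const_mul]
  congr 1; ext t; ring

lemma norm_fderiv_moll_le {u : E d → ℝ} (hu : LipschitzWith 1 u) (x : E d) :
    ‖fderiv ℝ (moll b u) x‖ ≤ 1 := by
  simpa using norm_fderiv_le_of_lipschitz ℝ (lipschitzWith_moll b hu) (x₀ := x)

/-- The derivative falls on the bump and the increment on `u`, so the constant depends on the bump
alone and not on `u`. -/
lemma exists_lipschitz_fderiv_moll : ∃ C, 0 ≤ C ∧ ∀ u : E d → ℝ, LipschitzWith 1 u → ∀ x y,
    ‖fderiv ℝ (moll b u) x - fderiv ℝ (moll b u) y‖ ≤ C * ‖x - y‖ := by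
  set η := b.normed (volume : Measure (E d))
  set Λ := (ContinuousLinearMap.lsmul ℝ ℝ : ℝ →L[ℝ] ℝ →L[ℝ] ℝ).precompL (E d)
  have hη : ContDiff ℝ 1 η := b.contDiff_normed
  have hη' : Continuous (fderiv ℝ η) := hη.continuous_fderiv one_ne_zero
  have hcs : HasCompactSupport (fderiv ℝ η) := b.hasCompactSupport_normed.fderiv (𝕜 := ℝ)
  have hi : Integrable fun t => ‖fderiv ℝ η t‖ := (hη'.integrable_of_hasCompactSupport hcs).norm
  have hΛ : ∀ (a : E d →L[ℝ] ℝ) (r : ℝ), Λ a r = r • a := fun a r => by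
    ext v; simp [Λ, ContinuousLinearMap.precompL_apply, mul_comm]
  refine ⟨∫ t, ‖fderiv ℝ η t‖, integral_nonneg fun _ => norm_nonneg _, fun u hu x y => ?_⟩
  have hd : ∀ x, fderiv ℝ (moll b u) x = ∫ t, Λ (fderiv ℝ η t) (u (x - t)) := fun x =>
    (b.hasCompactSupport_normed.hasFDerivAt_convolution_left _ hη hu.continuous.locallyIntegrable
      x).fderiv
  have hint : ∀ x, Integrable fun t => Λ (fderiv ℝ η t) (u (x - t)) := fun x =>
    hcs.convolutionExists_left Λ hη' hu.continuous.locallyIntegrable x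
  rw [hd, hd, ← integral_sub (hint x) (hint y)]
  refine (norm_integral_le_of_norm_le (g := fun t => ‖fderiv ℝ η t‖ * ‖x - y‖)
    (hi.mul_const _) (.of_forall fun t => ?_)).trans (le_of_eq ?_)
  · rw [← map_sub, hΛ, norm_smul, mul_comm]
    gcongr
    simpa [dist_eq_norm] using hu.dist_le_mul (x - t) (y - t)
  · rw [integral_mul_const]

lemma exists_taylor_moll : ∃ C, 0 ≤ C ∧ ∀ u : E d → ℝ, LipschitzWith 1 u → ∀ x k,
    |moll b u (x + k) - moll b u x - fderiv ℝ (moll b u) x k| ≤ C * ‖k‖ ^ 2 := by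
  obtain ⟨C, hC, h⟩ := exists_lipschitz_fderiv_moll b
  refine ⟨C, hC, fun u hu x k => ?_⟩
  have := (convex_closedBall x ‖k‖).norm_image_sub_le_of_norm_fderiv_le' (𝕜 := ℝ) (f := moll b u)
    (φ := fderiv ℝ (moll b u) x) (C := C * ‖k‖) (x := x) (y := x + k)
    (fun z _ => ((contDiff_moll b hu.continuous).differentiable (by simp)) z)
    (fun z hz => (h u hu z x).trans (by
      gcongr; simpa [dist_eq_norm] using hz)) (by simp) (by simp)
  simp only [add_sub_cancel_left, Real.norm_eq_abs] at this
  rw [pow_two, ← mul_assoc]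
  exact this

end mollifier

/-! ### The Kantorovich–Rubinstein distance, and stability of attention with respect to it. -/

section KR
variable {d : ℕ}

/-- The Kantorovich–Rubinstein distance of `ν` and `μ` is at most `Δ`. -/
def KRLe (ν μ : ProbabilityMeasure (S d)) (Δ : ℝ) : Prop :=
  ∀ u : E d → ℝ, LipschitzWith 1 u →
    |(∫ x : S d, u x ∂(ν : Measure (S d))) - ∫ x : S d, u x ∂(μ : Measure (S d))| ≤ Δ

lemma integrable_sphere {F : Type*} [NormedAddCommGroup F] {f : S d → F}
    (hf : Continuous f) [SecondCountableTopologyEither (S d) F] (μ : ProbabilityMeasure (S d)) :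
    Integrable f (μ : Measure (S d)) :=
  let k : C(S d, F) := ⟨f, hf⟩
  Integrable.of_bound hf.aestronglyMeasurable ‖k‖ (.of_forall k.norm_coe_le_norm)

lemma KRLe.nonneg {ν μ : ProbabilityMeasure (S d)} {Δ : ℝ} (h : KRLe ν μ Δ) : 0 ≤ Δ :=
  (abs_nonneg _).trans (h (fun _ => 0) (LipschitzWith.const 0 |>.weaken zero_le_one))

lemma KRLe.abs_sub_le {ν μ : ProbabilityMeasure (S d)} {Δ : ℝ} (h : KRLe ν μ Δ) {f : E d → ℝ}
    {C : ℝ} (hC : 0 ≤ C) (hf : ∀ x y, ‖f x - f y‖ ≤ C * dist x y) :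
    |(∫ x : S d, f x ∂(ν : Measure (S d))) - ∫ x : S d, f x ∂(μ : Measure (S d))| ≤ (C + 1) * Δ := by
  -- Dividing by `C + 1` rather than `C` covers `C = 0`.
  have hl : LipschitzWith 1 fun x => (C + 1)⁻¹ * f x := by
    refine LipschitzWith.of_dist_le_mul fun x y => ?_
    rw [dist_eq_norm, ← mul_sub, norm_mul, norm_inv, Real.norm_of_nonneg (by linarith : 0 ≤ C + 1)]
    rw [inv_mul_le_iff₀ (by linarith)]
    refine (hf x y).trans ?_
    rw [NNReal.coe_one, one_mul]
    exact mul_le_mul_of_nonneg_right (by linarith) dist_nonneg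
  have := h _ hl
  rw [integral_const_mul, integral_const_mul, ← mul_sub, abs_mul, abs_inv,
    abs_of_nonneg (by linarith : 0 ≤ C + 1), inv_mul_le_iff₀ (by linarith)] at this
  exact this

/-- The vector-valued estimate reduces to the scalar one by testing against the unit vector along
the difference of the integrals. -/
lemma KRLe.norm_sub_le {ν μ : ProbabilityMeasure (S d)} {Δ : ℝ} (h : KRLe ν μ Δ) {f : E d → E d}
    {C : ℝ} (hC : 0 ≤ C) (hf : ∀ x y, ‖f x - f y‖ ≤ C * dist x y) :
    ‖(∫ x : S d, f x ∂(ν : Measure (S d))) - ∫ x : S d, f x ∂(μ : Measure (S d))‖ ≤ (C + 1) * Δ := by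
  have hcf : Continuous f := (LipschitzWith.of_dist_le_mul (K := ⟨C, hC⟩) fun x y => by
    rw [dist_eq_norm]; exact hf x y).continuous
  have hi : ∀ ρ : ProbabilityMeasure (S d), Integrable (fun x : S d => f x) (ρ : Measure (S d)) :=
    fun ρ => integrable_sphere (hcf.comp continuous_subtype_val) ρ
  set w := (∫ x : S d, f x ∂(ν : Measure (S d))) - ∫ x : S d, f x ∂(μ : Measure (S d))
  rcases eq_or_ne w 0 with hw | hw
  · rw [hw, norm_zero]; exact mul_nonneg (by linarith) h.nonneg
  have hw' : 0 < ‖w‖ := norm_pos_iff.2 hw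
  set e : E d := ‖w‖⁻¹ • w
  have he : ‖e‖ = 1 := by simp [e, norm_smul, hw'.ne']
  have hwe : ‖w‖ = ⟪e, w⟫ := by
    simp only [e, real_inner_smul_left, real_inner_self_eq_norm_sq]
    field_simp
  have h2 := h.abs_sub_le (f := fun x => ⟪e, f x⟫) hC fun x y => by
    rw [← inner_sub_right]
    refine (norm_inner_le_norm _ _).trans ?_
    rw [he, one_mul]
    exact hf x y
  rw [integral_inner (hi ν), integral_inner (hi μ), ← inner_sub_right] at h2
  rw [hwe]
  exact (le_abs_self _).trans h2

/-- The tilted mean is an average of `Y` against a probability density, so it stays in any closed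
ball that contains almost all of `Y`. -/
lemma norm_tilt_le {S' : Type*} [MeasurableSpace S'] {μ : Measure S'} [IsProbabilityMeasure μ]
    {Y : S' → E d} {ξ p : E d} {r : ℝ} (hY : ∀ᵐ y ∂μ, ‖Y y - p‖ ≤ r)
    (hi : Integrable (fun y => Real.exp ⟪ξ, Y y⟫) μ)
    (hi' : Integrable (fun y => Real.exp ⟪ξ, Y y⟫ • Y y) μ) : ‖tilt μ Y ξ - p‖ ≤ r := by
  have hpos := integral_exp_pos hi
  have e : tilt μ Y ξ - p = (∫ y, Real.exp ⟪ξ, Y y⟫ ∂μ)⁻¹ •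
      ∫ y, Real.exp ⟪ξ, Y y⟫ • (Y y - p) ∂μ := by
    simp only [smul_sub]
    rw [integral_sub hi' (hi.smul_const p), smul_sub, integral_smul_const, smul_smul,
      inv_mul_cancel₀ hpos.ne', one_smul, tilt]
  rw [e, norm_smul, norm_inv, Real.norm_of_nonneg hpos.le, inv_mul_le_iff₀ hpos, mul_comm]
  rw [mul_comm, ← integral_mul_const]
  refine norm_integral_le_of_norm_le (hi.mul_const r) ?_
  filter_upwards [hY] with y hy
  rw [norm_smul, Real.norm_eq_abs, Real.abs_exp]
  gcongr

/-- Numerator and denominator are integrals of Lipschitz functions, hence controlled separately by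
the distance. They recombine through `β(A - A') = (βA - β'A') - (β - β')A'`, with `‖A'‖ ≤ 1` and `β
≥ exp (-K)`. -/
lemma exists_norm_attention_sub_le (K : ℝ) : ∃ C, 0 ≤ C ∧
    ∀ (B : Matrix (Fin d) (Fin d) ℝ) (x : E d) (ν μ : ProbabilityMeasure (S d)) (Δ : ℝ),
      ‖mulV B x‖ ≤ K → KRLe ν μ Δ → ‖attention B ν x - attention B μ x‖ ≤ C * Δ := by
  have h0 : UBL fun (y : E d) (ξ : {ξ : E d // ‖ξ‖ ≤ K}) => Real.exp ⟪(ξ : E d), retr y⟫ :=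
    ((UBL.const K fun ξ => ξ.2).inner UBL_retr).exp
  have h1 : UBL fun (y : E d) (ξ : {ξ : E d // ‖ξ‖ ≤ K}) => Real.exp ⟪(ξ : E d), retr y⟫ • retr y :=
    h0.smul UBL_retr
  obtain ⟨C₀, hC₀, h0⟩ := h0
  obtain ⟨C₁, hC₁, h1⟩ := h1
  refine ⟨Real.exp K * ((C₁ + 1) + (C₀ + 1)), by positivity, fun B x ν μ Δ hBx h => ?_⟩
  set ξ := mulV B x
  have e0 := h.abs_sub_le hC₀ (h0 ⟨ξ, hBx⟩).2
  have e1 := h.norm_sub_le hC₁ (h1 ⟨ξ, hBx⟩).2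
  have hr : ∀ y : S d, retr (y : E d) = y := fun y => retr_of_norm_le (norm_coe y).le
  simp only [hr] at e0 e1
  have hc : Continuous fun y : S d => Real.exp ⟪ξ, (y : E d)⟫ := by fun_prop
  have hc' : Continuous fun y : S d => Real.exp ⟪ξ, (y : E d)⟫ • (y : E d) := by fun_prop
  have hi := fun ρ : ProbabilityMeasure (S d) => integrable_sphere hc ρ
  have hi' := fun ρ : ProbabilityMeasure (S d) => integrable_sphere hc' ρ
  have hA : ‖attention B μ x‖ ≤ 1 := by
    simpa [attention_eq_tilt] using norm_tilt_le (μ := (μ : Measure (S d)))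
      (Y := fun y : S d => (y : E d)) (ξ := ξ) (p := 0) (r := 1) (by simp) (hi μ) (hi' μ)
  have hlow : Real.exp (-K) ≤ ∫ y : S d, Real.exp ⟪ξ, (y : E d)⟫ ∂(ν : Measure (S d)) := by
    have : ∫ _y : S d, Real.exp (-K) ∂(ν : Measure (S d)) ≤
        ∫ y : S d, Real.exp ⟪ξ, (y : E d)⟫ ∂(ν : Measure (S d)) := by
      refine integral_mono (integrable_const _) (hi ν) fun y => Real.exp_le_exp.2 ?_
      have := abs_real_inner_le_norm ξ (y : E d)
      rw [norm_coe, mul_one] at this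
      exact neg_le_of_abs_le (this.trans hBx)
    simpa using this
  have hpν := integral_exp_pos (hi ν)
  have hpμ := integral_exp_pos (hi μ)
  have hq : (∫ y : S d, Real.exp ⟪ξ, (y : E d)⟫ • (y : E d) ∂(μ : Measure (S d))) =
      (∫ y : S d, Real.exp ⟪ξ, (y : E d)⟫ ∂(μ : Measure (S d))) • attention B μ x := by
    rw [attention, smul_smul, mul_inv_cancel₀ hpμ.ne', one_smul]
  have hp : (∫ y : S d, Real.exp ⟪ξ, (y : E d)⟫ • (y : E d) ∂(ν : Measure (S d))) =
      (∫ y : S d, Real.exp ⟪ξ, (y : E d)⟫ ∂(ν : Measure (S d))) • attention B ν x := by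
    rw [attention, smul_smul, mul_inv_cancel₀ hpν.ne', one_smul]
  rw [hp, hq] at e1
  set β := ∫ y : S d, Real.exp ⟪ξ, (y : E d)⟫ ∂(ν : Measure (S d))
  set β' := ∫ y : S d, Real.exp ⟪ξ, (y : E d)⟫ ∂(μ : Measure (S d))
  have e2 : β • (attention B ν x - attention B μ x) =
      (β • attention B ν x - β' • attention B μ x) - (β - β') • attention B μ x := by
    rw [smul_sub, sub_smul]; abel
  have e3 : β * ‖attention B ν x - attention B μ x‖ ≤ ((C₁ + 1) + (C₀ + 1)) * Δ := by
    rw [← Real.norm_of_nonneg hpν.le, ← norm_smul, e2]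
    refine (_root_.norm_sub_le _ _).trans ?_
    rw [norm_smul, add_mul]
    refine add_le_add e1 (le_trans ?_ e0)
    exact mul_le_of_le_one_right (norm_nonneg _) hA
  have e4 : Real.exp (-K) * ‖attention B ν x - attention B μ x‖ ≤ ((C₁ + 1) + (C₀ + 1)) * Δ :=
    (mul_le_mul_of_nonneg_right hlow (norm_nonneg _)).trans e3
  rw [Real.exp_neg, inv_mul_le_iff₀ (Real.exp_pos K)] at e4
  linarith

lemma exists_norm_vField_sub_le {R : ℝ} (hR : 0 ≤ R) : ∃ C, 0 ≤ C ∧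
    ∀ (p : Params d) (x : S d) (ν μ : ProbabilityMeasure (S d)) (Δ : ℝ),
      p.BoundedBy R → KRLe ν μ Δ → ‖vField p ν (x : E d) - vField p μ (x : E d)‖ ≤ C * Δ := by
  obtain ⟨C, hC, h⟩ := exists_norm_attention_sub_le (d := d) (d * d * R)
  refine ⟨d * d * R * C, by positivity, fun p x ν μ Δ hp hΔ => ?_⟩
  have h1 := h p.B x ν μ Δ (by simpa using norm_mulV_le hR hp.B (x : E d)) hΔ
  rw [vField, vField, ← tanProj_sub, add_sub_add_right_eq_sub, ← mulV_sub]
  refine (norm_tanProj_le_of_unit (norm_coe x) _).trans ((norm_mulV_le hR hp.V _).trans ?_)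
  rw [mul_assoc (d * d * R : ℝ)]
  exact mul_le_mul_of_nonneg_left h1 (by positivity)

/-- Measures whose Lipschitz integrals agree are equal. -/
lemma eq_of_forall_lipschitz {ν μ : ProbabilityMeasure (S d)} (h : KRLe ν μ 0) : ν = μ := by
  classical
  have key : ∀ f : S d → ℝ, (∃ L, LipschitzWith L f) →
      ∫ x, f x ∂(ν : Measure (S d)) = ∫ x, f x ∂(μ : Measure (S d)) := by
    rintro f ⟨L, hf⟩
    -- The junk value 0 off the sphere is harmless: only the restriction to the sphere is Lipschitz,
    -- and that restriction is extended to the whole space.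
    let f' : E d → ℝ := fun x => if hx : x ∈ Metric.sphere (0 : E d) 1 then f ⟨x, hx⟩ else 0
    have hf' : LipschitzOnWith L f' (Metric.sphere (0 : E d) 1) := by
      refine LipschitzOnWith.of_dist_le_mul fun x hx y hy => ?_
      simp only [f', dif_pos hx, dif_pos hy]
      exact hf.dist_le_mul ⟨x, hx⟩ ⟨y, hy⟩
    obtain ⟨g, hg, hfg⟩ := hf'.extend_real
    have hgx : ∀ x : S d, f x = g x := fun x => by
      rw [← hfg x.2]
      simp only [f', dif_pos x.2, Subtype.coe_eta]
    simp only [hgx]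
    have := h.abs_sub_le (f := g) L.2 fun x y => by
      rw [← dist_eq_norm]; exact hg.dist_le_mul x y
    rw [mul_zero] at this
    exact sub_eq_zero.1 (abs_eq_zero.1 (this.antisymm (abs_nonneg _)))
  -- Lipschitz test functions detect weak convergence; a constant sequence converging to `μ` must be
  -- `μ`, since weak limits are unique.
  have ht : Tendsto (fun _ : ℕ => ν) atTop (𝓝 μ) := by
    refine tendsto_iff_forall_lipschitz_integral_tendsto.2 fun f _ hf => ?_
    rw [key f hf]
    exact tendsto_const_nhds
  exact tendsto_nhds_unique tendsto_const_nhds ht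

end KR

end Transformer

end

/-! ### Uniqueness of weak solutions. -/

noncomputable section

namespace Transformer

variable {d : ℕ}

/-- The difference of two measures, tested against a mollified function. -/
def mollGap (b : ContDiffBump (0 : E d)) (ν μ : ProbabilityMeasure (S d)) (u : E d → ℝ) : ℝ :=
  (∫ x : S d, moll b u x ∂(ν : Measure (S d))) - ∫ x : S d, moll b u x ∂(μ : Measure (S d))

lemma abs_integral_sub_le {ν : ProbabilityMeasure (S d)} {f g : S d → ℝ} (hf : Continuous f)
    (hg : Continuous g) {K : ℝ} (h : ∀ x, |f x - g x| ≤ K) :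
    |(∫ x, f x ∂(ν : Measure (S d))) - ∫ x, g x ∂(ν : Measure (S d))| ≤ K := by
  rw [← integral_sub (integrable_sphere hf ν) (integrable_sphere hg ν)]
  simpa using norm_integral_le_of_norm_le_const (μ := (ν : Measure (S d)))
    (f := fun x => f x - g x) (.of_forall h)

lemma mollGap_const_mul (b : ContDiffBump (0 : E d)) (ν μ : ProbabilityMeasure (S d)) (c : ℝ)
    (u : E d → ℝ) : mollGap b ν μ (fun y => c * u y) = c * mollGap b ν μ u := by
  simp only [mollGap, moll_const_mul, integral_const_mul, mul_sub]

lemma lipschitzWith_neg_one_mul {u : E d → ℝ} (hu : LipschitzWith 1 u) :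
    LipschitzWith 1 fun y => (-1) * u y := by
  refine LipschitzWith.of_dist_le_mul fun x y => ?_
  simpa [dist_eq_norm, abs_sub_comm, neg_add_eq_sub] using hu.dist_le_mul x y

lemma continuous_moll_sphere (b : ContDiffBump (0 : E d)) {u : E d → ℝ} (hu : Continuous u) :
    Continuous fun x : S d => moll b u x :=
  (contDiff_moll b hu).continuous.comp continuous_subtype_val

/-- Mollifying a 1-Lipschitz function moves it by at most `b.rOut`, once for each measure; `-u`
gives the other sign. -/
lemma KRLe_of_mollGap_le {b : ContDiffBump (0 : E d)} {ν μ : ProbabilityMeasure (S d)} {D : ℝ}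
    (hD : ∀ u, LipschitzWith 1 u → mollGap b ν μ u ≤ D) : KRLe ν μ (D + 2 * b.rOut) := by
  have one : ∀ u : E d → ℝ, LipschitzWith 1 u →
      (∫ x : S d, u x ∂(ν : Measure (S d))) - ∫ x : S d, u x ∂(μ : Measure (S d)) ≤
        D + 2 * b.rOut := fun u hu => by
    have h := fun ρ : ProbabilityMeasure (S d) => abs_le.1 <| abs_integral_sub_le (ν := ρ)
      (continuous_moll_sphere b hu.continuous) (hu.continuous.comp continuous_subtype_val)
      fun x => abs_moll_sub_le b hu (x : E d)
    have h1 := hD u hu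
    have h2 := h ν
    have h3 := h μ
    simp only [mollGap, Function.comp_apply] at *
    linarith
  refine fun u hu => abs_le.2 ⟨?_, one u hu⟩
  have := one _ (lipschitzWith_neg_one_mul hu)
  simp only [integral_const_mul] at this
  linarith

/-- The derivative along the field is compared with an Euler quotient: `∇(moll u)·w ≈ h⁻¹(moll(u ∘
G) - moll u)` with `G = id + h w`. Since `u ∘ G` is `(1 + hC)`-Lipschitz, its gap is again bounded
through `D`. The first term on the right is small when `u` nearly attains the supremum `D`. `C` does
not depend on the bump; only the Taylor constant `K` does, so `h` can be chosen after the bump. -/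
lemma exists_pairing_sub_le {R : ℝ} (hR : 0 ≤ R) : ∃ C, 0 ≤ C ∧
    ∀ b : ContDiffBump (0 : E d), ∃ K, 0 ≤ K ∧ ∀ h, 0 < h → ∀ p : Params d, p.BoundedBy R →
      ∀ (ν μ : ProbabilityMeasure (S d)) (D : ℝ), (∀ u, LipschitzWith 1 u → mollGap b ν μ u ≤ D) →
      ∀ u, LipschitzWith 1 u → pairing (moll b u) p ν - pairing (moll b u) p μ ≤
        h⁻¹ * ((1 + h * C) * D - mollGap b ν μ u) + C * D + C * b.rOut + K * h := by
  obtain ⟨C₀, hC₀, hw⟩ := UBL_vField (d := d) R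
  obtain ⟨C₁, hC₁, hv⟩ := exists_norm_vField_sub_le (d := d) hR
  refine ⟨2 * C₀ + 2 * C₁, by positivity, fun b => ?_⟩
  obtain ⟨K₀, hK₀, ht⟩ := exists_taylor_moll b
  refine ⟨2 * (K₀ * C₀ ^ 2), by positivity, fun h hh p hp ν μ D hD u hu => ?_⟩
  have hr : 0 < b.rOut := b.rOut_pos
  have hD0 : 0 ≤ D := by
    have h0 := hD (fun _ => 0) (LipschitzWith.const 0 |>.weaken zero_le_one)
    have e : mollGap b ν μ (fun _ => 0) = 0 := by simpa using mollGap_const_mul b ν μ 0 (fun _ => 0)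
    rwa [e] at h0
  set w : E d → E d := fun y => vField p ν (retr y) with hwdef
  have hw1 : ∀ y, ‖w y‖ ≤ C₀ := (hw (⟨p, hp⟩, ν)).1
  have hw2 : ∀ y z, ‖w y - w z‖ ≤ C₀ * dist y z := (hw (⟨p, hp⟩, ν)).2
  have hwS : ∀ x : S d, w x = vField p ν x := fun x => by
    simp only [hwdef, retr_of_norm_le (norm_coe x).le]
  have hwc : Continuous w := (LipschitzWith.of_dist_le_mul (K := ⟨C₀, hC₀⟩) fun x y => by
    rw [dist_eq_norm]; exact hw2 x y).continuous
  set G : E d → E d := fun y => y + h • w y with hG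
  have hGl : ∀ x y, dist (u (G x)) (u (G y)) ≤ (1 + h * C₀) * dist x y := fun x y => by
    have h1 : dist (u (G x)) (u (G y)) ≤ dist (G x) (G y) := by simpa using hu.dist_le_mul (G x) (G y)
    refine h1.trans ?_
    have : G x - G y = (x - y) + h • (w x - w y) := by simp only [hG, smul_sub]; abel
    rw [dist_eq_norm, this]
    refine (norm_add_le _ _).trans ?_
    rw [norm_smul, Real.norm_of_nonneg hh.le, ← dist_eq_norm x y]
    nlinarith [hw2 x y]
  have h1C : 0 < 1 + h * C₀ := by positivity
  have hGc : Continuous fun y => u (G y) :=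
    hu.continuous.comp (continuous_id.add (hwc.const_smul h))
  have hstep : mollGap b ν μ (fun y => u (G y)) ≤ (1 + h * C₀) * D := by
    have hl : LipschitzWith 1 fun y => (1 + h * C₀)⁻¹ * u (G y) := by
      refine LipschitzWith.of_dist_le_mul fun x y => ?_
      rw [dist_eq_norm, ← mul_sub, norm_mul, norm_inv, Real.norm_of_nonneg h1C.le,
        inv_mul_le_iff₀ h1C, NNReal.coe_one, one_mul, ← dist_eq_norm]
      exact hGl x y
    have := hD _ hl
    rwa [mollGap_const_mul, inv_mul_le_iff₀ h1C] at this
  have hφd : Continuous (fderiv ℝ (moll b u)) :=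
    (contDiff_moll b hu.continuous).continuous_fderiv (by simp)
  have hpt : ∀ x : S d, |fderiv ℝ (moll b u) (x : E d) (w x) -
      h⁻¹ * (moll b (fun y => u (G y)) x - moll b u x)| ≤ C₀ * b.rOut + K₀ * C₀ ^ 2 * h := fun x => by
    have e1 := ht u hu x (h • w x)
    rw [norm_smul, Real.norm_of_nonneg hh.le, map_smul, smul_eq_mul] at e1
    -- Cost of interchanging mollification with the Euler step: `w` varies by at most `C₀ ‖t‖` under
    -- a translation by `t`.
    have e2 : |moll b (fun y => u (G y)) x - moll b u (x + h • w x)| ≤ h * (C₀ * b.rOut) := by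
      refine abs_moll_sub_moll_le b hGc hu.continuous fun t ht' => ?_
      have e3 : |u (G (x - t)) - u (x + h • w x - t)| ≤ ‖G (x - t) - (x + h • w x - t)‖ := by
        simpa [Real.dist_eq, dist_eq_norm] using hu.dist_le_mul (G (x - t)) (x + h • w x - t)
      refine e3.trans ?_
      have e4 : G (x - t) - (x + h • w x - t) = h • (w (x - t) - w x) := by
        simp only [hG, smul_sub]; abel
      rw [e4, norm_smul, Real.norm_of_nonneg hh.le]
      gcongr
      refine (hw2 _ _).trans ?_
      rw [dist_eq_norm, sub_sub_cancel_left, norm_neg]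
      gcongr
    have e5 : K₀ * (h * ‖w x‖) ^ 2 ≤ h * (K₀ * C₀ ^ 2 * h) := by
      have := hw1 x
      calc _ ≤ K₀ * (h * C₀) ^ 2 := by gcongr
        _ = _ := by ring
    have e6 : fderiv ℝ (moll b u) (x : E d) (w x) - h⁻¹ * (moll b (fun y => u (G y)) x - moll b u x)
        = h⁻¹ * (-(moll b u (x + h • w x) - moll b u x - h * fderiv ℝ (moll b u) x (w x)) -
          (moll b (fun y => u (G y)) x - moll b u (x + h • w x))) := by
      field_simp; ring
    rw [e6, abs_mul, abs_inv, abs_of_pos hh, inv_mul_le_iff₀ hh]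
    refine (abs_sub _ _).trans ?_
    rw [abs_neg]
    linarith
  have hac : Continuous fun x : S d => fderiv ℝ (moll b u) (x : E d) (w x) :=
    (hφd.comp continuous_subtype_val).clm_apply (hwc.comp continuous_subtype_val)
  have hmG := continuous_moll_sphere b hGc
  have hmu := continuous_moll_sphere b hu.continuous
  have hgc : Continuous fun x : S d => h⁻¹ * (moll b (fun y => u (G y)) x - moll b u x) :=
    continuous_const.mul (hmG.sub hmu)
  have hint : ∀ ρ : ProbabilityMeasure (S d),
      ∫ x : S d, h⁻¹ * (moll b (fun y => u (G y)) x - moll b u x) ∂(ρ : Measure (S d)) =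
      h⁻¹ * ((∫ x : S d, moll b (fun y => u (G y)) x ∂(ρ : Measure (S d))) -
        ∫ x : S d, moll b u x ∂(ρ : Measure (S d))) := fun ρ => by
    rw [integral_const_mul, integral_sub (integrable_sphere hmG ρ) (integrable_sphere hmu ρ)]
  have b1 := abs_le.1 (abs_integral_sub_le (ν := ν) hac hgc hpt)
  have b2 := abs_le.1 (abs_integral_sub_le (ν := μ) hac hgc hpt)
  rw [hint] at b1 b2
  have hw'c : Continuous fun x : S d => fderiv ℝ (moll b u) (x : E d) (vField p μ (x : E d)) := by
    have : Continuous fun x : S d => vField p μ (x : E d) :=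
      continuous_vField (p := fun _ => p) ⟨fun _ _ => continuous_const, fun _ _ => continuous_const,
        fun _ _ => continuous_const, fun _ _ => continuous_const, fun _ => continuous_const⟩
        continuous_const continuous_subtype_val
    exact (hφd.comp continuous_subtype_val).clm_apply this
  -- So far both measures were transported by the field of `ν`; this exchanges it for the field of
  -- `μ` in the second pairing.
  have b3 := abs_le.1 (abs_integral_sub_le (ν := μ) (K := C₁ * (D + 2 * b.rOut)) hac hw'c fun x => by
    rw [← map_sub, hwS, ← Real.norm_eq_abs]
    refine ((fderiv ℝ (moll b u) (x : E d)).le_opNorm _).trans ?_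
    refine (mul_le_of_le_one_left (norm_nonneg _) (norm_fderiv_moll_le b hu _)).trans ?_
    exact hv p x ν μ _ hp (KRLe_of_mollGap_le hD))
  have e0 : pairing (moll b u) p ν = ∫ x : S d, fderiv ℝ (moll b u) (x : E d) (w x)
      ∂(ν : Measure (S d)) := by simp only [pairing, hwS]
  rw [e0, pairing]
  have e1 : h⁻¹ * mollGap b ν μ (fun y => u (G y)) ≤ h⁻¹ * ((1 + h * C₀) * D) := by
    gcongr
  have e2 : h⁻¹ * ((1 + h * (2 * C₀ + 2 * C₁)) * D - mollGap b ν μ u) =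
      h⁻¹ * ((1 + h * C₀) * D) - h⁻¹ * mollGap b ν μ u + (C₀ + 2 * C₁) * D := by
    field_simp; ring
  rw [e2]
  simp only [mollGap, mul_sub] at *
  nlinarith [mul_nonneg hC₁ hD0, mul_nonneg hC₀ hD0]

/-- Weak solutions with bounded measurable parameters are unique. -/
theorem IsWeakSolution.unique {T : ℝ} {θ : ℝ → Params d} (hθ : IsLinfty T θ)
    {μ₀ : ProbabilityMeasure (S d)} {ν μ : ℝ → ProbabilityMeasure (S d)}
    (hν : IsWeakSolution T θ μ₀ ν) (hμ : IsWeakSolution T θ μ₀ μ) :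
    ∀ t ∈ Icc 0 T, ν t = μ t := by
  obtain ⟨R, hR, hb⟩ := hθ.exists_boundedBy
  obtain ⟨C, hC, hmain⟩ := exists_pairing_sub_le (d := d) hR
  obtain ⟨M, hM, hv⟩ := exists_norm_vField_le (d := d) R
  have key : ∀ ε > 0, ∀ t ∈ Icc 0 T,
      KRLe (ν t) (μ t) (gronwallBound 0 (2 * C) ((C + 1) * ε) t + 2 * ε) := by
    intro ε hε
    let b : ContDiffBump (0 : E d) := ⟨ε / 2, ε, by linarith, by linarith⟩
    obtain ⟨K, hK, hKb⟩ := hmain b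
    -- `K` blows up as the bump shrinks; this step makes `K * h ≤ ε`.
    set h : ℝ := ε / (K + 1) with hh
    have hh0 : 0 < h := by positivity
    have hKh : K * h ≤ ε := by
      rw [hh, mul_div_assoc', div_le_iff₀ (by linarith)]; nlinarith
    let L := {u : E d → ℝ // LipschitzWith 1 u}
    let f : L → ℝ → ℝ := fun u t => mollGap b (ν t) (μ t) u.1
    -- A supremum over an uncountable family: its regularity comes from the bound `2 * M` on the
    -- speed of every `f u`, uniform in `u`.
    let D : ℝ → ℝ := fun t => ⨆ u : L, f u t
    have : Nonempty L := ⟨⟨fun _ => 0, LipschitzWith.const 0 |>.weaken zero_le_one⟩⟩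
    have hbd : ∀ t, BddAbove (range fun u : L => f u t) := fun t => by
      refine ⟨2, ?_⟩
      rintro _ ⟨u, rfl⟩
      have h1 := fun ρ : ProbabilityMeasure (S d) => abs_le.1 <| abs_integral_sub_le (ν := ρ) (K := 1)
        (continuous_moll_sphere b u.2.continuous) (continuous_const (y := moll b u.1 0)) fun x => by
          simpa [Real.dist_eq] using (lipschitzWith_moll b u.2).dist_le_mul (x : E d) 0
      have h2 := h1 (ν t)
      have h3 := h1 (μ t)
      simp only [f, mollGap, integral_const, probReal_univ, one_smul] at *
      linarith
    have hfD : ∀ u t, f u t ≤ D t := fun u t => le_ciSup (hbd t) u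
    have hD : ∀ t u, LipschitzWith 1 u → mollGap b (ν t) (μ t) u ≤ D t := fun t u hu => hfD ⟨u, hu⟩ t
    have hf0 : ∀ u, f u 0 = 0 := fun u => by simp [f, mollGap, hν.init, hμ.init]
    let P : L → ℝ → ℝ := fun u s => pairing (moll b u.1) (θ s) (ν s) - pairing (moll b u.1) (θ s) (μ s)
    have hsm : ∀ u : L, ContDiff ℝ ∞ (moll b u.1) := fun u => contDiff_moll b u.2.continuous
    have hPi : ∀ u, ∀ s ∈ Icc 0 T, ∀ t ∈ Icc 0 T, IntervalIntegrable (P u) volume s t :=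
      fun u s hs t ht => (intervalIntegrable_pairing hθ hν.continuousOn (hsm u) hs ht).sub
        (intervalIntegrable_pairing hθ hμ.continuousOn (hsm u) hs ht)
    have hfP : ∀ u, ∀ s ∈ Icc 0 T, ∀ t ∈ Icc 0 T, f u t - f u s = ∫ r in s..t, P u r := by
      have h0 : ∀ u, ∀ t ∈ Icc 0 T, f u t = ∫ r in (0:ℝ)..t, P u r := fun u t ht => by
        have a1 := hν.weak _ (hsm u) t ht
        have a2 := hμ.weak _ (hsm u) t ht
        have hT0 : (0:ℝ) ∈ Icc 0 T := ⟨le_rfl, ht.1.trans ht.2⟩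
        rw [intervalIntegral.integral_sub
          (intervalIntegrable_pairing hθ hν.continuousOn (hsm u) hT0 ht)
          (intervalIntegrable_pairing hθ hμ.continuousOn (hsm u) hT0 ht)]
        simp only [f, mollGap, pairing]
        linarith
      intro u s hs t ht
      have hT0 : (0:ℝ) ∈ Icc 0 T := ⟨le_rfl, ht.1.trans ht.2⟩
      rw [h0 u t ht, h0 u s hs, intervalIntegral.integral_interval_sub_left (hPi u 0 hT0 t ht)
        (hPi u 0 hT0 s hs)]
    -- almost everywhere bounds on intervals
    have hae : ∀ s ∈ Icc 0 T, ∀ t ∈ Icc 0 T, s ≤ t →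
        ∀ᵐ r ∂(volume.restrict (Ioc s t)), (θ r).BoundedBy R := fun s hs t ht _ => by
      have : (volume.restrict (Ioc s t) : Measure ℝ) ≤ volume.restrict (Ioc 0 T) :=
        Measure.restrict_mono (Ioc_subset_Ioc hs.1 ht.2) le_rfl
      rw [Measure.restrict_congr_set (Ioo_ae_eq_Ioc (a := (0:ℝ)) (b := T))] at hb
      exact ae_mono this hb
    have hPb : ∀ u r, (θ r).BoundedBy R → |P u r| ≤ 2 * M := fun u r hr => by
      have h1 := fun ρ : ProbabilityMeasure (S d) => abs_pairing_le (φ := moll b u.1) (M := 1)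
        (fun x => norm_fderiv_moll_le b u.2 x) (hv _ hr ρ) zero_le_one
      have h2 := abs_le.1 (h1 (ν r))
      have h3 := abs_le.1 (h1 (μ r))
      exact abs_le.2 ⟨by simp only [P]; linarith, by simp only [P]; linarith⟩
    have hfl : ∀ u, ∀ s ∈ Icc 0 T, ∀ t ∈ Icc 0 T, s ≤ t → |f u t - f u s| ≤ 2 * M * (t - s) := by
      intro u s hs t ht hst
      rw [hfP u s hs t ht]
      have hn := hae s hs t ht hst
      rw [ae_restrict_iff' measurableSet_Ioc] at hn
      have := intervalIntegral.norm_integral_le_of_norm_le_const_ae (f := P u) (a := s) (b := t)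
        (C := 2 * M) (by
          rw [uIoc_of_le hst]
          filter_upwards [hn] with r hr hmem using hPb u r (hr hmem))
      rwa [abs_of_nonneg (sub_nonneg.2 hst)] at this
    have hDl : ∀ s ∈ Icc 0 T, ∀ t ∈ Icc 0 T, s ≤ t → |D t - D s| ≤ 2 * M * (t - s) := by
      intro s hs t ht hst
      have h1 : D t ≤ D s + 2 * M * (t - s) := ciSup_le fun u => by
        linarith [hfD u s, (abs_le.1 (hfl u s hs t ht hst)).2]
      have h2 : D s ≤ D t + 2 * M * (t - s) := ciSup_le fun u => by
        linarith [hfD u t, (abs_le.1 (hfl u s hs t ht hst)).1]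
      exact abs_le.2 ⟨by linarith, by linarith⟩
    have hDc : ContinuousOn D (Icc 0 T) := by
      refine (LipschitzOnWith.of_dist_le_mul (K := ⟨2 * M, by positivity⟩) fun s hs t ht => ?_).continuousOn
      rw [Real.dist_eq, Real.dist_eq]
      rcases le_total s t with hst | hst
      · rw [abs_sub_comm, abs_sub_comm s t, abs_of_nonneg (sub_nonneg.2 hst)]
        exact hDl s hs t ht hst
      · rw [abs_of_nonneg (sub_nonneg.2 hst)]
        exact hDl t ht s hs hst
    set Q : ℝ := h⁻¹ * ((1 + h * C) * (2 * M) + 2 * M) + C * (2 * M) with hQ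
    have hQ0 : 0 ≤ Q := by positivity
    have hstep : ∀ s ∈ Icc 0 T, ∀ t ∈ Icc 0 T, s ≤ t → t - s ≤ h →
        D t ≤ D s + (t - s) * (2 * C * D s + (C * ε + K * h) + Q * (t - s)) := by
      intro s hs t ht hst hth
      refine ciSup_le fun u => ?_
      set A : ℝ := h⁻¹ * ((1 + h * C) * D s - f u s) + C * D s + C * ε + K * h + Q * (t - s) with hA
      have hPA : ∀ᵐ r ∂(volume.restrict (Icc s t)), P u r ≤ A := by
        rw [← restrict_Ioc_eq_restrict_Icc]
        filter_upwards [hae s hs t ht hst, ae_restrict_mem measurableSet_Ioc] with r hr hmem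
        have hr' : r ∈ Icc 0 T := ⟨hs.1.trans hmem.1.le, hmem.2.trans ht.2⟩
        have h1 := hKb h hh0 (θ r) hr (ν r) (μ r) (D r) (hD r) u.1 u.2
        have h2 : D r ≤ D s + 2 * M * (t - s) := by
          have := (abs_le.1 (hDl s hs r hr' hmem.1.le)).2
          nlinarith [hmem.2]
        have h3 : f u s - 2 * M * (t - s) ≤ f u r := by
          have := (abs_le.1 (hfl u s hs r hr' hmem.1.le)).1
          nlinarith [hmem.2]
        have h4 : h⁻¹ * ((1 + h * C) * D r - mollGap b (ν r) (μ r) u.1) ≤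
            h⁻¹ * ((1 + h * C) * (D s + 2 * M * (t - s)) - (f u s - 2 * M * (t - s))) := by
          have h5 : f u r = mollGap b (ν r) (μ r) u.1 := rfl
          rw [h5] at h3
          gcongr
        have h6 : C * D r ≤ C * (D s + 2 * M * (t - s)) := by gcongr
        have h7 : A = h⁻¹ * ((1 + h * C) * (D s + 2 * M * (t - s)) - (f u s - 2 * M * (t - s))) +
          C * (D s + 2 * M * (t - s)) + C * ε + K * h := by rw [hA, hQ]; ring
        have h8 : b.rOut = ε := rfl
        rw [h8] at h1
        simp only [P]
        rw [h7]
        linarith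
      have h9 : f u t - f u s ≤ A * (t - s) := by
        rw [hfP u s hs t ht]
        have := intervalIntegral.integral_mono_ae_restrict hst (hPi u s hs t ht)
          (intervalIntegrable_const (c := A)) hPA
        rwa [intervalIntegral.integral_const, smul_eq_mul, mul_comm] at this
      -- For `t - s ≤ h` the large term `(t - s) h⁻¹ (D s - f u s)` is at most `D s - f u s`,
      -- exactly the room by which `u` misses the supremum. This removes `h⁻¹` from the growth rate.
      have h10 : 0 ≤ (D s - f u s) * (1 - (t - s) * h⁻¹) := by
        refine mul_nonneg (sub_nonneg.2 (hfD u s)) ?_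
        have : (t - s) * h⁻¹ ≤ 1 := by rw [← div_eq_mul_inv, div_le_one hh0]; exact hth
        linarith
      have h11 : A * (t - s) = (t - s) * h⁻¹ * (D s - f u s) +
          (t - s) * (2 * C * D s + (C * ε + K * h) + Q * (t - s)) := by
        rw [hA]; field_simp; ring
      nlinarith
    have hgr : ∀ t ∈ Icc 0 T, D t ≤ gronwallBound 0 (2 * C) ((C + 1) * ε) (t - 0) := by
      refine le_gronwallBound_of_liminf_deriv_right_le
        (f' := fun s => 2 * C * D s + (C * ε + K * h)) hDc ?_ ?_ ?_
      · intro s hs r hr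
        refine Eventually.frequently ?_
        have hlim : Tendsto (fun z : ℝ => 2 * C * D s + (C * ε + K * h) + Q * (z - s)) (𝓝[>] s)
            (𝓝 (2 * C * D s + (C * ε + K * h) + Q * (s - s))) := by
          have : Continuous fun z : ℝ => 2 * C * D s + (C * ε + K * h) + Q * (z - s) := by fun_prop
          exact (this.tendsto s).mono_left nhdsWithin_le_nhds
        rw [sub_self, mul_zero, add_zero] at hlim
        filter_upwards [hlim.eventually (gt_mem_nhds hr), Ioc_mem_nhdsGT (lt_min hs.2
          (by linarith : s < s + h))] with z hz hmem
        have hz0 : 0 < z - s := sub_pos.2 hmem.1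
        have hzm := le_min_iff.1 hmem.2
        have := hstep s ⟨hs.1, hs.2.le⟩ z ⟨hs.1.trans hmem.1.le, hzm.1⟩ hmem.1.le
          (by linarith [hzm.2])
        rw [inv_mul_lt_iff₀ hz0]
        nlinarith
      · exact ciSup_le fun u => (hf0 u).le
      · intro s _
        nlinarith
    intro t ht
    have := KRLe_of_mollGap_le (b := b) (hD t)
    intro u hu
    refine (this u hu).trans ?_
    have h1 := hgr t ht
    rw [sub_zero] at h1
    have h2 : b.rOut = ε := rfl
    rw [h2]
    linarith
  intro t ht
  refine eq_of_forall_lipschitz fun u hu => ?_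
  -- The growth rate `2 * C` is independent of `ε`, so the bound vanishes with `ε`.
  have hlim : Tendsto (fun ε : ℝ => gronwallBound 0 (2 * C) ((C + 1) * ε) t + 2 * ε) (𝓝[>] 0) (𝓝 0) := by
    have hc : Continuous fun ε : ℝ => gronwallBound 0 (2 * C) ((C + 1) * ε) t + 2 * ε :=
      ((gronwallBound_continuous_ε 0 (2 * C) t).comp (continuous_const.mul continuous_id)).add
        (continuous_const.mul continuous_id)
    have := (hc.tendsto 0).mono_left (nhdsWithin_le_nhds (s := Ioi 0))
    simpa [gronwallBound_ε0_δ0] using this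
  exact ge_of_tendsto hlim (by
    filter_upwards [self_mem_nhdsWithin] with ε hε using key ε hε t ht u hu)

end Transformer

end

/-! ### Push-forwards, flows as weak solutions, and concatenation in time. -/

noncomputable section

namespace Transformer

variable {d : ℕ}

/-- The image of a probability measure on the sphere under a continuous map. -/
def push (μ : ProbabilityMeasure (S d)) (g : C(S d, S d)) : ProbabilityMeasure (S d) :=
  μ.map g.continuous.measurable.aemeasurable

lemma coe_push (μ : ProbabilityMeasure (S d)) (g : C(S d, S d)) :
    (push μ g : Measure (S d)) = (μ : Measure (S d)).map g := rfl

lemma integral_push {F : Type*} [NormedAddCommGroup F] [NormedSpace ℝ F]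
    [SecondCountableTopologyEither (S d) F]
    (μ : ProbabilityMeasure (S d)) (g : C(S d, S d)) {f : S d → F} (hf : Continuous f) :
    ∫ x, f x ∂(push μ g : Measure (S d)) = ∫ x, f (g x) ∂(μ : Measure (S d)) := by
  rw [coe_push, integral_map g.continuous.measurable.aemeasurable hf.aestronglyMeasurable]

lemma tilt_push (μ : ProbabilityMeasure (S d)) (g : C(S d, S d)) (ξ : E d) :
    tilt (push μ g : Measure (S d)) (fun y : S d => (y : E d)) ξ =
      tilt (μ : Measure (S d)) (fun y : S d => (g y : E d)) ξ := by
  unfold tilt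
  rw [integral_push μ g (f := fun y : S d => Real.exp ⟪ξ, (y : E d)⟫) (by fun_prop),
    integral_push μ g (f := fun y : S d => Real.exp ⟪ξ, (y : E d)⟫ • (y : E d)) (by fun_prop)]

lemma isCompact_supp (μ : ProbabilityMeasure (S d)) : IsCompact (supp μ) :=
  Measure.isClosed_support.isCompact

lemma supp_nonempty (μ : ProbabilityMeasure (S d)) : (supp μ).Nonempty :=
  Measure.nonempty_support (IsProbabilityMeasure.ne_zero _)

lemma ae_mem_supp (μ : ProbabilityMeasure (S d)) : ∀ᵐ x ∂(μ : Measure (S d)), x ∈ supp μ :=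
  Measure.support_mem_ae

lemma supp_push_subset (μ : ProbabilityMeasure (S d)) (g : C(S d, S d)) :
    supp (push μ g) ⊆ g '' supp μ := by
  refine Measure.support_subset_of_isClosed ((isCompact_supp μ).image g.continuous).isClosed ?_
  rw [coe_push]
  refine mem_ae_map_iff g.continuous.measurable.aemeasurable
    ((isCompact_supp μ).image g.continuous).measurableSet |>.2 ?_
  filter_upwards [ae_mem_supp μ] with x hx using mem_image_of_mem g hx

lemma mem_supp_push {μ : ProbabilityMeasure (S d)} (g : C(S d, S d)) {x : S d} (hx : x ∈ supp μ) :
    g x ∈ supp (push μ g) := by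
  refine (Measure.mem_support_iff_forall _).2 fun U hU => ?_
  obtain ⟨V, hVU, hV, hxV⟩ := mem_nhds_iff.1 hU
  refine lt_of_lt_of_le ?_ (measure_mono hVU)
  rw [coe_push, Measure.map_apply g.continuous.measurable hV.measurableSet]
  exact (Measure.mem_support_iff_forall _).1 hx _ ((hV.preimage g.continuous).mem_nhds hxV)

/-- A flow on the sphere driven by the measure that it transports. -/
structure IsFlow (T : ℝ) (θ : ℝ → Params d) (μ₀ : ProbabilityMeasure (S d))
    (X : ℝ → C(S d, S d)) : Prop where
  continuous : Continuous fun q : ℝ × S d => X q.1 q.2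
  init : ∀ x, X 0 x = x
  deriv : ∀ x, ∀ t ∈ Ioo 0 T,
    HasDerivAt (fun t => (X t x : E d)) (vField (θ t) (push μ₀ (X t)) (X t x : E d)) t

lemma continuous_push {X : ℝ → C(S d, S d)} (hX : Continuous fun q : ℝ × S d => X q.1 q.2)
    (μ₀ : ProbabilityMeasure (S d)) : Continuous fun t => push μ₀ (X t) := by
  refine ProbabilityMeasure.continuous_iff_forall_continuous_integral.2 fun f => ?_
  have h := fun t => integral_push μ₀ (X t) f.continuous
  simp only [h]
  exact continuous_integral_of_continuous_real (f := fun t x => f (X t x)) (f.continuous.comp hX)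
    continuous_const

/-- The fundamental theorem of calculus along each trajectory, integrated over the initial measure;
Fubini exchanges time and space. -/
theorem IsFlow.isWeakSolution {T : ℝ} {θ : ℝ → Params d} (hθ : ContinuousParams θ)
    {μ₀ : ProbabilityMeasure (S d)} {X : ℝ → C(S d, S d)} (hX : IsFlow T θ μ₀ X) :
    IsWeakSolution T θ μ₀ fun t => push μ₀ (X t) := by
  have hμ := continuous_push hX.continuous μ₀
  have hX0 : push μ₀ (X 0) = μ₀ := by
    refine ProbabilityMeasure.toMeasure_injective ?_
    rw [coe_push]
    have : (X 0 : S d → S d) = id := funext hX.init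
    rw [this, Measure.map_id]
  refine ⟨hμ.continuousOn, hX0, fun φ hφ t ht => ?_⟩
  let g : ℝ → S d → ℝ := fun s x =>
    fderiv ℝ φ (X s x : E d) (vField (θ s) (push μ₀ (X s)) (X s x : E d))
  have hφ' : Continuous (fderiv ℝ φ) := hφ.continuous_fderiv (by simp)
  have hXv : Continuous fun q : ℝ × S d => (X q.1 q.2 : E d) :=
    continuous_subtype_val.comp hX.continuous
  have hg : Continuous (Function.uncurry g) :=
    (hφ'.comp hXv).clm_apply (continuous_vField (hθ.comp continuous_fst) (hμ.comp continuous_fst) hXv)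
  have hgs : ∀ x, Continuous fun s => g s x := fun x => hg.comp (Continuous.prodMk_left x)
  have hftc : ∀ x : S d, ∫ s in (0:ℝ)..t, g s x = φ (X t x) - φ x := fun x => by
    have hXx : Continuous fun s => (X s x : E d) := hXv.comp (Continuous.prodMk_left x)
    have h := intervalIntegral.integral_eq_sub_of_hasDerivAt_of_le ht.1
      (f := fun s => φ (X s x)) (f' := fun s => g s x) (hφ.continuous.comp hXx).continuousOn
      (fun s hs => ((hφ.differentiable (by simp) (X s x : E d)).hasFDerivAt.comp_hasDerivAt s
        (hX.deriv x s ⟨hs.1, hs.2.trans_le ht.2⟩))) ((hgs x).intervalIntegrable _ _)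
    rw [h, hX.init]
  have hφc : Continuous fun x : S d => φ x := hφ.continuous.comp continuous_subtype_val
  have h1 : (∫ x : S d, φ x ∂(push μ₀ (X t) : Measure (S d))) -
      ∫ x : S d, φ x ∂(μ₀ : Measure (S d)) =
      ∫ x : S d, (∫ s in (0:ℝ)..t, g s x) ∂(μ₀ : Measure (S d)) := by
    simp only [hftc]
    rw [integral_push μ₀ (X t) hφc]
    exact (integral_sub (integrable_sphere (hφc.comp (X t).continuous) μ₀)
      (integrable_sphere hφc μ₀)).symm
  have h2 : ∀ s, (∫ x : S d, fderiv ℝ φ (x : E d) (vField (θ s) (push μ₀ (X s)) (x : E d))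
      ∂(push μ₀ (X s) : Measure (S d))) = ∫ x, g s x ∂(μ₀ : Measure (S d)) := fun s => by
    refine integral_push μ₀ (X s) (f := fun x : S d =>
      fderiv ℝ φ (x : E d) (vField (θ s) (push μ₀ (X s)) (x : E d))) ?_
    exact (hφ'.comp continuous_subtype_val).clm_apply (continuous_vField
      (hθ.comp (continuous_const (y := s))) continuous_const continuous_subtype_val)
  simp only [h1, h2, intervalIntegral.integral_of_le ht.1]
  refine integral_integral_swap ?_
  obtain ⟨C, hC⟩ := (isCompact_Icc (a := (0:ℝ)) (b := t)).prod (isCompact_univ (X := S d))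
    |>.exists_bound_of_continuousOn hg.continuousOn
  have hb : ∀ᵐ s ∂(volume.restrict (Ioc 0 t)), ∀ x, ‖g s x‖ ≤ C := by
    filter_upwards [ae_restrict_mem measurableSet_Ioc] with s hs x
    exact hC (s, x) ⟨Ioc_subset_Icc_self hs, mem_univ _⟩
  have hgm : AEStronglyMeasurable (Function.uncurry fun x s => g s x)
      ((μ₀ : Measure (S d)).prod (volume.restrict (Ioc 0 t))) :=
    (hg.comp continuous_swap).aestronglyMeasurable
  refine Integrable.of_bound hgm C ?_
  refine (Measure.ae_prod_iff_ae_ae ?_).2 (.of_forall fun x => ?_)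
  · exact measurableSet_le (hg.comp continuous_swap).measurable.norm measurable_const
  · filter_upwards [hb] with s hs using hs x

lemma ContinuousParams.isLinfty {θ : ℝ → Params d} (hθ : ContinuousParams θ) (T : ℝ) :
    IsLinfty T θ := by
  have key : ∀ f : ℝ → ℝ, Continuous f → MemLp f ∞ (volume.restrict (Ioo 0 T)) := fun f hf => by
    obtain ⟨C, hC⟩ := (isCompact_Icc (a := (0:ℝ)) (b := T)).exists_bound_of_continuousOn
      hf.continuousOn
    refine memLp_top_of_bound hf.aestronglyMeasurable C ?_
    filter_upwards [ae_restrict_mem measurableSet_Ioo] with s hs using hC s (Ioo_subset_Icc_self hs)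
  exact ⟨fun i j => key _ (hθ.V i j), fun i j => key _ (hθ.B i j), fun i j => key _ (hθ.W i j),
    fun i j => key _ (hθ.U i j), fun i => key _ (hθ.b i)⟩

/-- The curve that follows `f` up to time `T₁`, and then `g`. -/
def concat {α : Type*} (T₁ : ℝ) (f g : ℝ → α) (t : ℝ) : α := if t ≤ T₁ then f t else g (t - T₁)

lemma concat_of_le {α : Type*} {T₁ t : ℝ} (f g : ℝ → α) (h : t ≤ T₁) : concat T₁ f g t = f t :=
  if_pos h

lemma concat_of_lt {α : Type*} {T₁ t : ℝ} (f g : ℝ → α) (h : T₁ < t) :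
    concat T₁ f g t = g (t - T₁) := if_neg h.not_ge

lemma memLp_concat {T₁ T₂ : ℝ} {f g : ℝ → ℝ}
    (hf : MemLp f ∞ (volume.restrict (Ioo 0 T₁))) (hg : MemLp g ∞ (volume.restrict (Ioo 0 T₂))) :
    MemLp (concat T₁ f g) ∞ (volume.restrict (Ioo 0 (T₁ + T₂))) := by
  have e : concat T₁ f g = (Iic T₁).piecewise f fun t => g (t - T₁) := by
    ext t; simp [concat, piecewise]
  rw [e]
  refine MemLp.piecewise measurableSet_Iic ?_ ?_
  · rw [Measure.restrict_restrict measurableSet_Iic]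
    rw [Measure.restrict_congr_set (Ioo_ae_eq_Ioc (a := (0:ℝ)) (b := T₁))] at hf
    have hs : Iic T₁ ∩ Ioo 0 (T₁ + T₂) ⊆ Ioc 0 T₁ := fun t ht => ⟨ht.2.1, ht.1⟩
    exact hf.mono_measure (Measure.restrict_mono hs le_rfl)
  · rw [Measure.restrict_restrict measurableSet_Iic.compl]
    have hm := (measurePreserving_sub_right (volume : Measure ℝ) T₁).restrict_preimage
      (measurableSet_Ioo (a := (0:ℝ)) (b := T₂))
    refine (hg.comp_measurePreserving hm).mono_measure (Measure.restrict_mono (fun t ht => ?_) le_rfl)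
    simp only [mem_inter_iff, mem_compl_iff, mem_Iic, mem_Ioo, mem_preimage, not_le] at *
    exact ⟨by linarith, by linarith⟩

lemma IsLinfty.concat {T₁ T₂ : ℝ} {θ₁ θ₂ : ℝ → Params d} (h₁ : IsLinfty T₁ θ₁)
    (h₂ : IsLinfty T₂ θ₂) : IsLinfty (T₁ + T₂) (concat T₁ θ₁ θ₂) := by
  have e : ∀ F : Params d → ℝ, (fun t => F (Transformer.concat T₁ θ₁ θ₂ t)) =
      Transformer.concat T₁ (fun t => F (θ₁ t)) fun t => F (θ₂ t) := fun F => by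
    ext t
    unfold Transformer.concat
    split_ifs <;> rfl
  refine ⟨fun i j => ?_, fun i j => ?_, fun i j => ?_, fun i j => ?_, fun i => ?_⟩
  · rw [e fun p => p.V i j]; exact memLp_concat (h₁.1 i j) (h₂.1 i j)
  · rw [e fun p => p.B i j]; exact memLp_concat (h₁.2.1 i j) (h₂.2.1 i j)
  · rw [e fun p => p.W i j]; exact memLp_concat (h₁.2.2.1 i j) (h₂.2.2.1 i j)
  · rw [e fun p => p.U i j]; exact memLp_concat (h₁.2.2.2.1 i j) (h₂.2.2.2.1 i j)
  · rw [e fun p => p.b i]; exact memLp_concat (h₁.2.2.2.2 i) (h₂.2.2.2.2 i)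

lemma IsWeakSolution.concat {T₁ T₂ : ℝ} (hT₁ : 0 ≤ T₁) (hT₂ : 0 ≤ T₂) {θ₁ θ₂ : ℝ → Params d}
    (hθ₁ : IsLinfty T₁ θ₁) (hθ₂ : IsLinfty T₂ θ₂) {μ₀ : ProbabilityMeasure (S d)}
    {μ₁ μ₂ : ℝ → ProbabilityMeasure (S d)} (h₁ : IsWeakSolution T₁ θ₁ μ₀ μ₁)
    (h₂ : IsWeakSolution T₂ θ₂ (μ₁ T₁) μ₂) :
    IsWeakSolution (T₁ + T₂) (concat T₁ θ₁ θ₂) μ₀ (concat T₁ μ₁ μ₂) := by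
  have hc : ContinuousOn (Transformer.concat T₁ μ₁ μ₂) (Icc 0 (T₁ + T₂)) := by
    have hu : Icc 0 (T₁ + T₂) = Icc 0 T₁ ∪ Icc T₁ (T₁ + T₂) :=
      (Icc_union_Icc_eq_Icc hT₁ (by linarith)).symm
    rw [hu]
    refine ContinuousOn.union_of_isClosed ?_ ?_ isClosed_Icc isClosed_Icc
    · exact h₁.continuousOn.congr fun t ht => concat_of_le _ _ ht.2
    · have : ContinuousOn (fun t => μ₂ (t - T₁)) (Icc T₁ (T₁ + T₂)) :=
        h₂.continuousOn.comp (by fun_prop) fun t ht => ⟨by linarith [ht.1], by linarith [ht.2]⟩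
      refine this.congr fun t ht => ?_
      rcases ht.1.eq_or_lt with rfl | hlt
      · rw [concat_of_le _ _ le_rfl]
        simp only [sub_self, h₂.init]
      · exact concat_of_lt _ _ hlt
  refine ⟨hc, by rw [concat_of_le _ _ hT₁, h₁.init], fun φ hφ t ht => ?_⟩
  set P := fun s => pairing φ (Transformer.concat T₁ θ₁ θ₂ s) (Transformer.concat T₁ μ₁ μ₂ s)
  change _ = ∫ s in (0:ℝ)..t, P s
  have low : ∀ r, 0 ≤ r → r ≤ T₁ → ∫ s in (0:ℝ)..r, P s = ∫ s in (0:ℝ)..r, pairing φ (θ₁ s) (μ₁ s) :=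
    fun r h0 hr => intervalIntegral.integral_congr fun s hs => by
      rw [uIcc_of_le h0] at hs
      simp only [P, concat_of_le _ _ (hs.2.trans hr)]
  rcases le_or_gt t T₁ with h | h
  · rw [concat_of_le _ _ h, low t ht.1 h]
    exact h₁.weak φ hφ t ⟨ht.1, h⟩
  · have hT : T₁ ∈ Icc 0 (T₁ + T₂) := ⟨hT₁, by linarith⟩
    have h0 : (0:ℝ) ∈ Icc 0 (T₁ + T₂) := ⟨le_rfl, by linarith⟩
    have hi := fun a ha b hb =>
      intervalIntegrable_pairing (hθ₁.concat hθ₂) hc hφ (a := a) (b := b) ha hb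
    rw [← intervalIntegral.integral_add_adjacent_intervals (hi 0 h0 T₁ hT) (hi T₁ hT t ht),
      low T₁ hT₁ le_rfl, concat_of_lt _ _ h]
    have e : ∫ s in T₁..t, P s = ∫ s in (0:ℝ)..(t - T₁), pairing φ (θ₂ s) (μ₂ s) := by
      rw [← sub_self T₁, ← intervalIntegral.integral_comp_sub_right
        (fun s => pairing φ (θ₂ s) (μ₂ s)) T₁]
      -- The junction time carries the values of the first piece; the half-open interval excludes
      -- it.
      refine intervalIntegral.integral_congr_ae (.of_forall fun s hs => ?_)
      rw [uIoc_of_le h.le] at hs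
      simp only [P, concat_of_lt _ _ hs.1]
    have a1 := h₁.weak φ hφ T₁ ⟨hT₁, le_rfl⟩
    have a2 := h₂.weak φ hφ (t - T₁) ⟨by linarith, by linarith [ht.2]⟩
    rw [e]
    simp only [pairing]
    linarith

/-- The parameters `θ` steer the data `μ₀` along the weak solutions `μ`, using attention only in
feedback form. -/
structure Steers {N : ℕ} (T : ℝ) (θ : ℝ → Params d) (μ₀ : Fin N → ProbabilityMeasure (S d))
    (μ : Fin N → ℝ → ProbabilityMeasure (S d)) : Prop where
  linfty : IsLinfty T θ
  weak : ∀ i, IsWeakSolution T θ (μ₀ i) (μ i)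
  -- The right end is included because the junction time of a concatenation belongs to the first
  -- piece.
  mode : ∀ t ∈ Ioc 0 T, (θ t).V = 0 ∨ ∃ k lam a z, IsFeedback (θ t) (fun i => μ i t) k lam a z

lemma Steers.concat {N : ℕ} {T₁ T₂ : ℝ} (hT₁ : 0 ≤ T₁) (hT₂ : 0 ≤ T₂) {θ₁ θ₂ : ℝ → Params d}
    {μ₀ : Fin N → ProbabilityMeasure (S d)} {μ₁ μ₂ : Fin N → ℝ → ProbabilityMeasure (S d)}
    (h₁ : Steers T₁ θ₁ μ₀ μ₁) (h₂ : Steers T₂ θ₂ (fun i => μ₁ i T₁) μ₂) :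
    Steers (T₁ + T₂) (concat T₁ θ₁ θ₂) μ₀ fun i => concat T₁ (μ₁ i) (μ₂ i) := by
  refine ⟨h₁.linfty.concat h₂.linfty,
    fun i => (h₁.weak i).concat hT₁ hT₂ h₁.linfty h₂.linfty (h₂.weak i), fun t ht => ?_⟩
  rcases le_or_gt t T₁ with h | h
  · simp only [concat_of_le _ _ h]
    exact h₁.mode t ⟨ht.1, h⟩
  · simp only [concat_of_lt _ _ h]
    exact h₂.mode _ ⟨by linarith, by linarith [ht.2]⟩

end Transformer

end

/-! ### The closed feedback loop. -/

noncomputable section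

namespace Transformer

variable {d N : ℕ}

/-- The parameter value of feedback form with gain `lam`, half-space `a`, and `W𝟏 = w`. -/
def fbParams (lam : ℝ) (B : Matrix (Fin d) (Fin d) ℝ) (a w : E d) : Params d where
  V := lam • (1 : Matrix (Fin d) (Fin d) ℝ)
  B := B
  W := Matrix.of fun i _ => w i / d
  U := Matrix.of fun _ j => a j
  b := 0

lemma mulV_replicate_ones (hd : 0 < d) (w : E d) (c : ℝ) :
    mulV (Matrix.of fun i (_ : Fin d) => w i / d) (c • ones d) = c • w := by
  have : (d:ℝ) ≠ 0 := by positivity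
  ext i
  rw [mulV_apply]
  simp only [Matrix.of_apply, PiLp.smul_apply, ones, smul_eq_mul, mul_one, Finset.sum_const,
    Finset.card_univ, Fintype.card_fin, nsmul_eq_mul]
  field_simp

lemma relu_halfspace (a x : E d) :
    relu (mulV (Matrix.of fun (_ : Fin d) j => a j) x + 0) = max ⟪a, x⟫ 0 • ones d := by
  ext i
  simp [relu, mulV_apply, ones, PiLp.inner_apply, mul_comm]

lemma vField_fbParams (hd : 0 < d) (lam : ℝ) (B : Matrix (Fin d) (Fin d) ℝ) (a w : E d)
    (μ : ProbabilityMeasure (S d)) (x : E d) :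
    vField (fbParams lam B a w) μ x =
      tanProj x (lam • attention B μ x + max ⟪a, x⟫ 0 • w) := by
  simp only [vField, fbParams, smul_one_mulV, relu_halfspace, mulV_replicate_ones hd]

/-- The data of a feedback law. -/
structure Loop (d N : ℕ) where
  lam : ℝ
  B : Matrix (Fin d) (Fin d) ℝ
  a : S d
  z : S d
  k : Fin N
  μ₀ : Fin N → ProbabilityMeasure (S d)

namespace Loop

/-- The curves of the closed loop live in this space. -/
abbrev State (d N : ℕ) := Fin N → C(S d, E d)

variable (l : Loop d N)

/-- The vector `W𝟏` prescribed by the feedback law. -/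
def gain (Y : State d N) : E d :=
  (⟪(l.a : E d), (l.z : E d)⟫)⁻¹ • (l.lam • (l.z : E d) -
    l.lam • tilt (l.μ₀ l.k : Measure (S d)) (fun s => retr (Y l.k s)) (mulV l.B l.z))

/-- The velocity before projection. -/
def drive (q : State d N × E d) (i : Fin N) : E d :=
  l.lam • tilt (l.μ₀ i : Measure (S d)) (fun s => retr (q.1 i s)) (mulV l.B (retr q.2)) +
    max ⟪(l.a : E d), retr q.2⟫ 0 • l.gain q.1

lemma UBL_state : UBL fun (q : State d N × E d) (p : Fin N × S d) => retr (q.1 p.1 p.2) :=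
  UBL_retr.comp_lip (g := fun (q : State d N × E d) (p : Fin N × S d) => q.1 p.1 p.2) 1
    fun p x y => by
      rw [one_mul]
      exact (ContinuousMap.dist_apply_le_dist p.2).trans
        ((dist_le_pi_dist x.1 y.1 p.1).trans (le_max_left _ _))

lemma UBL_point {Ω : Type*} : UBL fun (q : State d N × E d) (_ : Ω) => retr q.2 :=
  UBL_retr.comp_lip (g := fun (q : State d N × E d) (_ : Ω) => q.2) 1 fun _ x y => by
    rw [one_mul]; exact le_max_right _ _

lemma UBL_stateTilt {Ω : Type*} (σ : Ω → Fin N) (μ : Ω → ProbabilityMeasure (S d))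
    {f : State d N × E d → Ω → E d} (hf : UBL f) :
    UBL fun q i => tilt (μ i : Measure (S d)) (fun s => retr (q.1 (σ i) s)) (f q i) := by
  have hg : UBL fun (q : State d N × E d) (p : Ω × S d) => retr (q.1 (σ p.1) p.2) :=
    UBL_state.comp_param fun p : Ω × S d => (σ p.1, p.2)
  have hm : ∀ (q : State d N × E d) (i : Ω), AEStronglyMeasurable
      (fun s : S d => retr (q.1 (σ i) s)) (μ i : Measure (S d)) := fun q i => by
    have hc : Continuous fun s : S d => retr (q.1 (σ i) s) :=
      continuous_retr.comp (q.1 (σ i)).continuous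
    exact hc.aestronglyMeasurable
  exact UBL.tilt hf hg (fun i => (μ i : Measure (S d))) hm

lemma UBL_gain {Ω : Type*} : UBL fun (q : State d N × E d) (_ : Ω) => l.gain q.1 := by
  have h : UBL fun (q : State d N × E d) (_ : Unit) =>
      tilt (l.μ₀ l.k : Measure (S d)) (fun s => retr (q.1 l.k s)) (mulV l.B (l.z : E d)) :=
    UBL_stateTilt (fun _ => l.k) (fun _ => l.μ₀ l.k)
      (UBL.const (c := fun _ : Unit => mulV l.B (l.z : E d)) ‖mulV l.B (l.z : E d)‖ fun _ => le_rfl)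
  have c : ∀ r : ℝ, UBL fun (_ : State d N × E d) (_ : Unit) => r := fun r => UBL.const ‖r‖ fun _ => le_rfl
  have h2 := (c (⟪(l.a : E d), (l.z : E d)⟫)⁻¹).smul
    (((c l.lam).smul (UBL.const (F := E d) 1 fun _ => (norm_coe l.z).le)).sub ((c l.lam).smul h))
  exact h2.comp_param fun _ => ()

lemma UBL_drive : UBL l.drive := by
  have c : ∀ r : ℝ, UBL fun (_ : State d N × E d) (_ : Fin N) => r := fun r => UBL.const ‖r‖ fun _ => le_rfl
  have h : UBL fun (q : State d N × E d) (i : Fin N) =>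
      tilt (l.μ₀ i : Measure (S d)) (fun s => retr (q.1 i s)) (mulV l.B (retr q.2)) := by
    have hB : UBL fun (q : State d N × E d) (_ : Fin N) => mulV l.B (retr q.2) :=
      UBL_point.mulV (fun _ => l.B) (∑ i, ∑ j, |l.B i j|) fun _ i j =>
        (Finset.single_le_sum (f := fun j => |l.B i j|) (fun j _ => abs_nonneg _)
          (Finset.mem_univ j)).trans (Finset.single_le_sum (f := fun i => ∑ j, |l.B i j|)
          (fun i _ => Finset.sum_nonneg fun j _ => abs_nonneg _) (Finset.mem_univ i))
    exact UBL_stateTilt (fun i => i) l.μ₀ hB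
  have hr : UBL fun (q : State d N × E d) (_ : Fin N) => max ⟪(l.a : E d), retr q.2⟫ 0 :=
    ((UBL.const 1 fun _ => (norm_coe l.a).le).inner UBL_point).post (fun _ r => max r 0) 1 0
      zero_le_one (by simp) fun _ u v => by
        simpa using abs_max_sub_max_le_max u 0 v 0
  exact ((c l.lam).smul h).add (hr.smul l.UBL_gain)

/-- The projected velocity. -/
def vel (q : State d N × E d) (i : Fin N) : E d := tanProj (retr q.2) (l.drive q i)

lemma UBL_vel : UBL l.vel := UBL_point.tanProj l.UBL_drive

lemma continuous_vel (i : Fin N) : Continuous fun q => l.vel q i := by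
  obtain ⟨C, hC, h⟩ := l.UBL_vel
  exact (LipschitzWith.of_dist_le_mul (K := ⟨C, hC⟩) fun x y => by
    rw [dist_eq_norm]; exact (h i).2 x y).continuous

lemma continuous_gain : Continuous l.gain := by
  obtain ⟨C, hC, h⟩ := l.UBL_gain (Ω := Unit)
  exact (LipschitzWith.of_dist_le_mul (K := ⟨C, hC⟩) fun x y => by
    rw [dist_eq_norm]
    refine ((h ()).2 (x, 0) (y, 0)).trans_eq ?_
    simp only [Prod.dist_eq, dist_self, max_eq_left dist_nonneg]
    rfl).continuous

/-- The closed loop as an autonomous field on the state space. -/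
def field (Y : State d N) : State d N := fun i =>
  ⟨fun x => l.vel (Y, Y i x) i, (l.continuous_vel i).comp
    (continuous_const.prodMk (Y i).continuous)⟩

lemma exists_field_bounds : ∃ C : NNReal, (∀ Y, ‖l.field Y‖ ≤ C) ∧ LipschitzWith C l.field := by
  obtain ⟨C, hC, h⟩ := l.UBL_vel
  refine ⟨⟨C, hC⟩, fun Y => ?_, LipschitzWith.of_dist_le_mul fun Y Y' => ?_⟩
  · exact (pi_norm_le_iff_of_nonneg hC).2 fun i => (ContinuousMap.norm_le _ hC).2 fun x => (h i).1 _
  · refine (dist_pi_le_iff (by positivity)).2 fun i => (ContinuousMap.dist_le (by positivity)).2 fun x => ?_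
    rw [dist_eq_norm]
    refine ((h i).2 _ _).trans ?_
    refine mul_le_mul_of_nonneg_left ?_ hC
    exact max_le le_rfl ((ContinuousMap.dist_apply_le_dist x).trans (dist_le_pi_dist Y Y' i))

/-- The field is bounded and Lipschitz on the whole Banach space, so Picard–Lindelöf applies on all
of `[0, τ]` at once, in a ball of radius `C τ`. -/
lemma exists_solution {τ : ℝ} (hτ : 0 < τ) (Y₀ : State d N) : ∃ α : ℝ → State d N, α 0 = Y₀ ∧
    ∀ t ∈ Icc 0 τ, HasDerivWithinAt α (l.field (α t)) (Icc 0 τ) t := by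
  obtain ⟨C, hC, hL⟩ := l.exists_field_bounds
  have h : IsPicardLindelof (fun _ => l.field) (tmin := 0) (tmax := τ) ⟨0, le_rfl, hτ.le⟩ Y₀
      (C * τ.toNNReal) 0 C C :=
    IsPicardLindelof.of_time_independent (fun Y _ => hC Y) hL.lipschitzOnWith (by
      simp [hτ.le])
  exact h.exists_eq_forall_mem_Icc_hasDerivWithinAt₀

end Loop

/-- The radial velocity vanishes outside the unit ball and is `O(1 - ‖y‖²)` inside. Hence `‖y‖² - 1`
obeys a linear differential inequality and stays zero if it starts at zero. -/
lemma abs_inner_tanProj_retr_le (y g : E d) : |⟪y, tanProj (retr y) g⟫| ≤ ‖g‖ * |‖y‖ ^ 2 - 1| := by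
  rcases le_total 1 ‖y‖ with h | h
  · have hy : ‖y‖ ≠ 0 := by linarith
    have : ⟪y, tanProj (retr y) g⟫ = 0 := by
      simp only [tanProj, retr, max_eq_right h, inner_sub_right, inner_smul_right,
        real_inner_smul_left, real_inner_self_eq_norm_sq]
      field_simp
      simp
    rw [this, abs_zero]
    positivity
  · have : ⟪y, tanProj (retr y) g⟫ = ⟪y, g⟫ * (1 - ‖y‖ ^ 2) := by
      simp only [tanProj, retr_of_norm_le h, inner_sub_right, inner_smul_right,
        real_inner_self_eq_norm_sq]
      ring
    rw [this, abs_mul, abs_sub_comm]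
    gcongr
    have := abs_real_inner_le_norm y g
    nlinarith [norm_nonneg g]

/-- Curves driven by projected velocities do not leave the sphere. -/
lemma norm_eq_one_of_deriv {τ M : ℝ} {y g : ℝ → E d} (h0 : ‖y 0‖ = 1) (hg : ∀ t, ‖g t‖ ≤ M)
    (hd : ∀ t ∈ Icc 0 τ, HasDerivWithinAt y (tanProj (retr (y t)) (g t)) (Icc 0 τ) t) :
    ∀ t ∈ Icc 0 τ, ‖y t‖ = 1 := by
  have hu : ∀ t ∈ Icc 0 τ, HasDerivWithinAt (fun t => ‖y t‖ ^ 2 - 1)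
      (2 * ⟪y t, tanProj (retr (y t)) (g t)⟫) (Icc 0 τ) t := fun t ht =>
    ((hd t ht).norm_sq).sub_const 1
  have hz := eq_zero_of_abs_deriv_le_mul_abs_self_of_eq_zero_right (K := 2 * M) (a := 0) (b := τ)
    (f := fun t => ‖y t‖ ^ 2 - 1) (f' := fun t => 2 * ⟪y t, tanProj (retr (y t)) (g t)⟫)
    (fun t ht => (hu t ht).continuousWithinAt)
    (fun t ht => ((hu t ⟨ht.1, ht.2.le⟩).mono_of_mem_nhdsWithin
      (Icc_mem_nhdsGE_of_mem ht)))
    (by simp [h0]) (fun t ht => by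
      rw [norm_mul, Real.norm_eq_abs, Real.norm_eq_abs, Real.norm_eq_abs, abs_two, mul_assoc]
      have := abs_inner_tanProj_retr_le (y t) (g t)
      have := hg t
      nlinarith [abs_nonneg (‖y t‖ ^ 2 - 1)])
  intro t ht
  have := hz t ht
  have h1 : ‖y t‖ ^ 2 = 1 := by linarith
  nlinarith [norm_nonneg (y t)]

/-- The inclusion of sphere-valued maps into vector-valued maps. -/
def incl (g : C(S d, S d)) : C(S d, E d) := ⟨fun x => g x, by fun_prop⟩

/-- The feedback loop has a solution: the controls are continuous in time, they satisfy the
feedback law, and they drive all the measures simultaneously. -/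
theorem exists_closedLoop (hd : 0 < d) (l : Loop d N)
    (haz : 0 < ⟪(l.a : E d), (l.z : E d)⟫) {τ : ℝ} (hτ : 0 < τ) :
    ∃ (X : Fin N → ℝ → C(S d, S d)) (w : ℝ → E d), Continuous w ∧
      (∀ i, IsFlow τ (fun t => fbParams l.lam l.B l.a (w t)) (l.μ₀ i) (X i)) ∧
      (∀ t, ⟪(l.a : E d), (l.z : E d)⟫ • w t =
        l.lam • ((l.z : E d) - attention l.B (push (l.μ₀ l.k) (X l.k t)) l.z)) ∧
      ∀ i, ∃ v : ℝ → C(S d, E d), ∀ t ∈ Icc 0 τ,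
        HasDerivWithinAt (fun t => incl (X i t)) (v t) (Icc 0 τ) t ∧
        ∀ x, v t x = vField (fbParams l.lam l.B l.a (w t)) (push (l.μ₀ i) (X i t)) (X i t x) := by
  obtain ⟨α, hα0, hα⟩ := l.exists_solution hτ (fun _ => ⟨fun x : S d => (x : E d), continuous_subtype_val⟩)
  obtain ⟨M, hM, hMb⟩ := l.UBL_drive
  have hαi : ∀ i, ∀ t ∈ Icc 0 τ, HasDerivWithinAt (fun t => α t i) (l.field (α t) i) (Icc 0 τ) t :=
    fun i t ht => (hasDerivWithinAt_pi.1 (hα t ht)) i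
  have hαx : ∀ i (x : S d), ∀ t ∈ Icc 0 τ,
      HasDerivWithinAt (fun t => α t i x) (l.vel (α t, α t i x) i) (Icc 0 τ) t := fun i x t ht =>
    (ContinuousMap.evalCLM ℝ x : C(S d, E d) →L[ℝ] E d).hasFDerivAt.comp_hasDerivWithinAt t
      (hαi i t ht)
  have hαn : ∀ i (x : S d), ∀ t ∈ Icc 0 τ, ‖α t i x‖ = 1 := fun i x =>
    norm_eq_one_of_deriv (g := fun t => l.drive (α t, α t i x) i) (M := M) (by simp [hα0])
      (fun t => (hMb i).1 _) (hαx i x)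
  have hαc : ContinuousOn α (Icc 0 τ) := fun t ht => (hα t ht).continuousWithinAt
  -- Clamping time to `[0, τ]` makes flows and controls continuous on the whole line, as `IsFlow`
  -- and the conclusion demand.
  let π : ℝ → ℝ := fun t => projIcc 0 τ hτ.le t
  have hπ : Continuous π := continuous_subtype_val.comp continuous_projIcc
  have hπm : ∀ t, π t ∈ Icc 0 τ := fun t => (projIcc 0 τ hτ.le t).2
  have hπe : ∀ t ∈ Icc 0 τ, π t = t := fun t ht => by simp only [π, projIcc_of_mem hτ.le ht]
  have hαπ : Continuous fun t => α (π t) := hαc.comp_continuous hπ hπm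
  have hαS : ∀ i t x, α (π t) i x ∈ Metric.sphere (0 : E d) 1 := fun i t x => by
    simpa using hαn i x (π t) (hπm t)
  let X : Fin N → ℝ → C(S d, S d) := fun i t =>
    ⟨fun x => ⟨α (π t) i x, hαS i t x⟩, (α (π t) i).continuous.subtype_mk (hαS i t)⟩
  have hXc : ∀ i, Continuous fun q : ℝ × S d => X i q.1 q.2 := fun i => by
    refine Continuous.subtype_mk (f := fun q : ℝ × S d => α (π q.1) i q.2) ?_
      fun q => hαS i q.1 q.2
    have h1 : Continuous fun q : ℝ × S d => α (π q.1) i :=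
      (continuous_apply i).comp (hαπ.comp continuous_fst)
    exact h1.eval continuous_snd
  have hretr : ∀ i t (s : S d), retr (α (π t) i s) = (X i t s : E d) := fun i t s =>
    retr_of_norm_le (hαn i s (π t) (hπm t)).le
  have hatt : ∀ i t (x : E d), tilt (l.μ₀ i : Measure (S d)) (fun s => retr (α (π t) i s)) (mulV l.B x)
      = attention l.B (push (l.μ₀ i) (X i t)) x := fun i t x => by
    rw [attention_eq_tilt, tilt_push]
    simp only [hretr]
  let w : ℝ → E d := fun t => l.gain (α (π t))
  have hvel : ∀ i t (x : S d), l.vel (α (π t), α (π t) i x) i =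
      vField (fbParams l.lam l.B l.a (w t)) (push (l.μ₀ i) (X i t)) (X i t x) := fun i t x => by
    rw [vField_fbParams hd]
    simp only [Loop.vel, Loop.drive, hatt, w]
    simp only [hretr]
  -- Differentiability in the sup norm, stronger than along each trajectory: later Grönwall
  -- estimates run on the radius of a whole support.
  have hflow : ∀ i, ∀ t ∈ Icc 0 τ, HasDerivWithinAt (fun t => incl (X i t))
      (l.field (α t) i) (Icc 0 τ) t := fun i t ht => by
    refine (hαi i t ht).congr_of_mem (fun s hs => ?_) ht
    ext1 x
    change α (π s) i x = α s i x
    rw [hπe s hs]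
  refine ⟨X, w, l.continuous_gain.comp hαπ, fun i => ⟨hXc i, fun x => ?_, fun x t ht => ?_⟩,
    fun t => ?_, fun i => ⟨fun t => l.field (α t) i, fun t ht => ⟨hflow i t ht, fun x => ?_⟩⟩⟩
  · refine Subtype.ext ?_
    change α (π 0) i x = x
    rw [hπe 0 ⟨le_rfl, hτ.le⟩, hα0]
    rfl
  · rw [← hvel i t x]
    have htI := Ioo_subset_Icc_self ht
    have h1 := (hαx i x t htI).hasDerivAt (Icc_mem_nhds ht.1 ht.2)
    rw [hπe t htI]
    refine h1.congr_of_eventuallyEq ?_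
    filter_upwards [Icc_mem_nhds ht.1 ht.2] with s hs
    change α (π s) i x = α s i x
    rw [hπe s hs]
  · simp only [w, Loop.gain, hatt]
    rw [smul_smul, mul_inv_cancel₀ haz.ne', one_smul, smul_sub]
  · rw [← hvel i t x, hπe t ht]
    rfl

end Transformer

end

/-! ### Separation of measures by Laplace transforms. -/

noncomputable section

namespace Transformer

variable {d : ℕ}

section Laplace

variable {m m' : Measure (E d)} [IsProbabilityMeasure m] [IsProbabilityMeasure m'] {R : ℝ}

lemma integrable_exp_inner (hm : ∀ᵐ y ∂m, ‖y‖ ≤ R) (η : E d) :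
    Integrable (fun y => Real.exp ⟪η, y⟫) m := by
  refine Integrable.of_bound (by fun_prop : Continuous fun y : E d => Real.exp ⟪η, y⟫).aestronglyMeasurable
    (Real.exp (‖η‖ * R)) ?_
  filter_upwards [hm] with y hy
  rw [Real.norm_eq_abs, Real.abs_exp, Real.exp_le_exp]
  exact (real_inner_le_norm _ _).trans (mul_le_mul_of_nonneg_left hy (norm_nonneg _))

lemma continuous_laplace (hm : ∀ᵐ y ∂m, ‖y‖ ≤ R) :
    Continuous fun η : E d => ∫ y, Real.exp ⟪η, y⟫ ∂m := by
  refine continuous_iff_continuousAt.2 fun η₀ => ?_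
  refine continuousAt_of_dominated (bound := fun _ => Real.exp ((‖η₀‖ + 1) * R)) ?_ ?_
    (integrable_const _) (.of_forall fun y => by fun_prop)
  · exact .of_forall fun η =>
      (by fun_prop : Continuous fun y : E d => Real.exp ⟪η, y⟫).aestronglyMeasurable
  · filter_upwards [Metric.ball_mem_nhds η₀ one_pos] with η hη
    filter_upwards [hm] with y hy
    rw [Real.norm_eq_abs, Real.abs_exp, Real.exp_le_exp]
    have h1 : ‖η‖ ≤ ‖η₀‖ + 1 := by
      have := norm_le_norm_add_norm_sub' η η₀
      rw [mem_ball_iff_norm] at hη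
      linarith
    exact (real_inner_le_norm _ _).trans (mul_le_mul h1 hy (norm_nonneg _) (by positivity))

lemma interior_integrableExpSet_inner {m : Measure (E d)} (hm : ∀ η, Integrable (fun y => Real.exp ⟪η, y⟫) m)
    (v : E d) : interior (ProbabilityTheory.integrableExpSet (fun y : E d => ⟪v, y⟫) m) = univ := by
  have : ProbabilityTheory.integrableExpSet (fun y : E d => ⟪v, y⟫) m = univ := by
    refine eq_univ_of_forall fun t => ?_
    simpa [ProbabilityTheory.integrableExpSet, real_inner_smul_left] using hm (t • v)
  rw [this, interior_univ]

/-- A compactly supported measure is determined by its Laplace transform near one point. -/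
lemma eq_of_laplace_eventuallyEq (hm : ∀ᵐ y ∂m, ‖y‖ ≤ R) (hm' : ∀ᵐ y ∂m', ‖y‖ ≤ R) {η₀ : E d}
    (h : ∀ᶠ η in 𝓝 η₀, ∫ y, Real.exp ⟪η, y⟫ ∂m = ∫ y, Real.exp ⟪η, y⟫ ∂m') : m = m' := by
  have hi := integrable_exp_inner hm
  have hi' := integrable_exp_inner hm'
  -- Along a line through `η₀` the normalised Laplace transform is the moment generating function of
  -- the measure tilted by `η₀`, hence analytic. Agreement near `η₀` thus spreads along the line to
  -- every `η`.
  have key : ∀ n : Measure (E d), IsProbabilityMeasure n →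
      (∀ η, Integrable (fun y => Real.exp ⟪η, y⟫) n) → ∀ v : E d,
      AnalyticOnNhd ℝ (fun t : ℝ => (∫ y, Real.exp ⟪η₀ + t • v, y⟫ ∂n) /
        ∫ y, Real.exp ⟪η₀, y⟫ ∂n) univ := fun n hn hni v => by
    have e : ∀ (t : ℝ) (y : E d), Real.exp (t * ⟪v, y⟫) = Real.exp ⟪t • v, y⟫ := fun t y => by
      rw [real_inner_smul_left]
    have e2 : ∀ u : E d, ((fun y : E d => ⟪η₀, y⟫) + fun y => ⟪u, y⟫) = fun y => ⟪η₀ + u, y⟫ :=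
      fun u => by ext y; simp [inner_add_left]
    have hnt : ∀ η, Integrable (fun y => Real.exp ⟪η, y⟫) (n.tilted fun y => ⟪η₀, y⟫) := fun η => by
      rw [integrable_tilted_iff (hni η₀)]
      simpa [← Real.exp_add, ← inner_add_left] using hni (η₀ + η)
    have := ProbabilityTheory.analyticOnNhd_mgf (X := fun y : E d => ⟪v, y⟫)
      (μ := n.tilted fun y => ⟪η₀, y⟫)
    rw [interior_integrableExpSet_inner hnt] at this
    refine this.congr isOpen_univ fun t _ => ?_
    simp only [ProbabilityTheory.mgf, e]
    rw [integral_exp_tilted, e2]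
  have hpos : 0 < ∫ y, Real.exp ⟪η₀, y⟫ ∂m := integral_exp_pos (hi η₀)
  have hF : ∀ η, ∫ y, Real.exp ⟪η, y⟫ ∂m = ∫ y, Real.exp ⟪η, y⟫ ∂m' := fun η => by
    have h1 := key m inferInstance hi (η - η₀)
    have h2 := key m' inferInstance hi' (η - η₀)
    have ht : Tendsto (fun t : ℝ => η₀ + t • (η - η₀)) (𝓝 0) (𝓝 η₀) := by
      have : Continuous fun t : ℝ => η₀ + t • (η - η₀) := by fun_prop
      simpa using this.tendsto 0
    have h3 := h1.eq_of_eventuallyEq h2 (z₀ := 0) (by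
      filter_upwards [ht.eventually h] with t ht
      rw [ht, h.self_of_nhds])
    have h4 := congrFun h3 1
    simp only [one_smul, add_sub_cancel, ← h.self_of_nhds] at h4
    exact (div_left_inj' hpos.ne').1 h4
  refine Measure.ext_of_charFun (funext fun t => ?_)
  have hmgf : ProbabilityTheory.mgf (fun y : E d => ⟪t, y⟫) m =
      ProbabilityTheory.mgf (fun y : E d => ⟪t, y⟫) m' := funext fun s => by
    simpa [ProbabilityTheory.mgf, real_inner_smul_left] using hF (s • t)
  -- Analytic continuation to the imaginary axis gives equality of characteristic functions.
  have h5 := ProbabilityTheory.eqOn_complexMGF_of_mgf hmgf (x := Complex.I) (by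
    simp [interior_integrableExpSet_inner hi])
  simpa [ProbabilityTheory.complexMGF, charFun_apply, real_inner_comm, mul_comm] using h5

end Laplace

/-- A direction, not along `c`, whose Laplace transforms separate finitely many distinct compactly
supported measures. -/
lemma exists_separating_direction (hd : 2 ≤ d) (c : E d) {N : ℕ} (m : Fin N → Measure (E d))
    [∀ i, IsProbabilityMeasure (m i)] {R : ℝ} (hm : ∀ i, ∀ᵐ y ∂(m i), ‖y‖ ≤ R)
    (hne : ∀ i j, i ≠ j → m i ≠ m j) : ∃ η : E d, η ∉ Submodule.span ℝ {c} ∧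
      ∀ i j, i ≠ j → ∫ y, Real.exp ⟪η, y⟫ ∂(m i) ≠ ∫ y, Real.exp ⟪η, y⟫ ∂(m j) := by
  -- `none` indexes the complement of the line of `c`, `some p` the condition for a pair; finitely
  -- many open dense sets have a common point.
  let O : Option {p : Fin N × Fin N // p.1 ≠ p.2} → Set (E d) := fun p => p.elim
    ((Submodule.span ℝ {c} : Submodule ℝ (E d)) : Set (E d))ᶜ
    fun p => {η | ∫ y, Real.exp ⟪η, y⟫ ∂(m p.1.1) ≠ ∫ y, Real.exp ⟪η, y⟫ ∂(m p.1.2)}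
  have hd' : Dense (⋂ p, O p) := by
    refine dense_iInter_of_isOpen (fun p => ?_) fun p => ?_
    · rcases p with _ | p
      · exact (Submodule.closed_of_finiteDimensional _).isOpen_compl
      · exact isOpen_ne_fun (continuous_laplace (hm _)) (continuous_laplace (hm _))
    · rcases p with _ | ⟨p, hp⟩
      -- A line has empty interior because `d ≥ 2`.
      · refine interior_eq_empty_iff_dense_compl.1 (not_nonempty_iff_eq_empty.1 fun hne => ?_)
        have htop := Submodule.eq_top_of_nonempty_interior' _ hne
        have h1 := finrank_span_le_card (R := ℝ) ({c} : Set (E d))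
        rw [htop, finrank_top, finrank_euclideanSpace, Fintype.card_fin] at h1
        simp at h1
        omega
      · refine fun η => by_contra fun hη => hne _ _ hp ?_
        rw [mem_closure_iff_frequently, not_frequently] at hη
        exact eq_of_laplace_eventuallyEq (hm _) (hm _) (hη.mono fun η h => by simpa [O] using h)
  obtain ⟨η, hη⟩ := hd'.nonempty
  rw [mem_iInter] at hη
  exact ⟨η, hη none, fun i j hij => hη (some ⟨(i, j), hij⟩)⟩

end Transformer

end

/-! ### Boosts: the conformal flow towards `c`. -/

noncomputable section

namespace Transformer

variable {d N : ℕ}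

section boost

/-- The parameter value whose vector field is the projection of `c`. -/
def boostParams (c : E d) : Params d where
  V := 0
  B := 0
  W := Matrix.of fun i _ => c i / d
  U := 0
  b := ones d

lemma vField_boostParams (hd : 0 < d) (c : E d) (μ : ProbabilityMeasure (S d)) (x : E d) :
    vField (boostParams c) μ x = tanProj x c := by
  have h : relu (0 + ones d) = (1:ℝ) • ones d := by
    ext i
    simp [relu, ones]
  rw [vField, boostParams, zero_mulV, zero_mulV, h, mulV_replicate_ones hd, zero_add, one_smul]

/-- The conformal factor of the boost by `s` in the direction `c`. -/
def boostDen (c : E d) (s : ℝ) (x : E d) : ℝ := Real.cosh s + ⟪c, x⟫ * Real.sinh s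

/-- The numerator of the boost. -/
def boostNum (c : E d) (s : ℝ) (x : E d) : E d :=
  x + (Real.sinh s + ⟪c, x⟫ * Real.cosh s - ⟪c, x⟫) • c

lemma boostDen_eq (c : E d) (s : ℝ) (x : E d) : boostDen c s x =
    Real.exp s * ((1 + ⟪c, x⟫) / 2) + Real.exp (-s) * ((1 - ⟪c, x⟫) / 2) := by
  rw [boostDen, Real.cosh_eq, Real.sinh_eq]
  ring

lemma abs_inner_le_one {x y : E d} (hx : ‖x‖ = 1) (hy : ‖y‖ = 1) : |⟪x, y⟫| ≤ 1 := by
  simpa [hx, hy] using abs_real_inner_le_norm x y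

lemma boostDen_pos {c x : E d} (hc : ‖c‖ = 1) (hx : ‖x‖ = 1) (s : ℝ) : 0 < boostDen c s x := by
  rw [boostDen_eq]
  obtain ⟨h1, h2⟩ := abs_le.1 (abs_inner_le_one hc hx)
  have e1 := Real.exp_pos s
  have e2 := Real.exp_pos (-s)
  rcases le_total 0 ⟪c, x⟫ with h | h
  · have : 0 ≤ Real.exp (-s) * ((1 - ⟪c, x⟫) / 2) := by
      apply mul_nonneg e2.le; linarith
    have : 0 < Real.exp s * ((1 + ⟪c, x⟫) / 2) := by apply mul_pos e1; linarith
    linarith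
  · have : 0 < Real.exp (-s) * ((1 - ⟪c, x⟫) / 2) := by
      apply mul_pos e2; linarith
    have : 0 ≤ Real.exp s * ((1 + ⟪c, x⟫) / 2) := by apply mul_nonneg e1.le; linarith
    linarith

/-- The pair (`boostDen`, `boostNum`) is the image of the null vector `(1, x)` under the Lorentz
boost of rapidity `s` along `c`. It is null again, by `cosh² - sinh² = 1`. -/
lemma norm_boostNum {c x : E d} (hc : ‖c‖ = 1) (hx : ‖x‖ = 1) (s : ℝ) :
    ‖boostNum c s x‖ = boostDen c s x := by
  have h : ‖boostNum c s x‖ ^ 2 = boostDen c s x ^ 2 := by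
    rw [boostNum, norm_add_sq_real, norm_smul, inner_smul_right, hc, hx, real_inner_comm x c,
      Real.norm_eq_abs, mul_one, sq_abs, boostDen]
    have := Real.cosh_sq s
    rw [real_inner_comm c x]
    linear_combination (⟪c, x⟫ ^ 2 - 1) * this
  exact (pow_left_inj₀ (norm_nonneg _) (boostDen_pos hc hx s).le two_ne_zero).1 h

lemma continuous_boostDen (c : E d) : Continuous fun q : ℝ × S d => boostDen c q.1 q.2 := by
  unfold boostDen
  fun_prop

lemma continuous_boostNum (c : E d) : Continuous fun q : ℝ × S d => boostNum c q.1 q.2 := by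
  unfold boostNum
  fun_prop

variable (c : S d)

lemma continuous_boostMap : Continuous fun q : ℝ × S d =>
    (boostDen (c : E d) q.1 q.2)⁻¹ • boostNum (c : E d) q.1 q.2 :=
  ((continuous_boostDen _).inv₀ fun q =>
    (boostDen_pos (norm_coe c) (norm_coe q.2) q.1).ne').smul (continuous_boostNum _)

lemma boostMap_mem (s : ℝ) (x : S d) :
    (boostDen (c : E d) s x)⁻¹ • boostNum (c : E d) s x ∈ Metric.sphere (0 : E d) 1 := by
  have h := boostDen_pos (norm_coe c) (norm_coe x) s
  rw [mem_sphere_zero_iff_norm, norm_smul, norm_boostNum (norm_coe c) (norm_coe x), norm_inv,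
    Real.norm_of_nonneg h.le, inv_mul_cancel₀ h.ne']

/-- The flow of `x ↦ tanProj x c` on the sphere. -/
def boost (s : ℝ) : C(S d, S d) :=
  ⟨fun x => ⟨_, boostMap_mem c s x⟩, ((continuous_boostMap c).comp
    (Continuous.prodMk_right s)).subtype_mk _⟩

lemma coe_boost (s : ℝ) (x : S d) :
    (boost c s x : E d) = (boostDen (c : E d) s x)⁻¹ • boostNum (c : E d) s x := rfl

lemma continuous_boost : Continuous fun q : ℝ × S d => boost c q.1 q.2 :=
  (continuous_boostMap c).subtype_mk fun q => boostMap_mem c q.1 q.2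

lemma boost_zero (x : S d) : boost c 0 x = x := by
  refine Subtype.ext ?_
  simp [coe_boost, boostDen, boostNum]

lemma inner_boost (s : ℝ) (x : S d) : ⟪(c : E d), (boost c s x : E d)⟫ =
    (boostDen (c : E d) s x)⁻¹ * (Real.sinh s + ⟪(c : E d), x⟫ * Real.cosh s) := by
  rw [coe_boost, inner_smul_right, boostNum, inner_add_right, inner_smul_right,
    real_inner_self_eq_norm_sq, norm_coe]
  ring

lemma inner_boost_of_orthogonal {η : E d} (h : ⟪η, (c : E d)⟫ = 0) (s : ℝ) (x : S d) :
    ⟪η, (boost c s x : E d)⟫ = (boostDen (c : E d) s x)⁻¹ * ⟪η, (x : E d)⟫ := by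
  rw [coe_boost, inner_smul_right, boostNum, inner_add_right, inner_smul_right, h]
  ring

lemma hasDerivAt_boost (s : ℝ) (x : S d) : HasDerivAt (fun s => (boost c s x : E d))
    (tanProj (boost c s x : E d) c) s := by
  have hD : HasDerivAt (fun s => boostDen (c : E d) s x)
      (Real.sinh s + ⟪(c : E d), x⟫ * Real.cosh s) s :=
    (Real.hasDerivAt_cosh s).add ((Real.hasDerivAt_sinh s).const_mul _)
  have hN : HasDerivAt (fun s => boostNum (c : E d) s x)
      ((Real.cosh s + ⟪(c : E d), x⟫ * Real.sinh s) • (c : E d)) s :=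
    ((((Real.hasDerivAt_sinh s).add ((Real.hasDerivAt_cosh s).const_mul _)).sub_const _).smul_const
      (c : E d)).const_add _
  have h0 := (boostDen_pos (norm_coe c) (norm_coe x) s).ne'
  have h := (hD.inv h0).smul hN
  refine h.congr_deriv ?_
  rw [tanProj, real_inner_comm (c : E d), inner_boost, coe_boost]
  change (boostDen (c : E d) s x)⁻¹ • boostDen (c : E d) s x • (c : E d) + _ = _
  rw [smul_smul, inv_mul_cancel₀ h0, one_smul, sub_eq_add_neg, ← neg_smul,
    smul_smul]
  congr 2
  simp only [pow_two]
  field_simp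

/-- Since `‖y - c‖² = 2(1 - ⟪c, y⟫)` on the sphere, the squared distance is exactly `2(1 - ⟪c,
x⟫)e^{-s}` over `boostDen`, and the denominator is at least `e^s δ / 2`. -/
lemma norm_boost_sub_le {δ : ℝ} (hδ : 0 < δ) (s : ℝ) {x : S d}
    (hx : δ ≤ 1 + ⟪(c : E d), (x : E d)⟫) :
    ‖(boost c s x : E d) - c‖ ≤ √(8 / δ) * Real.exp (-s) := by
  obtain ⟨h1, h2⟩ := abs_le.1 (abs_inner_le_one (norm_coe c) (norm_coe x))
  have hD := boostDen_pos (norm_coe c) (norm_coe x) s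
  have hD' : Real.exp s * (δ / 2) ≤ boostDen (c : E d) s x := by
    rw [boostDen_eq]
    have : 0 ≤ Real.exp (-s) * ((1 - ⟪(c : E d), x⟫) / 2) :=
      mul_nonneg (Real.exp_pos _).le (by linarith)
    have : Real.exp s * (δ / 2) ≤ Real.exp s * ((1 + ⟪(c : E d), x⟫) / 2) := by gcongr
    linarith
  refine abs_le_of_sq_le_sq' ?_ (by positivity) |>.2
  rw [norm_sub_sq_real, norm_coe, norm_coe, real_inner_comm, inner_boost, mul_pow,
    Real.sq_sqrt (by positivity)]
  have e : (1:ℝ) ^ 2 - 2 * ((boostDen (c : E d) s x)⁻¹ *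
      (Real.sinh s + ⟪(c : E d), x⟫ * Real.cosh s)) + 1 ^ 2 =
      2 * (1 - ⟪(c : E d), x⟫) * Real.exp (-s) / boostDen (c : E d) s x := by
    field_simp
    rw [boostDen, Real.sinh_eq, Real.cosh_eq]
    ring
  rw [e, div_le_iff₀ hD]
  have e3 : Real.exp (-s) * Real.exp s = 1 := by rw [← Real.exp_add]; simp
  calc 2 * (1 - ⟪(c : E d), x⟫) * Real.exp (-s) ≤ 4 * Real.exp (-s) := by
        gcongr; linarith
    _ = 8 / δ * Real.exp (-s) ^ 2 * (Real.exp s * (δ / 2)) := by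
        field_simp
        linear_combination (-8) * e3
    _ ≤ _ := by gcongr

/-- The blow-up of the boost at the sink. -/
lemma tendsto_exp_mul_inv_boostDen {x : S d} (hx : 0 < 1 + ⟪(c : E d), (x : E d)⟫) :
    Tendsto (fun s => Real.exp s * (boostDen (c : E d) s x)⁻¹) atTop
      (𝓝 (2 / (1 + ⟪(c : E d), (x : E d)⟫))) := by
  have h1 : Tendsto (fun s : ℝ => Real.exp (-s)) atTop (𝓝 0) :=
    Real.tendsto_exp_neg_atTop_nhds_zero
  have h2 : Tendsto (fun s : ℝ => ((1 + ⟪(c : E d), (x : E d)⟫) / 2 +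
      Real.exp (-s) * Real.exp (-s) * ((1 - ⟪(c : E d), (x : E d)⟫) / 2))⁻¹) atTop
      (𝓝 ((1 + ⟪(c : E d), (x : E d)⟫) / 2 + 0 * 0 * ((1 - ⟪(c : E d), (x : E d)⟫) / 2))⁻¹) :=
    (((h1.mul h1).mul_const _).const_add _).inv₀ (by simp; exact hx.ne')
  simp only [zero_mul, add_zero, inv_div] at h2
  refine h2.congr fun s => ?_
  have e3 : Real.exp (-s) * Real.exp s = 1 := by rw [← Real.exp_add]; simp
  have hD := boostDen_pos (norm_coe c) (norm_coe x) s
  rw [← div_eq_mul_inv, inv_eq_one_div, div_eq_div_iff _ hD.ne', boostDen_eq]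
  · linear_combination (-Real.exp (-s) * (1 - ⟪(c : E d), (x : E d)⟫) / 2) * e3
  · obtain ⟨h1, h2⟩ := abs_le.1 (abs_inner_le_one (norm_coe c) (norm_coe x))
    have : 0 ≤ Real.exp (-s) * Real.exp (-s) * ((1 - ⟪(c : E d), (x : E d)⟫) / 2) := by
      apply mul_nonneg (by positivity); linarith
    linarith

lemma exp_mul_inv_boostDen_le {δ : ℝ} (hδ : 0 < δ) {x : S d}
    (hx : δ ≤ 1 + ⟪(c : E d), (x : E d)⟫) (s : ℝ) :
    Real.exp s * (boostDen (c : E d) s x)⁻¹ ≤ 2 / δ := by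
  have hD := boostDen_pos (norm_coe c) (norm_coe x) s
  rw [← div_eq_mul_inv, div_le_div_iff₀ hD hδ, boostDen_eq]
  obtain ⟨h1, h2⟩ := abs_le.1 (abs_inner_le_one (norm_coe c) (norm_coe x))
  have : 0 ≤ Real.exp (-s) * ((1 - ⟪(c : E d), x⟫) / 2) :=
    mul_nonneg (Real.exp_pos _).le (by linarith)
  have : Real.exp s * δ ≤ Real.exp s * (1 + ⟪(c : E d), x⟫) := by gcongr
  linarith

lemma continuousParams_const {Z : Type*} [TopologicalSpace Z] (p : Params d) :
    ContinuousParams fun _ : Z => p :=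
  ⟨fun _ _ => continuous_const, fun _ _ => continuous_const, fun _ _ => continuous_const,
    fun _ _ => continuous_const, fun _ => continuous_const⟩

lemma steers_boost (hd : 0 < d) (μ₀ : Fin N → ProbabilityMeasure (S d)) (τ κ : ℝ) :
    Steers τ (fun _ => boostParams (κ • (c : E d))) μ₀
      fun i t => push (μ₀ i) (boost c (κ * t)) := by
  refine ⟨(continuousParams_const _).isLinfty τ, fun i => ?_, fun t _ => .inl rfl⟩
  refine IsFlow.isWeakSolution (X := fun t => boost c (κ * t)) (continuousParams_const _)
    ⟨?_, fun x => ?_, fun x t _ => ?_⟩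
  · exact (continuous_boost c).comp (f := fun q : ℝ × S d => (κ * q.1, q.2)) (by fun_prop)
  · rw [mul_zero, boost_zero]
  · rw [vField_boostParams hd, tanProj_smul]
    have := (hasDerivAt_boost c (κ * t) x).scomp t ((hasDerivAt_id t).const_mul κ)
    rw [mul_one] at this
    exact this

end boost

/-! ### Bounds along feedback loops. -/

section loops

lemma norm_attention_sub_le (B : Matrix (Fin d) (Fin d) ℝ) (μ : ProbabilityMeasure (S d)) (x p : E d)
    {r : ℝ} (h : ∀ y ∈ supp μ, ‖(y : E d) - p‖ ≤ r) : ‖attention B μ x - p‖ ≤ r := by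
  rw [attention_eq_tilt]
  refine norm_tilt_le ?_ (integrable_sphere (by fun_prop) μ) (integrable_sphere (by fun_prop) μ)
  filter_upwards [ae_mem_supp μ] with y hy using h y hy

lemma norm_attention_le (B : Matrix (Fin d) (Fin d) ℝ) (μ : ProbabilityMeasure (S d)) (x : E d) :
    ‖attention B μ x‖ ≤ 1 := by
  simpa using norm_attention_sub_le B μ x 0 (r := 1) fun y _ => by simp

lemma norm_vField_fbParams_le (hd : 0 < d) {lam : ℝ} (hlam : 0 ≤ lam)
    (B : Matrix (Fin d) (Fin d) ℝ) (a : S d) (w : E d) (μ : ProbabilityMeasure (S d)) (x : S d) :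
    ‖vField (fbParams lam B a w) μ x‖ ≤ lam + ‖w‖ := by
  rw [vField_fbParams hd]
  refine (norm_tanProj_le_of_unit (norm_coe x) _).trans ((norm_add_le _ _).trans ?_)
  rw [norm_smul, norm_smul, Real.norm_of_nonneg hlam, Real.norm_of_nonneg (le_max_right _ _)]
  have h1 := norm_attention_le B μ x
  have h2 := (abs_le.1 (abs_inner_le_one (norm_coe a) (norm_coe x))).2
  refine add_le_add (by nlinarith) ?_
  exact mul_le_of_le_one_left (norm_nonneg _) (max_le h2 zero_le_one)

lemma continuousParams_fbParams (lam : ℝ) (B : Matrix (Fin d) (Fin d) ℝ) (a : E d) {w : ℝ → E d}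
    (hw : Continuous w) : ContinuousParams fun t => fbParams lam B a (w t) :=
  ⟨fun _ _ => continuous_const, fun _ _ => continuous_const,
    fun i _ => by simp only [fbParams, Matrix.of_apply]; fun_prop,
    fun _ _ => continuous_const, fun _ => continuous_const⟩

lemma isFeedback_fbParams (hd : 0 < d) {lam : ℝ} (hlam : 0 < lam) {B : Matrix (Fin d) (Fin d) ℝ}
    (hB : B ≠ 0) {a z : S d} (haz : 0 < ⟪(a : E d), (z : E d)⟫) {w : E d} {k : Fin N}
    {μ : Fin N → ProbabilityMeasure (S d)}
    (hneg : ∀ j, j ≠ k → ∀ x ∈ supp (μ j), ⟪(a : E d), (x : E d)⟫ < 0)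
    (hw : ⟪(a : E d), (z : E d)⟫ • w = lam • ((z : E d) - attention B (μ k) z)) :
    IsFeedback (fbParams lam B a w) μ k lam a z := by
  refine ⟨hlam, rfl, hB, rfl, rfl, haz, hneg, ?_⟩
  have := mulV_replicate_ones hd w 1
  rw [one_smul, one_smul] at this
  simp only [fbParams, this, smul_one_mulV, max_eq_left haz.le, hw]
  rw [smul_sub, sub_add_cancel]

lemma norm_gain_le {lam : ℝ} (hlam : 0 ≤ lam) {B : Matrix (Fin d) (Fin d) ℝ} {a z : S d}
    (haz : 0 < ⟪(a : E d), (z : E d)⟫) {w : E d} {μ : ProbabilityMeasure (S d)}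
    (hw : ⟪(a : E d), (z : E d)⟫ • w = lam • ((z : E d) - attention B μ z)) :
    ‖w‖ ≤ 2 * lam / ⟪(a : E d), (z : E d)⟫ := by
  have h := congrArg norm hw
  rw [norm_smul, norm_smul, Real.norm_of_nonneg haz.le, Real.norm_of_nonneg hlam] at h
  rw [le_div_iff₀ haz, mul_comm, h]
  have h1 := norm_sub_le (z : E d) (attention B μ z)
  have h2 := norm_attention_le B μ (z : E d)
  rw [norm_coe] at h1
  nlinarith

/-- The feedback loop is driven at bounded speed and steers the data, as long as the half-space
condition holds. -/
lemma steers_loop (hd : 0 < d) (l : Loop d N) (hlam : 0 < l.lam) (hB : l.B ≠ 0)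
    (haz : 0 < ⟪(l.a : E d), (l.z : E d)⟫) {τ : ℝ} {X : Fin N → ℝ → C(S d, S d)} {w : ℝ → E d}
    (hwc : Continuous w)
    (hX : ∀ i, IsFlow τ (fun t => fbParams l.lam l.B l.a (w t)) (l.μ₀ i) (X i))
    (hw : ∀ t, ⟪(l.a : E d), (l.z : E d)⟫ • w t =
        l.lam • ((l.z : E d) - attention l.B (push (l.μ₀ l.k) (X l.k t)) l.z))
    (hneg : ∀ t ∈ Icc 0 τ, ∀ j, j ≠ l.k → ∀ x ∈ supp (l.μ₀ j), ⟪(l.a : E d), (X j t x : E d)⟫ < 0) :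
    Steers τ (fun t => fbParams l.lam l.B l.a (w t)) l.μ₀ (fun i t => push (l.μ₀ i) (X i t)) ∧
    ∀ t ∈ Icc 0 τ, IsFeedback (fbParams l.lam l.B l.a (w t)) (fun i => push (l.μ₀ i) (X i t))
      l.k l.lam l.a l.z := by
  have hc := continuousParams_fbParams l.lam l.B l.a hwc
  have hF : ∀ t ∈ Icc 0 τ, IsFeedback (fbParams l.lam l.B l.a (w t))
      (fun i => push (l.μ₀ i) (X i t)) l.k l.lam l.a l.z := fun t ht =>
    isFeedback_fbParams hd hlam hB haz (fun j hj x hx => by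
      obtain ⟨y, hy, rfl⟩ := supp_push_subset _ _ hx
      exact hneg t ht j hj y hy) (hw t)
  exact ⟨⟨hc.isLinfty τ, fun i => (hX i).isWeakSolution hc, fun t ht =>
    .inr ⟨l.k, l.lam, l.a, l.z, hF t (Ioc_subset_Icc_self ht)⟩⟩, hF⟩

end loops

end Transformer

end

/-! ### Localisation of the data near `c`. -/

noncomputable section

namespace Transformer

variable {d N : ℕ}

/-- Restriction of vector-valued maps to a subset of the sphere. -/
def restrictCLM (K : Set (S d)) [CompactSpace K] : C(S d, E d) →L[ℝ] C(K, E d) :=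
  LinearMap.mkContinuous
    { toFun := fun f => f.restrict K
      map_add' := fun _ _ => rfl
      map_smul' := fun _ _ => rfl } 1 fun f => by
    rw [one_mul]
    exact (ContinuousMap.norm_le _ (norm_nonneg _)).2 fun x => f.norm_coe_le_norm x

lemma restrictCLM_apply (K : Set (S d)) [CompactSpace K] (f : C(S d, E d)) (x : K) :
    restrictCLM K f x = f x := rfl

lemma one_sub_inner_le {c x : E d} (hc : ‖c‖ = 1) : 1 - ⟪c, x⟫ ≤ ‖x - c‖ := by
  have h := real_inner_le_norm c (c - x)
  rw [inner_sub_right, real_inner_self_eq_norm_sq, hc, norm_sub_rev] at h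
  linarith

/-- The projection kills `x`, so attention counts only through `A - x`, of size `2r`; the ReLU
factor is at most `r`. No smallness of `r` is assumed, so the estimate can feed a Grönwall argument
before the radius is known to be small. -/
lemma norm_vField_near_le (hd : 0 < d) {lam r : ℝ} (hlam : 0 ≤ lam) (B : Matrix (Fin d) (Fin d) ℝ)
    (c : S d) {w : E d} (hw : ‖w‖ ≤ 2 * lam) {μ : ProbabilityMeasure (S d)} {x : S d}
    (hx : ‖(x : E d) - c‖ ≤ r) (hμ : ∀ y ∈ supp μ, ‖(y : E d) - c‖ ≤ r) :
    ‖vField (fbParams lam B (-(c : E d)) w) μ x‖ ≤ 4 * lam * r := by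
  have hA := norm_attention_sub_le B μ (x : E d) c hμ
  have e : vField (fbParams lam B (-(c : E d)) w) μ x =
      tanProj (x : E d) (lam • (attention B μ x - x) + max ⟪-(c : E d), x⟫ 0 • w) := by
    rw [vField_fbParams hd, tanProj_add, tanProj_add, smul_sub, tanProj_sub, tanProj_smul _ (x : E d),
      tanProj_self (norm_coe x), smul_zero, sub_zero]
  have h0 : 0 ≤ r := (norm_nonneg _).trans hx
  have h1 : ‖attention B μ x - x‖ ≤ 2 * r := by
    have := norm_sub_le_norm_sub_add_norm_sub (attention B μ x) (c : E d) x
    rw [norm_sub_rev (c : E d)] at this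
    linarith
  have h2 : max ⟪-(c : E d), (x : E d)⟫ 0 ≤ r := by
    refine max_le ?_ h0
    have := one_sub_inner_le (x := (x : E d)) (norm_coe c)
    rw [inner_neg_left]
    linarith
  rw [e]
  refine (norm_tanProj_le_of_unit (norm_coe x) _).trans ((norm_add_le _ _).trans ?_)
  rw [norm_smul, norm_smul, Real.norm_of_nonneg hlam, Real.norm_of_nonneg (le_max_right _ _)]
  have h3 : max ⟪-(c : E d), (x : E d)⟫ 0 * ‖w‖ ≤ r * (2 * lam) := by gcongr
  nlinarith

/-- Along the feedback loop whose half-space is opposite to `c`, a measure clustered near `c` spreads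
at most exponentially. -/
lemma norm_flow_sub_le (hd : 0 < d) {lam ρ τ : ℝ} (hlam : 0 ≤ lam) {B : Matrix (Fin d) (Fin d) ℝ}
    {c : S d} {w : ℝ → E d} (hw : ∀ t, ‖w t‖ ≤ 2 * lam) {μ : ProbabilityMeasure (S d)}
    {X : ℝ → C(S d, S d)} (hX0 : ∀ x, X 0 x = x) {v : ℝ → C(S d, E d)}
    (hv : ∀ t ∈ Icc 0 τ, HasDerivWithinAt (fun t => incl (X t)) (v t) (Icc 0 τ) t ∧
      ∀ x, v t x = vField (fbParams lam B (-(c : E d)) (w t)) (push μ (X t)) (X t x))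
    (hρ : ∀ x ∈ supp μ, ‖(x : E d) - c‖ ≤ ρ) :
    ∀ t ∈ Icc 0 τ, ∀ x ∈ supp μ, ‖(X t x : E d) - c‖ ≤ ρ * Real.exp (4 * lam * t) := by
  have : CompactSpace (supp μ) := isCompact_iff_compactSpace.1 (isCompact_supp μ)
  have hρ0 : 0 ≤ ρ := by
    obtain ⟨x, hx⟩ := supp_nonempty μ
    exact (norm_nonneg _).trans (hρ x hx)
  -- The speed of one particle depends on the radius of the whole support, so the estimate is run on
  -- the sup norm over the support.
  let f : ℝ → C(supp μ, E d) := fun t => restrictCLM (supp μ) (incl (X t) - .const _ (c : E d))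
  have hf : ∀ t x, f t x = (X t x : E d) - c := fun t x => rfl
  have hfd : ∀ t ∈ Icc 0 τ, HasDerivWithinAt f (restrictCLM (supp μ) (v t)) (Icc 0 τ) t :=
    fun t ht => (restrictCLM (supp μ)).hasFDerivAt.comp_hasDerivWithinAt t
      ((hv t ht).1.sub_const _)
  have hfn : ∀ t, ∀ x ∈ supp μ, ‖(X t x : E d) - c‖ ≤ ‖f t‖ := fun t x hx => by
    rw [← hf t ⟨x, hx⟩]
    exact (f t).norm_coe_le_norm _
  have key := norm_le_gronwallBound_of_norm_deriv_right_le (f := f) (δ := ρ) (K := 4 * lam) (ε := 0)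
    (a := 0) (b := τ) (fun t ht => (hfd t ht).continuousWithinAt)
    (fun t ht => (hfd t ⟨ht.1, ht.2.le⟩).mono_of_mem_nhdsWithin (Icc_mem_nhdsGE_of_mem ht))
    ((ContinuousMap.norm_le _ hρ0).2 fun x => by rw [hf, hX0]; exact hρ x x.2)
    fun t ht => by
      rw [add_zero]
      refine (ContinuousMap.norm_le _ (by positivity)).2 fun x => ?_
      rw [restrictCLM_apply, (hv t ⟨ht.1, ht.2.le⟩).2]
      refine norm_vField_near_le hd hlam B c (hw t) (hfn t x x.2) fun y hy => ?_
      obtain ⟨y', hy', rfl⟩ := supp_push_subset _ _ hy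
      exact hfn t y' hy'
  intro t ht x hx
  have := key t ht
  rw [gronwallBound_ε0, sub_zero] at this
  exact (hfn t x hx).trans this

/-- The matrix of `x ↦ ⟪c, x⟫ • ξ`. -/
def dyad (ξ c : E d) : Matrix (Fin d) (Fin d) ℝ := Matrix.of fun i j => ξ i * c j

lemma mulV_dyad (ξ c x : E d) : mulV (dyad ξ c) x = ⟪c, x⟫ • ξ := by
  ext i
  rw [mulV_apply]
  simp only [dyad, Matrix.of_apply, PiLp.smul_apply, smul_eq_mul, PiLp.inner_apply, Finset.sum_mul]
  refine Finset.sum_congr rfl fun j _ => ?_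
  simp
  ring

lemma dyad_ne_zero {ξ : E d} (hξ : ξ ≠ 0) (c : S d) : dyad ξ (c : E d) ≠ 0 := fun h => by
  have := mulV_dyad ξ (c : E d) c
  rw [h, zero_mulV, real_inner_self_eq_norm_sq, norm_coe, one_pow, one_smul] at this
  exact hξ this.symm

/-! ### Gibbs means and relaxation of the coordinate `⟪ξ, ·⟫`. -/

section gibbs

variable {ν : ProbabilityMeasure (S d)} {ξ : E d} {M : ℝ}

/-- The mean of `⟪ξ, ·⟫` for the Gibbs measure of density `e^{s⟪ξ, ·⟫}`. -/
def gibbsMean (ν : ProbabilityMeasure (S d)) (ξ : E d) (s : ℝ) : ℝ :=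
  ⟪ξ, tilt (ν : Measure (S d)) (fun y : S d => (y : E d)) (s • ξ)⟫

/-- For `a` equal to the Gibbs mean at `s` the right side vanishes. This cancellation is behind the
near-conservation of the Laplace transform. -/
lemma integral_exp_mul_gibbs (ν : ProbabilityMeasure (S d)) (ξ : E d) (s a : ℝ) :
    ∫ y : S d, Real.exp (s * ⟪ξ, (y : E d)⟫) * (⟪ξ, (y : E d)⟫ - a) ∂(ν : Measure (S d)) =
      (∫ y : S d, Real.exp (s * ⟪ξ, (y : E d)⟫) ∂(ν : Measure (S d))) * (gibbsMean ν ξ s - a) := by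
  have hi : Integrable (fun y : S d => Real.exp (s * ⟪ξ, (y : E d)⟫)) (ν : Measure (S d)) :=
    integrable_sphere (by fun_prop) ν
  have hi' : Integrable (fun y : S d => Real.exp (s * ⟪ξ, (y : E d)⟫) • (y : E d))
      (ν : Measure (S d)) := integrable_sphere (by fun_prop) ν
  have hpos := integral_exp_pos hi
  simp only [mul_sub]
  rw [integral_sub (integrable_sphere (by fun_prop) ν) (integrable_sphere (by fun_prop) ν),
    integral_mul_const, gibbsMean, tilt]
  simp only [real_inner_smul_left]
  rw [inner_smul_right, ← mul_assoc, mul_inv_cancel₀ hpos.ne', one_mul, ← integral_inner hi']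
  simp only [inner_smul_right]

/-- The integral of `e^{s⟪ξ, y⟫}(⟪ξ, y⟫ - a)`, centred at the mean `a` for `s = 1`, vanishes at `s =
1`, so at `s` only the change of the exponential remains. In the application `s = ⟪c, x⟫`, whence
`|s| ≤ 1`. -/
lemma abs_gibbsMean_sub_le (hM : ∀ y ∈ supp ν, |⟪ξ, (y : E d)⟫| ≤ M) {s : ℝ} (hs : |s| ≤ 1) :
    |gibbsMean ν ξ s - gibbsMean ν ξ 1| ≤ 2 * M ^ 2 * Real.exp (2 * M) * |s - 1| := by
  have hM0 : 0 ≤ M := by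
    obtain ⟨x, hx⟩ := supp_nonempty ν
    exact (abs_nonneg _).trans (hM x hx)
  have hexp : ∀ u : ℝ, |u| ≤ 1 → ∀ y ∈ supp ν, |u * ⟪ξ, (y : E d)⟫| ≤ M := fun u hu y hy => by
    rw [abs_mul]
    have := hM y hy
    nlinarith [abs_nonneg u, abs_nonneg ⟪ξ, (y : E d)⟫]
  have hlow : ∀ u : ℝ, |u| ≤ 1 → Real.exp (-M) ≤
      ∫ y : S d, Real.exp (u * ⟪ξ, (y : E d)⟫) ∂(ν : Measure (S d)) := fun u hu => by
    have : ∫ _y : S d, Real.exp (-M) ∂(ν : Measure (S d)) ≤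
        ∫ y : S d, Real.exp (u * ⟪ξ, (y : E d)⟫) ∂(ν : Measure (S d)) := by
      refine integral_mono_ae (integrable_const _) (integrable_sphere (by fun_prop) ν) ?_
      filter_upwards [ae_mem_supp ν] with y hy
      exact Real.exp_le_exp.2 (neg_le_of_abs_le (hexp u hu y hy))
    simpa using this
  have hmean : |gibbsMean ν ξ 1| ≤ M := by
    have h1 := integral_exp_mul_gibbs ν ξ 1 0
    simp only [sub_zero] at h1
    have h2 : |∫ y : S d, Real.exp (1 * ⟪ξ, (y : E d)⟫) * ⟪ξ, (y : E d)⟫ ∂(ν : Measure (S d))| ≤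
        (∫ y : S d, Real.exp (1 * ⟪ξ, (y : E d)⟫) ∂(ν : Measure (S d))) * M := by
      rw [← integral_mul_const, ← Real.norm_eq_abs]
      refine norm_integral_le_of_norm_le (integrable_sphere (by fun_prop) ν) ?_
      filter_upwards [ae_mem_supp ν] with y hy
      rw [norm_mul, Real.norm_eq_abs, Real.abs_exp]
      exact mul_le_mul_of_nonneg_left (hM y hy) (Real.exp_pos _).le
    have hp := (Real.exp_pos _).trans_le (hlow 1 (by simp))
    rw [h1, abs_mul, abs_of_pos hp] at h2
    exact le_of_mul_le_mul_left h2 hp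
  set a := gibbsMean ν ξ 1
  have h0 := integral_exp_mul_gibbs ν ξ 1 a
  rw [sub_self, mul_zero] at h0
  have h1 := integral_exp_mul_gibbs ν ξ s a
  have h2 : |∫ y : S d, Real.exp (s * ⟪ξ, (y : E d)⟫) * (⟪ξ, (y : E d)⟫ - a) ∂(ν : Measure (S d))| ≤
      Real.exp M * (|s - 1| * M) * (2 * M) := by
    rw [← sub_zero (∫ y : S d, _ ∂(ν : Measure (S d))), ← h0, ← integral_sub
      (integrable_sphere (by fun_prop) ν) (integrable_sphere (by fun_prop) ν), ← Real.norm_eq_abs]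
    refine (norm_integral_le_of_norm_le_const (C := Real.exp M * (|s - 1| * M) * (2 * M)) ?_).trans
      (by simp)
    filter_upwards [ae_mem_supp ν] with y hy
    rw [← sub_mul, norm_mul, Real.norm_eq_abs, Real.norm_eq_abs]
    have e1 := UBL.exp_sub_exp_le ((abs_le.1 (hexp s hs y hy)).2) ((abs_le.1 (hexp 1 (by simp) y hy)).2)
    rw [← sub_mul, abs_mul] at e1
    have e2 : |⟪ξ, (y : E d)⟫ - a| ≤ 2 * M := by
      have := abs_sub ⟪ξ, (y : E d)⟫ a
      have := hM y hy
      linarith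
    refine mul_le_mul (e1.trans ?_) e2 (abs_nonneg _) (by positivity)
    gcongr
    exact hM y hy
  rw [h1, abs_mul, abs_of_pos ((Real.exp_pos _).trans_le (hlow s hs))] at h2
  have h3 : Real.exp (-M) * |gibbsMean ν ξ s - a| ≤ Real.exp M * (|s - 1| * M) * (2 * M) :=
    (mul_le_mul_of_nonneg_right (hlow s hs) (abs_nonneg _)).trans h2
  rw [Real.exp_neg, inv_mul_le_iff₀ (Real.exp_pos M)] at h3
  refine h3.trans_eq ?_
  rw [two_mul M, Real.exp_add]
  ring

lemma abs_inner_le_of_near {c : S d} (hξ : ⟪ξ, (c : E d)⟫ = 0) {r : ℝ} (hM : ‖ξ‖ * r ≤ M) {x : S d}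
    (hx : ‖(x : E d) - c‖ ≤ r) : |⟪ξ, (x : E d)⟫| ≤ M := by
  have h := abs_real_inner_le_norm ξ ((x : E d) - c)
  rw [inner_sub_right, hξ, sub_zero] at h
  exact h.trans ((mul_le_mul_of_nonneg_left hx (norm_nonneg _)).trans hM)

/-- Near `c`, the tangential coordinate `⟪ξ, ·⟫` relaxes to its Gibbs mean. -/
lemma abs_inner_vField_sub_le (hd : 0 < d) {lam r : ℝ} (hlam : 0 ≤ lam) {c : S d}
    (hξ : ⟪ξ, (c : E d)⟫ = 0) (hM : ‖ξ‖ * r ≤ M) (hr : r ≤ 1) (w : E d) {x : S d}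
    (hx : ‖(x : E d) - c‖ ≤ r) (hν : ∀ y ∈ supp ν, ‖(y : E d) - c‖ ≤ r) :
    |⟪ξ, vField (fbParams lam (dyad ξ c) (-(c : E d)) w) ν x⟫ -
      lam * (gibbsMean ν ξ 1 - ⟪ξ, (x : E d)⟫)| ≤
      lam * ((2 * M ^ 2 * Real.exp (2 * M) + 2 * M) * r) := by
  have hcx := one_sub_inner_le (x := (x : E d)) (norm_coe c)
  have hcx1 := (abs_le.1 (abs_inner_le_one (norm_coe c) (norm_coe x))).2
  -- `r ≤ 1` keeps `x` in the hemisphere of `c`, where the perceptron is switched off.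
  have hrelu : max ⟪-(c : E d), (x : E d)⟫ 0 = 0 := by
    refine max_eq_right ?_
    rw [inner_neg_left]
    linarith
  set A := attention (dyad ξ (c : E d)) ν x with hA
  have hgA : ⟪ξ, A⟫ = gibbsMean ν ξ ⟪(c : E d), (x : E d)⟫ := by
    rw [hA, attention_eq_tilt, mulV_dyad, gibbsMean]
  -- Two errors: `Bx = ⟪c, x⟫ ξ` is not quite `ξ`, and the projection removes a normal component
  -- because the sphere is curved.
  have e : ⟪ξ, vField (fbParams lam (dyad ξ c) (-(c : E d)) w) ν x⟫ -
      lam * (gibbsMean ν ξ 1 - ⟪ξ, (x : E d)⟫) =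
      lam * ((gibbsMean ν ξ ⟪(c : E d), (x : E d)⟫ - gibbsMean ν ξ 1) +
        ⟪ξ, (x : E d)⟫ * ⟪(x : E d), (x : E d) - A⟫) := by
    rw [vField_fbParams hd, hrelu, zero_smul, add_zero, tanProj_smul, inner_smul_right, tanProj,
      inner_sub_right, inner_smul_right, hgA, inner_sub_right, real_inner_self_eq_norm_sq, norm_coe]
    ring
  have h1 := abs_gibbsMean_sub_le (fun y hy => abs_inner_le_of_near hξ hM (hν y hy))
    (abs_inner_le_one (norm_coe c) (norm_coe x))
  have h2 : |⟪(c : E d), (x : E d)⟫ - 1| ≤ r := by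
    rw [abs_le]; constructor <;> linarith [(norm_nonneg ((x : E d) - c))]
  have h3 : |⟪(x : E d), (x : E d) - A⟫| ≤ 2 * r := by
    refine (abs_real_inner_le_norm _ _).trans ?_
    rw [norm_coe, one_mul]
    have := norm_sub_le_norm_sub_add_norm_sub (x : E d) (c : E d) A
    have h4 := norm_attention_sub_le (dyad ξ (c : E d)) ν (x : E d) c hν
    rw [norm_sub_rev (c : E d)] at this
    linarith
  have h5 := abs_inner_le_of_near hξ hM hx
  have hM0 : 0 ≤ M := (abs_nonneg _).trans h5
  rw [e, abs_mul, abs_of_nonneg hlam]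
  refine mul_le_mul_of_nonneg_left ((abs_add_le _ _).trans ?_) hlam
  rw [abs_mul, add_mul]
  refine add_le_add (h1.trans (by gcongr)) ?_
  rw [mul_comm 2 M, mul_assoc]
  exact mul_le_mul h5 h3 (abs_nonneg _) hM0

end gibbs

end Transformer

end

/-! ### Clustering at the log-Laplace value. -/

noncomputable section

namespace Transformer

variable {d N : ℕ}

lemma abs_log_sub_log_le {a b m : ℝ} (hm : 0 < m) (ha : m ≤ a) (hb : m ≤ b) :
    |Real.log a - Real.log b| ≤ |a - b| / m := by
  have key : ∀ {a b : ℝ}, m ≤ a → m ≤ b → Real.log a - Real.log b ≤ |a - b| / m := fun {a b} ha hb => by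
    have ha0 := hm.trans_le ha
    have hb0 := hm.trans_le hb
    rw [← Real.log_div ha0.ne' hb0.ne']
    refine (Real.log_le_sub_one_of_pos (div_pos ha0 hb0)).trans ?_
    rw [div_sub_one hb0.ne']
    exact div_le_div₀ (abs_nonneg _) (le_abs_self _) hm hb
  refine abs_le.2 ⟨?_, key ha hb⟩
  have := key hb ha
  rw [abs_sub_comm] at this
  linarith

/-- A scalar which relaxes at rate `lam`, up to an error. -/
lemma abs_le_of_relaxation {lam ε τ : ℝ} (hlam : 0 < lam) (hτ : 0 ≤ τ) {D D' : ℝ → ℝ}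
    (hD : ∀ t ∈ Icc 0 τ, HasDerivWithinAt D (D' t) (Icc 0 τ) t)
    (h : ∀ t ∈ Icc 0 τ, |D' t + lam * D t| ≤ lam * ε) :
    |D τ| ≤ |D 0| * Real.exp (-(lam * τ)) + ε := by
  have hε : 0 ≤ ε := by
    have := (abs_nonneg _).trans (h 0 ⟨le_rfl, hτ⟩)
    exact nonneg_of_mul_nonneg_right this hlam
  have he : ∀ t : ℝ, HasDerivAt (fun t => Real.exp (lam * t)) (lam * Real.exp (lam * t)) t :=
    fun t => by
    have := ((hasDerivAt_id t).const_mul lam).exp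
    simp only [id, mul_one] at this
    rwa [mul_comm]
  -- Integrating factor.
  have hf : ∀ t ∈ Icc 0 τ, HasDerivWithinAt (fun t => Real.exp (lam * t) * D t)
      (Real.exp (lam * t) * (D' t + lam * D t)) (Icc 0 τ) t := fun t ht => by
    refine ((he t).hasDerivWithinAt.mul (hD t ht)).congr_deriv ?_
    ring
  have key := image_norm_le_of_norm_deriv_right_le_deriv_boundary
    (f := fun t => Real.exp (lam * t) * D t) (a := 0) (b := τ)
    (B := fun t => |D 0| + ε * (Real.exp (lam * t) - 1))
    (B' := fun t => ε * (lam * Real.exp (lam * t)))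
    (fun t ht => (hf t ht).continuousWithinAt)
    (fun t ht => (hf t ⟨ht.1, ht.2.le⟩).mono_of_mem_nhdsWithin (Icc_mem_nhdsGE_of_mem ht))
    (by simp) (fun t => (((he t).sub_const 1).const_mul ε).const_add _)
    (fun t ht => by
      rw [norm_mul, Real.norm_eq_abs, Real.norm_eq_abs, Real.abs_exp]
      have := h t ⟨ht.1, ht.2.le⟩
      have := Real.exp_pos (lam * t)
      nlinarith)
  have h1 := key ⟨hτ, le_rfl⟩
  rw [norm_mul, Real.norm_eq_abs, Real.norm_eq_abs, Real.abs_exp] at h1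
  have e3 : Real.exp (-(lam * τ)) * Real.exp (lam * τ) = 1 := by rw [← Real.exp_add]; simp
  have e4 := Real.exp_pos (-(lam * τ))
  have h2 := mul_le_mul_of_nonneg_left h1 e4.le
  rw [← mul_assoc, e3, one_mul] at h2
  refine h2.trans ?_
  have : Real.exp (-(lam * τ)) * (|D 0| + ε * (Real.exp (lam * τ) - 1)) =
      |D 0| * Real.exp (-(lam * τ)) + ε - ε * Real.exp (-(lam * τ)) := by
    linear_combination ε * e3
  rw [this]
  nlinarith

section cluster

variable {lam ρ M τ : ℝ} {ξ : E d} {c : S d} {w : ℝ → E d} {μ : ProbabilityMeasure (S d)}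
  {X : ℝ → C(S d, S d)}

/-- Under the loop with `B x = ⟪c, x⟫ ξ`, a measure close to `c` contracts, in the coordinate
`⟪ξ, ·⟫`, to a value close to its initial log-Laplace transform. -/
lemma abs_inner_flow_sub_log_le (hd : 0 < d) (hlam : 0 < lam) (hτ : 0 < τ)
    (hξ : ⟪ξ, (c : E d)⟫ = 0) (hwc : Continuous w) (hw : ∀ t, ‖w t‖ ≤ 2 * lam)
    (hX : IsFlow τ (fun t => fbParams lam (dyad ξ c) (-(c : E d)) (w t)) μ X)
    (hv : ∃ v : ℝ → C(S d, E d), ∀ t ∈ Icc 0 τ,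
      HasDerivWithinAt (fun t => incl (X t)) (v t) (Icc 0 τ) t ∧
      ∀ x, v t x = vField (fbParams lam (dyad ξ c) (-(c : E d)) (w t)) (push μ (X t)) (X t x))
    (hρ : ∀ x ∈ supp μ, ‖(x : E d) - c‖ ≤ ρ) (hM : ‖ξ‖ * (ρ * Real.exp (4 * (lam * τ))) ≤ M)
    (hr : ρ * Real.exp (4 * (lam * τ)) ≤ 1) {x : S d} (hx : x ∈ supp μ) :
    |⟪ξ, (X τ x : E d)⟫ - Real.log (∫ y : S d, Real.exp ⟪ξ, (y : E d)⟫ ∂(μ : Measure (S d)))| ≤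
      2 * (‖ξ‖ * ρ) * Real.exp (-(lam * τ)) + (2 + lam * τ * Real.exp (2 * M)) *
        ((2 * M ^ 2 * Real.exp (2 * M) + 2 * M) * (ρ * Real.exp (4 * (lam * τ)))) := by
  obtain ⟨v, hv⟩ := hv
  set r := ρ * Real.exp (4 * (lam * τ)) with hr_def
  set ε := (2 * M ^ 2 * Real.exp (2 * M) + 2 * M) * r with hε
  have hρ0 : 0 ≤ ρ := (norm_nonneg _).trans (hρ x hx)
  have hnear : ∀ t ∈ Icc 0 τ, ∀ y ∈ supp μ, ‖(X t y : E d) - c‖ ≤ r := fun t ht y hy => by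
    refine (norm_flow_sub_le hd hlam.le hw hX.init hv hρ t ht y hy).trans ?_
    rw [hr_def, mul_assoc 4]
    gcongr
    exact ht.2
  have hnear' : ∀ t ∈ Icc 0 τ, ∀ y ∈ supp (push μ (X t)), ‖(y : E d) - c‖ ≤ r := fun t ht y hy => by
    obtain ⟨y', hy', rfl⟩ := supp_push_subset _ _ hy
    exact hnear t ht y' hy'
  have hqM : ∀ t ∈ Icc 0 τ, ∀ y ∈ supp μ, |⟪ξ, (X t y : E d)⟫| ≤ M := fun t ht y hy =>
    abs_inner_le_of_near hξ hM (hnear t ht y hy)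
  have h0 : (0:ℝ) ∈ Icc 0 τ := ⟨le_rfl, hτ.le⟩
  have h1 : τ ∈ Icc 0 τ := ⟨hτ.le, le_rfl⟩
  have hM0 : 0 ≤ M := (abs_nonneg _).trans (hqM 0 h0 x hx)
  let q' : S d → ℝ → ℝ := fun y t => ⟪ξ, vField (fbParams lam (dyad ξ c) (-(c : E d)) (w t))
    (push μ (X t)) (X t y)⟫
  have hq' : ∀ y ∈ supp μ, ∀ t ∈ Icc 0 τ,
      |q' y t - lam * (gibbsMean (push μ (X t)) ξ 1 - ⟪ξ, (X t y : E d)⟫)| ≤ lam * ε :=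
    fun y hy t ht => abs_inner_vField_sub_le hd hlam.le hξ hM hr (w t) (hnear t ht y hy)
      (hnear' t ht)
  have hq : ∀ y, ∀ t ∈ Icc 0 τ,
      HasDerivWithinAt (fun t => ⟪ξ, (X t y : E d)⟫) (q' y t) (Icc 0 τ) t := fun y t ht => by
    have h := (innerSL ℝ ξ).hasFDerivAt.comp_hasDerivWithinAt t
      ((ContinuousMap.evalCLM ℝ y : C(S d, E d) →L[ℝ] E d).hasFDerivAt.comp_hasDerivWithinAt t
        (hv t ht).1)
    refine h.congr_deriv ?_
    change ⟪ξ, v t y⟫ = _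
    rw [(hv t ht).2]
  -- The Gibbs mean is common to both particles and cancels in the difference, leaving pure
  -- relaxation up to `2 * ε`.
  have hosc : ∀ y ∈ supp μ, |⟪ξ, (X τ x : E d)⟫ - ⟪ξ, (X τ y : E d)⟫| ≤
      2 * (‖ξ‖ * ρ) * Real.exp (-(lam * τ)) + 2 * ε := fun y hy => by
    have h := abs_le_of_relaxation (ε := 2 * ε) hlam hτ.le
      (D := fun t => ⟪ξ, (X t x : E d)⟫ - ⟪ξ, (X t y : E d)⟫)
      (fun t ht => (hq x t ht).sub (hq y t ht)) fun t ht => by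
        have a1 := abs_le.1 (hq' x hx t ht)
        have a2 := abs_le.1 (hq' y hy t ht)
        exact abs_le.2 ⟨by linarith, by linarith⟩
    refine h.trans ?_
    gcongr
    rw [hX.init, hX.init]
    have a1 := abs_le.1 (abs_inner_le_of_near hξ le_rfl (hρ x hx))
    have a2 := abs_le.1 (abs_inner_le_of_near hξ le_rfl (hρ y hy))
    exact abs_le.2 ⟨by linarith, by linarith⟩
  let Z : ℝ → ℝ := fun t => ∫ y : S d, Real.exp ⟪ξ, (y : E d)⟫ ∂(push μ (X t) : Measure (S d))
  have hφ : Continuous fun y : S d => Real.exp ⟪ξ, (y : E d)⟫ := by fun_prop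
  have hZ : ∀ t, Z t = ∫ y : S d, Real.exp ⟪ξ, (X t y : E d)⟫ ∂(μ : Measure (S d)) := fun t =>
    integral_push μ (X t) hφ
  have hint : ∀ t, Integrable (fun y : S d => Real.exp ⟪ξ, (X t y : E d)⟫) (μ : Measure (S d)) :=
    fun t => integrable_sphere (by fun_prop) μ
  have hZ0 : Z 0 = ∫ y : S d, Real.exp ⟪ξ, (y : E d)⟫ ∂(μ : Measure (S d)) := by
    rw [hZ]
    simp only [hX.init]
  have hZm : ∀ t ∈ Icc 0 τ, Real.exp (-M) ≤ Z t := fun t ht => by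
    rw [hZ]
    have : ∫ _y : S d, Real.exp (-M) ∂(μ : Measure (S d)) ≤
        ∫ y : S d, Real.exp ⟪ξ, (X t y : E d)⟫ ∂(μ : Measure (S d)) := by
      refine integral_mono_ae (integrable_const _) (hint t) ?_
      filter_upwards [ae_mem_supp μ] with y hy
      exact Real.exp_le_exp.2 (neg_le_of_abs_le (hqM t ht y hy))
    simpa using this
  -- The weak formulation is tested with `exp ⟪ξ, ·⟫`; at leading order its derivative is zero.
  have hdrift : |Z τ - Z 0| ≤ Real.exp M * (lam * ε) * τ := by
    have hsol := hX.isWeakSolution (continuousParams_fbParams lam (dyad ξ (c : E d)) (-(c : E d)) hwc)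
    have hsm : ContDiff ℝ ∞ fun y : E d => Real.exp ⟪ξ, y⟫ := (innerSL ℝ ξ).contDiff.exp
    have h := hsol.weak _ hsm τ h1
    rw [hZ0]
    change Z τ - _ = _ at h
    rw [h, ← Real.norm_eq_abs]
    refine (intervalIntegral.norm_integral_le_of_norm_le_const
      (C := Real.exp M * (lam * ε)) fun t ht => ?_).trans_eq (by rw [sub_zero, abs_of_pos hτ])
    rw [uIoc_of_le hτ.le] at ht
    have ht' := Ioc_subset_Icc_self ht
    have hfd : ∀ y u : E d, fderiv ℝ (fun y : E d => Real.exp ⟪ξ, y⟫) y u =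
        Real.exp ⟪ξ, y⟫ * ⟪ξ, u⟫ := fun y u => by
      have : HasFDerivAt (fun y : E d => Real.exp ⟪ξ, y⟫) (Real.exp ⟪ξ, y⟫ • innerSL ℝ ξ) y :=
        ((innerSL ℝ ξ).hasFDerivAt (x := y)).exp
      rw [this.fderiv]
      simp
    simp only [hfd]
    set ν := push μ (X t)
    set p := fbParams lam (dyad ξ (c : E d)) (-(c : E d)) (w t)
    have hz := integral_exp_mul_gibbs ν ξ 1 (gibbsMean ν ξ 1)
    rw [sub_self, mul_zero] at hz
    have hvc : Continuous fun y : S d => vField p ν (y : E d) :=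
      continuous_vField (continuousParams_const p) continuous_const continuous_subtype_val
    -- The added term integrates to zero by the definition of the Gibbs mean; with it the integrand
    -- becomes the relaxation error.
    have e : ∫ y : S d, Real.exp ⟪ξ, (y : E d)⟫ * ⟪ξ, vField p ν (y : E d)⟫ ∂(ν : Measure (S d)) =
        ∫ y : S d, (Real.exp ⟪ξ, (y : E d)⟫ * ⟪ξ, vField p ν (y : E d)⟫ + lam * (Real.exp (1 *
          ⟪ξ, (y : E d)⟫) * (⟪ξ, (y : E d)⟫ - gibbsMean ν ξ 1))) ∂(ν : Measure (S d)) := by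
      rw [integral_add (integrable_sphere (by fun_prop) ν) (integrable_sphere (by fun_prop) ν),
        integral_const_mul, hz, mul_zero, add_zero]
    rw [e]
    refine (norm_integral_le_of_norm_le_const (C := Real.exp M * (lam * ε)) ?_).trans (by simp)
    filter_upwards [ae_mem_supp ν] with y hy
    have a1 := abs_inner_vField_sub_le hd hlam.le hξ hM hr (w t) (hnear' t ht' y hy) (hnear' t ht')
    have a2 := (abs_le.1 (abs_inner_le_of_near hξ hM (hnear' t ht' y hy))).2
    rw [show Real.exp ⟪ξ, (y : E d)⟫ * ⟪ξ, vField p ν (y : E d)⟫ + lam * (Real.exp (1 *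
          ⟪ξ, (y : E d)⟫) * (⟪ξ, (y : E d)⟫ - gibbsMean ν ξ 1)) = Real.exp ⟪ξ, (y : E d)⟫ *
          (⟪ξ, vField p ν (y : E d)⟫ - lam * (gibbsMean ν ξ 1 - ⟪ξ, (y : E d)⟫)) by
      rw [one_mul]; ring, norm_mul, Real.norm_eq_abs, Real.norm_eq_abs, Real.abs_exp]
    exact mul_le_mul (Real.exp_le_exp.2 a2) a1 (abs_nonneg _) (Real.exp_pos _).le
  have hlog := abs_log_sub_log_le (Real.exp_pos (-M)) (hZm τ h1) (hZm 0 h0)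
  have hlog' : |Real.log (Z τ) - Real.log (Z 0)| ≤ lam * τ * Real.exp (2 * M) * ε := by
    refine hlog.trans ?_
    rw [div_le_iff₀ (Real.exp_pos _)]
    refine hdrift.trans_eq ?_
    have e : Real.exp (2 * M) * Real.exp (-M) = Real.exp M := by rw [← Real.exp_add]; ring_nf
    linear_combination (-lam * τ * ε) * e
  set Δ := 2 * (‖ξ‖ * ρ) * Real.exp (-(lam * τ)) + 2 * ε
  have hZpos : 0 < Z τ := (Real.exp_pos _).trans_le (hZm τ h1)
  -- All particles are within `Δ` of `x` in the coordinate `⟪ξ, ·⟫`, so `log (Z τ)` is within `Δ` of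
  -- its value at `X τ x`.
  have hup : Z τ ≤ Real.exp (⟪ξ, (X τ x : E d)⟫ + Δ) := by
    have : ∫ y : S d, Real.exp ⟪ξ, (X τ y : E d)⟫ ∂(μ : Measure (S d)) ≤
        ∫ _y : S d, Real.exp (⟪ξ, (X τ x : E d)⟫ + Δ) ∂(μ : Measure (S d)) := by
      refine integral_mono_ae (hint τ) (integrable_const _) ?_
      filter_upwards [ae_mem_supp μ] with y hy
      refine Real.exp_le_exp.2 ?_
      have := (abs_le.1 (hosc y hy)).1
      linarith
    rw [hZ]
    simpa using this
  have hlo : Real.exp (⟪ξ, (X τ x : E d)⟫ - Δ) ≤ Z τ := by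
    have : ∫ _y : S d, Real.exp (⟪ξ, (X τ x : E d)⟫ - Δ) ∂(μ : Measure (S d)) ≤
        ∫ y : S d, Real.exp ⟪ξ, (X τ y : E d)⟫ ∂(μ : Measure (S d)) := by
      refine integral_mono_ae (integrable_const _) (hint τ) ?_
      filter_upwards [ae_mem_supp μ] with y hy
      refine Real.exp_le_exp.2 ?_
      have := (abs_le.1 (hosc y hy)).2
      linarith
    rw [hZ]
    simpa using this
  have l1 := (Real.log_le_iff_le_exp hZpos).2 hup
  have l2 := (Real.le_log_iff_exp_le hZpos).2 hlo
  rw [hZ0] at hlog'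
  obtain ⟨l3, l4⟩ := abs_le.1 hlog'
  exact abs_le.2 ⟨by linarith, by linarith⟩

end cluster

end Transformer

end

/-! ### The clustering phase as admissible steering. -/

noncomputable section

namespace Transformer

variable {d N : ℕ}

/-- The feedback point and the half-space direction are both `-c`. The data remain in the hemisphere
of `c`, so the sign condition holds for every measure, whichever `k` is taken, and `W` never acts on
the supports. -/
theorem exists_clustering (hd : 0 < d) {c : S d} {ξ : E d} (hξ : ⟪ξ, (c : E d)⟫ = 0) (hξ0 : ξ ≠ 0)
    {lam τ ρ M : ℝ} (hlam : 0 < lam) (hτ : 0 < τ) (k : Fin N)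
    (μ₀ : Fin N → ProbabilityMeasure (S d)) (hρ : ∀ i, ∀ x ∈ supp (μ₀ i), ‖(x : E d) - c‖ ≤ ρ)
    (hM : ‖ξ‖ * (ρ * Real.exp (4 * (lam * τ))) ≤ M) (hr : ρ * Real.exp (4 * (lam * τ)) < 1) :
    ∃ θ μ, Steers τ θ μ₀ μ ∧ ∀ i, ∀ x ∈ supp (μ i τ), 0 < ⟪(c : E d), (x : E d)⟫ ∧
      |⟪ξ, (x : E d)⟫ - Real.log (∫ y : S d, Real.exp ⟪ξ, (y : E d)⟫ ∂(μ₀ i : Measure (S d)))| ≤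
        2 * (‖ξ‖ * ρ) * Real.exp (-(lam * τ)) + (2 + lam * τ * Real.exp (2 * M)) *
          ((2 * M ^ 2 * Real.exp (2 * M) + 2 * M) * (ρ * Real.exp (4 * (lam * τ)))) := by
  let l : Loop d N := ⟨lam, dyad ξ c, -c, -c, k, μ₀⟩
  have haz' : ⟪(l.a : E d), (l.z : E d)⟫ = 1 := by simp [l]
  have haz : 0 < ⟪(l.a : E d), (l.z : E d)⟫ := by rw [haz']; exact one_pos
  obtain ⟨X, w, hwc, hX, hw, hv⟩ := exists_closedLoop hd l haz hτ
  have hwb : ∀ t, ‖w t‖ ≤ 2 * lam := fun t => by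
    have := norm_gain_le hlam.le haz (hw t)
    rwa [haz', div_one] at this
  have hla : (l.a : E d) = -(c : E d) := rfl
  rw [hla] at hX hv
  have hρ0 : 0 ≤ ρ := by
    obtain ⟨x, hx⟩ := supp_nonempty (μ₀ k)
    exact (norm_nonneg _).trans (hρ k x hx)
  have hpos : ∀ i, ∀ t ∈ Icc 0 τ, ∀ x ∈ supp (μ₀ i), 0 < ⟪(c : E d), (X i t x : E d)⟫ :=
    fun i t ht x hx => by
    obtain ⟨v, hv⟩ := hv i
    have h1 := norm_flow_sub_le hd hlam.le hwb (hX i).init hv (hρ i) t ht x hx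
    have h2 := one_sub_inner_le (x := (X i t x : E d)) (norm_coe c)
    have h3 : ρ * Real.exp (4 * lam * t) ≤ ρ * Real.exp (4 * (lam * τ)) := by
      rw [mul_assoc 4]
      gcongr
      exact ht.2
    linarith
  refine ⟨_, _, (steers_loop hd l hlam (dyad_ne_zero hξ0 c) haz hwc (by rw [hla]; exact hX) hw
    fun t ht j _ x hx => ?_).1, fun i x hx => ?_⟩
  · rw [hla, inner_neg_left]
    linarith [hpos j t ht x hx]
  · obtain ⟨y, hy, rfl⟩ := supp_push_subset _ _ hx
    exact ⟨hpos i τ ⟨hτ.le, le_rfl⟩ y hy,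
      abs_inner_flow_sub_log_le hd hlam hτ hξ hwc hwb (hX i) (hv i) (hρ i) hM hr.le hy⟩

/-! ### Stereographic projection and disentanglement of the supports. -/

section stereographic

variable (c : S d)

/-- The stereographic projection from `-c`. -/
def stereo (x : E d) : E d := (2 / (1 + ⟪(c : E d), x⟫)) • (x - ⟪(c : E d), x⟫ • (c : E d))

/-- The inverse of the stereographic projection from `-c`. -/
def invStereo (y : E d) : E d :=
  ((4 - ‖y‖ ^ 2) / (4 + ‖y‖ ^ 2)) • (c : E d) +
    ((1 + (4 - ‖y‖ ^ 2) / (4 + ‖y‖ ^ 2)) / 2) • y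

lemma measurable_stereo : Measurable (stereo c) := by
  unfold stereo
  exact (measurable_const.div
    (by fun_prop : Continuous fun x : E d => 1 + ⟪(c : E d), x⟫).measurable).smul
    (by fun_prop : Continuous fun x : E d => x - ⟪(c : E d), x⟫ • (c : E d)).measurable

lemma measurable_invStereo : Measurable (invStereo c) := by
  unfold invStereo
  fun_prop

lemma norm_stereo_sq {x : E d} (hx : ‖x‖ = 1) (h : 1 + ⟪(c : E d), x⟫ ≠ 0) :
    ‖stereo c x‖ ^ 2 = 4 * (1 - ⟪(c : E d), x⟫) / (1 + ⟪(c : E d), x⟫) := by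
  rw [stereo, norm_smul, mul_pow, norm_sub_sq_real, norm_smul, inner_smul_right, norm_coe, hx,
    real_inner_comm (c : E d) x, Real.norm_eq_abs, Real.norm_eq_abs, mul_one, sq_abs, sq_abs]
  field_simp
  ring

/-- The norm of the stereographic image determines the height `⟪c, x⟫`, and the height then undoes
the scaling. -/
lemma invStereo_stereo {x : E d} (hx : ‖x‖ = 1) (h : 1 + ⟪(c : E d), x⟫ ≠ 0) :
    invStereo c (stereo c x) = x := by
  have e : (4 - ‖stereo c x‖ ^ 2) / (4 + ‖stereo c x‖ ^ 2) = ⟪(c : E d), x⟫ := by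
    have h4 : 4 + ‖stereo c x‖ ^ 2 ≠ 0 := by positivity
    rw [div_eq_iff h4, norm_stereo_sq c hx h]
    field_simp
    ring
  rw [invStereo, e, stereo, smul_smul]
  have : (1 + ⟪(c : E d), x⟫) / 2 * (2 / (1 + ⟪(c : E d), x⟫)) = 1 := by field_simp
  rw [this, one_smul, add_sub_cancel]

lemma inner_stereo_of_orthogonal {η : E d} (h : ⟪η, (c : E d)⟫ = 0) (x : E d) :
    ⟪η, stereo c x⟫ = 2 / (1 + ⟪(c : E d), x⟫) * ⟪η, x⟫ := by
  rw [stereo, inner_smul_right, inner_sub_right, inner_smul_right, h]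
  ring

lemma inner_stereo_self (x : E d) : ⟪(c : E d), stereo c x⟫ = 0 := by
  rw [stereo, inner_smul_right, inner_sub_right, inner_smul_right, real_inner_self_eq_norm_sq,
    norm_coe]
  ring

/-- Measures that do not charge a neighbourhood of `-c` are determined by their stereographic
images. -/
lemma eq_of_map_stereo_eq {δ : ℝ} (hδ : 0 < δ) {μ ν : ProbabilityMeasure (S d)}
    (hμ : ∀ x ∈ supp μ, δ ≤ 1 + ⟪(c : E d), (x : E d)⟫)
    (hν : ∀ x ∈ supp ν, δ ≤ 1 + ⟪(c : E d), (x : E d)⟫)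
    (h : (μ : Measure (S d)).map (fun x : S d => stereo c x) =
      (ν : Measure (S d)).map fun x : S d => stereo c x) : μ = ν := by
  have hm : Measurable fun x : S d => stereo c (x : E d) :=
    (measurable_stereo c).comp measurable_subtype_coe
  have key : ∀ μ : ProbabilityMeasure (S d), (∀ x ∈ supp μ, δ ≤ 1 + ⟪(c : E d), (x : E d)⟫) →
      ((μ : Measure (S d)).map (fun x : S d => stereo c x)).map (invStereo c) =
        (μ : Measure (S d)).map Subtype.val := fun μ hμ => by
    rw [Measure.map_map (measurable_invStereo c) hm]
    refine Measure.map_congr ?_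
    filter_upwards [ae_mem_supp μ] with x hx
    exact invStereo_stereo c (norm_coe x) (hδ.trans_le (hμ x hx)).ne'
  have h1 := key μ hμ
  rw [h, key ν hν] at h1
  have he : MeasurableEmbedding (Subtype.val : S d → E d) :=
    MeasurableEmbedding.subtype_coe Metric.isClosed_sphere.measurableSet
  refine ProbabilityMeasure.toMeasure_injective ?_
  rw [← he.comap_map (μ : Measure (S d)), ← h1, he.comap_map]

end stereographic

/-- A direction orthogonal to `c` in which the stereographic images of the data have distinct
Laplace transforms. -/
lemma exists_direction (hd : 2 ≤ d) (c : S d) {δ : ℝ} (hδ : 0 < δ)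
    (μ₀ : Fin N → ProbabilityMeasure (S d)) (hne : ∀ i j, i ≠ j → μ₀ i ≠ μ₀ j)
    (hμ : ∀ i, ∀ x ∈ supp (μ₀ i), δ ≤ 1 + ⟪(c : E d), (x : E d)⟫) :
    ∃ η : E d, η ≠ 0 ∧ ⟪η, (c : E d)⟫ = 0 ∧ ∀ i j, i ≠ j →
      ∫ x : S d, Real.exp (2 / (1 + ⟪(c : E d), x⟫) * ⟪η, (x : E d)⟫) ∂(μ₀ i : Measure (S d)) ≠
      ∫ x : S d, Real.exp (2 / (1 + ⟪(c : E d), x⟫) * ⟪η, (x : E d)⟫) ∂(μ₀ j : Measure (S d)) := by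
  have hm : Measurable fun x : S d => stereo c (x : E d) :=
    (measurable_stereo c).comp measurable_subtype_coe
  let m : Fin N → Measure (E d) := fun i => (μ₀ i : Measure (S d)).map fun x : S d => stereo c x
  have : ∀ i, IsProbabilityMeasure (m i) := fun i => Measure.isProbabilityMeasure_map hm.aemeasurable
  have hb : ∀ i, ∀ᵐ y ∂(m i), ‖y‖ ≤ √(8 / δ) := fun i => by
    refine (ae_map_iff hm.aemeasurable (measurableSet_le measurable_norm measurable_const)).2 ?_
    filter_upwards [ae_mem_supp (μ₀ i)] with x hx
    have h1 := hμ i x hx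
    have h0 := hδ.trans_le h1
    refine Real.le_sqrt_of_sq_le ?_
    rw [norm_stereo_sq c (norm_coe x) h0.ne', div_le_div_iff₀ h0 hδ]
    have h2 := (abs_le.1 (abs_inner_le_one (norm_coe c) (norm_coe x))).1
    nlinarith
  obtain ⟨η, hη, hsep⟩ := exists_separating_direction hd (c : E d) m hb fun i j hij h =>
    hne i j hij (eq_of_map_stereo_eq c hδ (hμ i) (hμ j) h)
  -- Removing the component along `c` does not affect the transforms, as stereographic images are
  -- orthogonal to `c`; `η'` is nonzero because `η` is off the line of `c`.
  let η' := η - ⟪(c : E d), η⟫ • (c : E d)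
  have horth : ⟪η', (c : E d)⟫ = 0 := by
    simp only [η', inner_sub_left, real_inner_smul_left, real_inner_self_eq_norm_sq, norm_coe]
    rw [real_inner_comm]
    ring
  have hF : ∀ i, ∫ y, Real.exp ⟪η, y⟫ ∂(m i) =
      ∫ x : S d, Real.exp (2 / (1 + ⟪(c : E d), x⟫) * ⟪η', (x : E d)⟫) ∂(μ₀ i : Measure (S d)) :=
    fun i => by
    rw [integral_map hm.aemeasurable
      (by fun_prop : Continuous fun y : E d => Real.exp ⟪η, y⟫).aestronglyMeasurable]
    refine integral_congr_ae (.of_forall fun x => ?_)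
    simp only
    rw [← inner_stereo_of_orthogonal c horth, inner_sub_left, real_inner_smul_left,
      inner_stereo_self, mul_zero, sub_zero]
  refine ⟨η', fun h => hη ?_, horth, fun i j hij => ?_⟩
  · rw [sub_eq_zero.1 h]
    exact Submodule.smul_mem _ _ (Submodule.mem_span_singleton_self _)
  · rw [← hF, ← hF]
    exact hsep i j hij

/-- After a long boost, the rescaled Laplace transforms converge. -/
lemma tendsto_laplace_boost (c : S d) {δ : ℝ} (hδ : 0 < δ) {η : E d} (hη : ⟪η, (c : E d)⟫ = 0)
    (μ : ProbabilityMeasure (S d)) (hμ : ∀ x ∈ supp μ, δ ≤ 1 + ⟪(c : E d), (x : E d)⟫) :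
    Tendsto (fun s => ∫ y : S d, Real.exp ⟪Real.exp s • η, (y : E d)⟫
        ∂(push μ (boost c s) : Measure (S d))) atTop
      (𝓝 (∫ x : S d, Real.exp (2 / (1 + ⟪(c : E d), x⟫) * ⟪η, (x : E d)⟫)
        ∂(μ : Measure (S d)))) := by
  have e : ∀ s, ∫ y : S d, Real.exp ⟪Real.exp s • η, (y : E d)⟫
      ∂(push μ (boost c s) : Measure (S d)) =
      ∫ x : S d, Real.exp (Real.exp s * (boostDen (c : E d) s x)⁻¹ * ⟪η, (x : E d)⟫)
        ∂(μ : Measure (S d)) := fun s => by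
    rw [integral_push μ _ (f := fun y : S d => Real.exp ⟪Real.exp s • η, (y : E d)⟫) (by fun_prop)]
    simp only [real_inner_smul_left, inner_boost_of_orthogonal c hη, mul_assoc]
  simp only [e]
  refine tendsto_integral_filter_of_dominated_convergence
    (fun _ => Real.exp (2 / δ * ‖η‖)) (.of_forall fun s => ?_) (.of_forall fun s => ?_)
    (integrable_const _) ?_
  · have : Continuous fun x : S d => (boostDen (c : E d) s x)⁻¹ :=
      ((continuous_boostDen (c : E d)).comp (Continuous.prodMk_right s)).inv₀ fun x =>
        (boostDen_pos (norm_coe c) (norm_coe x) s).ne'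
    exact (by fun_prop : Continuous fun x : S d => Real.exp (Real.exp s *
      (boostDen (c : E d) s x)⁻¹ * ⟪η, (x : E d)⟫)).aestronglyMeasurable
  · filter_upwards [ae_mem_supp μ] with x hx
    rw [Real.norm_eq_abs, Real.abs_exp, Real.exp_le_exp]
    have h1 := exp_mul_inv_boostDen_le c hδ (hμ x hx) s
    have h2 : 0 < Real.exp s * (boostDen (c : E d) s x)⁻¹ :=
      mul_pos (Real.exp_pos s) (inv_pos.2 (boostDen_pos (norm_coe c) (norm_coe x) s))
    have h3 := real_inner_le_norm η (x : E d)
    rw [norm_coe, mul_one] at h3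
    exact (mul_le_mul_of_nonneg_left h3 h2.le).trans
      (mul_le_mul_of_nonneg_right h1 (norm_nonneg _))
  · filter_upwards [ae_mem_supp μ] with x hx
    exact (((tendsto_exp_mul_inv_boostDen c (hδ.trans_le (hμ x hx))).mul_const _).rexp)

/-- The empty set is allowed: for `N = 1` there are no other supports to separate from. -/
lemma _root_.IsCompact.exists_le_neg {α : Type*} [TopologicalSpace α] {K : Set α} (hK : IsCompact K)
    {f : α → ℝ} (hf : Continuous f) (h : ∀ x ∈ K, f x < 0) : ∃ m > 0, ∀ x ∈ K, f x ≤ -m := by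
  rcases K.eq_empty_or_nonempty with rfl | hne
  · exact ⟨1, one_pos, by simp⟩
  · obtain ⟨x, hx, hmax⟩ := hK.exists_isMaxOn hne hf.continuousOn
    exact ⟨-f x, neg_pos.2 (h x hx), fun y hy => by rw [neg_neg]; exact hmax hy⟩

/-- Distinct data that leave a hole can be steered into an open hemisphere with disjoint supports. -/
theorem exists_steers_disjoint (hd : 2 ≤ d) (hN : 0 < N) (μ₀ : Fin N → ProbabilityMeasure (S d))
    (hne : ∀ i j, i ≠ j → μ₀ i ≠ μ₀ j) (hhole : (⋃ i, supp (μ₀ i)) ≠ univ) {τ : ℝ} (hτ : 0 < τ) :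
    ∃ (c : S d) (θ : ℝ → Params d) (μ : Fin N → ℝ → ProbabilityMeasure (S d)),
      Steers (τ + τ) θ μ₀ μ ∧
      (∀ i, ∀ x ∈ supp (μ i (τ + τ)), 0 < ⟪(c : E d), (x : E d)⟫) ∧
      ∀ i j, i ≠ j → Disjoint (supp (μ i (τ + τ))) (supp (μ j (τ + τ))) := by
  have hd0 : 0 < d := by omega
  obtain ⟨p, hp⟩ := (ne_univ_iff_exists_notMem _).1 hhole
  -- The boost repels from `-c`, so the source of the flow is placed in the hole; by compactness the
  -- supports avoid it by a margin `δ`.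
  obtain ⟨c, rfl⟩ : ∃ c : S d, p = -c := ⟨-p, (neg_neg p).symm⟩
  obtain ⟨δ, hδ, hδ'⟩ := (isCompact_iUnion fun i => isCompact_supp (μ₀ i)).exists_le_neg
    (f := fun x : S d => -1 - ⟪(c : E d), (x : E d)⟫) (by fun_prop) fun x hx => by
      have hxp : ((-c : S d) : E d) ≠ x := fun h => hp (Subtype.ext h ▸ hx)
      have := (inner_lt_one_iff_real_of_norm_eq_one (norm_coe (-c)) (norm_coe x)).2 hxp
      rw [coe_neg_sphere, inner_neg_left] at this
      linarith
  have hμ : ∀ i, ∀ x ∈ supp (μ₀ i), δ ≤ 1 + ⟪(c : E d), (x : E d)⟫ := fun i x hx => by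
    have := hδ' x (mem_iUnion_of_mem i hx)
    linarith
  obtain ⟨η, hη0, hη, hsep⟩ := exists_direction hd c hδ μ₀ hne hμ
  set F : Fin N → ℝ := fun i => ∫ x : S d, Real.exp (2 / (1 + ⟪(c : E d), x⟫) * ⟪η, (x : E d)⟫)
    ∂(μ₀ i : Measure (S d)) with hF
  have hFpos : ∀ i, 0 < F i := fun i => by
    refine integral_exp_pos (Integrable.of_bound (C := Real.exp (2 / δ * ‖η‖)) ?_ ?_)
    · refine (Measurable.exp (Measurable.mul (measurable_const.div ?_) ?_)).aestronglyMeasurable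
      · exact (by fun_prop : Continuous fun x : S d => 1 + ⟪(c : E d), (x : E d)⟫).measurable
      · exact (by fun_prop : Continuous fun x : S d => ⟪η, (x : E d)⟫).measurable
    · filter_upwards [ae_mem_supp (μ₀ i)] with x hx
      rw [Real.norm_eq_abs, Real.abs_exp, Real.exp_le_exp]
      have h1 := hμ i x hx
      have h3 := real_inner_le_norm η (x : E d)
      rw [norm_coe, mul_one] at h3
      have h0 := hδ.trans_le h1
      have h4 : 2 / (1 + ⟪(c : E d), (x : E d)⟫) ≤ 2 / δ := by gcongr
      exact (mul_le_mul_of_nonneg_left h3 (by positivity)).trans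
        (mul_le_mul_of_nonneg_right h4 (norm_nonneg _))
  have hgap : ∃ γ > 0, ∀ i j, i ≠ j → γ ≤ |Real.log (F i) - Real.log (F j)| := by
    have h : ∀ᶠ γ in 𝓝[>] (0:ℝ), ∀ i j, i ≠ j → γ ≤ |Real.log (F i) - Real.log (F j)| := by
      refine eventually_all.2 fun i => eventually_all.2 fun j => ?_
      by_cases hij : i = j
      · exact .of_forall fun _ h => absurd hij h
      · have : 0 < |Real.log (F i) - Real.log (F j)| := abs_pos.2 (sub_ne_zero.2 fun h =>
          hsep i j hij (Real.log_injOn_pos (hFpos i) (hFpos j) h))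
        filter_upwards [Ioo_mem_nhdsGT this] with γ hγ _ using hγ.2.le
    obtain ⟨γ, h1, h2⟩ := (h.and self_mem_nhdsWithin).exists
    exact ⟨γ, h2, h1⟩
  obtain ⟨γ, hγ, hgap⟩ := hgap
  set κ := √(8 / δ) with hκ
  have hexp : Tendsto (fun s : ℝ => Real.exp (-s)) atTop (𝓝 0) :=
    Real.tendsto_exp_neg_atTop_nhds_zero
  -- `σ` is the product of gain and duration in the clustering phase. It is fixed before `s`, using
  -- the contraction error alone.
  obtain ⟨σ, hσ, hσ0⟩ : ∃ σ : ℝ, 2 * (‖η‖ * κ) * Real.exp (-σ) < γ / 8 ∧ 0 < σ := by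
    have h1 : Tendsto (fun s : ℝ => 2 * (‖η‖ * κ) * Real.exp (-s)) atTop (𝓝 0) := by
      simpa using hexp.const_mul (2 * (‖η‖ * κ))
    exact ((h1.eventually_lt_const (by positivity)).and (eventually_gt_atTop 0)).exists
  -- Independent of `s`: the factor `e^s` in `ξ` compensates the radius `κ e^{-s}`. Hence `Q` is
  -- also fixed, and the nonlinear error, `Q` times a radius of order `e^{-s}`, tends to zero as `s`
  -- grows.
  set M := ‖η‖ * κ * Real.exp (4 * σ) with hM
  set Q := (2 + σ * Real.exp (2 * M)) * (2 * M ^ 2 * Real.exp (2 * M) + 2 * M) with hQ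
  have hρ0 : Tendsto (fun s : ℝ => κ * Real.exp (-s) * Real.exp (4 * σ)) atTop (𝓝 0) := by
    simpa using (hexp.const_mul κ).mul_const (Real.exp (4 * σ))
  have hρ1 : Tendsto (fun s : ℝ => Q * (κ * Real.exp (-s) * Real.exp (4 * σ))) atTop (𝓝 0) := by
    simpa using hρ0.const_mul Q
  have hlog : ∀ i, Tendsto (fun s => Real.log (∫ y : S d, Real.exp ⟪Real.exp s • η, (y : E d)⟫
      ∂(push (μ₀ i) (boost c s) : Measure (S d)))) atTop (𝓝 (Real.log (F i))) := fun i =>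
    (tendsto_laplace_boost c hδ hη (μ₀ i) (hμ i)).log (hFpos i).ne'
  have hev : ∀ᶠ s in atTop, ∀ i, |Real.log (∫ y : S d, Real.exp ⟪Real.exp s • η, (y : E d)⟫
      ∂(push (μ₀ i) (boost c s) : Measure (S d))) - Real.log (F i)| < γ / 8 :=
    eventually_all.2 fun i => by
      have := (hlog i).eventually (Metric.ball_mem_nhds _ (by positivity : 0 < γ / 8))
      simpa [Real.dist_eq] using this
  obtain ⟨s, ⟨hs1, hs2⟩, hs3⟩ := (((hρ0.eventually_lt_const one_pos).and
    (hρ1.eventually_lt_const (by positivity : 0 < γ / 8))).and hev).exists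
  have hlt : σ / τ * τ = σ := div_mul_cancel₀ σ hτ.ne'
  have hst : s / τ * τ = s := div_mul_cancel₀ s hτ.ne'
  have h₁ := steers_boost c hd0 μ₀ τ (s / τ)
  have hξn : ‖Real.exp s • η‖ * (κ * Real.exp (-s)) = ‖η‖ * κ := by
    rw [norm_smul, Real.norm_eq_abs, Real.abs_exp]
    have e3 : Real.exp (-s) * Real.exp s = 1 := by rw [← Real.exp_add]; simp
    linear_combination (‖η‖ * κ) * e3
  obtain ⟨θ₂, μ₂, h₂, hend⟩ := exists_clustering hd0 (ξ := Real.exp s • η) (c := c)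
    (lam := σ / τ) (τ := τ) (ρ := κ * Real.exp (-s)) (M := M)
    (by rw [real_inner_smul_left, hη, mul_zero]) (smul_ne_zero (Real.exp_pos s).ne' hη0)
    (div_pos hσ0 hτ) hτ ⟨0, hN⟩ (fun i => push (μ₀ i) (boost c (s / τ * τ)))
    (fun i x hx => by
      obtain ⟨y, hy, rfl⟩ := supp_push_subset _ _ hx
      rw [hst]
      exact norm_boost_sub_le c hδ s (hμ i y hy))
    (by rw [hlt, ← mul_assoc, hξn]) (by rwa [hlt])
  rw [hlt, hξn, hst] at hend
  -- Three errors of `γ / 8`: incomplete contraction, nonlinearity, and the limit of the rescaled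
  -- transforms. Two values then differ from their targets by less than `γ` in total.
  have hval : ∀ i, ∀ x ∈ supp (μ₂ i τ), |⟪Real.exp s • η, (x : E d)⟫ - Real.log (F i)| < 3 / 8 * γ :=
    fun i x hx => by
    have a1 := abs_le.1 (hend i x hx).2
    have a2 := abs_lt.1 (hs3 i)
    rw [hQ, mul_assoc] at hs2
    exact abs_lt.2 ⟨by linarith, by linarith⟩
  have hcat : ∀ i, concat τ (fun t => push (μ₀ i) (boost c (s / τ * t))) (μ₂ i) (τ + τ) = μ₂ i τ :=
    fun i => by rw [concat_of_lt _ _ (by linarith), add_sub_cancel_right]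
  refine ⟨c, _, _, h₁.concat hτ.le hτ.le h₂, fun i x hx => ?_, fun i j hij => ?_⟩
  · rw [hcat] at hx
    exact (hend i x hx).1
  · rw [hcat, hcat, Set.disjoint_left]
    intro x hi hj
    have a1 := abs_lt.1 (hval i x hi)
    have a2 := abs_lt.1 (hval j x hj)
    have a3 : |Real.log (F i) - Real.log (F j)| < γ := abs_lt.2 ⟨by linarith, by linarith⟩
    exact absurd (hgap i j hij) (not_le.2 a3)

end Transformer

end

/-! ### Attention at a point of a support, with small gain. -/

noncomputable section

namespace Transformer

variable {d N : ℕ}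

lemma hasDerivWithinAt_flow {τ : ℝ} {X : ℝ → C(S d, S d)} {v : ℝ → C(S d, E d)}
    {u : ℝ → S d → E d} (hv : ∀ t ∈ Icc 0 τ, HasDerivWithinAt (fun t => incl (X t)) (v t) (Icc 0 τ) t ∧
      ∀ x, v t x = u t x) (x : S d) : ∀ t ∈ Icc 0 τ,
    HasDerivWithinAt (fun t => (X t x : E d)) (u t x) (Icc 0 τ) t := fun t ht =>
  ((ContinuousMap.evalCLM ℝ x : C(S d, E d) →L[ℝ] E d).hasFDerivAt.comp_hasDerivWithinAt t
    (hv t ht).1).congr_deriv ((hv t ht).2 x)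

/-- A zero of the velocity is a fixed point of the flow. -/
lemma eq_of_vField_eq_zero (hd : 0 < d) {lam R τ : ℝ} {B : Matrix (Fin d) (Fin d) ℝ} {a : S d}
    {w : ℝ → E d} (hlamR : |lam| ≤ R) (hB : ∀ i j, |B i j| ≤ R) (hw : ∀ t, ‖w t‖ ≤ R) (hR : 1 ≤ R)
    {ν : ℝ → ProbabilityMeasure (S d)} {x : ℝ → S d} {z : S d} (hx0 : x 0 = z)
    (hx : ∀ t ∈ Icc 0 τ, HasDerivWithinAt (fun t => (x t : E d))
      (vField (fbParams lam B (a : E d) (w t)) (ν t) (x t)) (Icc 0 τ) t)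
    (hz : ∀ t, vField (fbParams lam B (a : E d) (w t)) (ν t) z = 0) :
    ∀ t ∈ Icc 0 τ, x t = z := by
  have hp : ∀ t, (fbParams lam B (a : E d) (w t)).BoundedBy R := fun t => by
    have hcoord : ∀ (x : E d) i, |x i| ≤ ‖x‖ := fun x i => by
      simpa using PiLp.norm_apply_le x i
    have hd1 : (1:ℝ) ≤ d := by exact_mod_cast hd
    refine ⟨fun i j => ?_, hB, fun i j => ?_, fun i j => ?_, fun i => ?_⟩
    · simp only [fbParams, Matrix.smul_apply, smul_eq_mul, Matrix.one_apply]
      split_ifs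
      · simpa using hlamR
      · simpa using zero_le_one.trans hR
    · simp only [fbParams, Matrix.of_apply, abs_div, Nat.abs_cast]
      exact (div_le_self (abs_nonneg _) hd1).trans ((hcoord _ i).trans (hw t))
    · simp only [fbParams, Matrix.of_apply]
      exact (hcoord _ j).trans ((norm_coe a).le.trans hR)
    · simpa [fbParams] using zero_le_one.trans hR
  obtain ⟨C, hC, hL⟩ := UBL_vField (d := d) R
  have hretr : ∀ y : S d, retr (y : E d) = y := fun y => retr_of_norm_le (norm_coe y).le
  have h0 := eq_zero_of_abs_deriv_le_mul_abs_self_of_eq_zero_right (K := C) (a := 0) (b := τ)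
    (f := fun t => (x t : E d) - z)
    (f' := fun t => vField (fbParams lam B (a : E d) (w t)) (ν t) (x t))
    (fun t ht => ((hx t ht).sub_const _).continuousWithinAt)
    (fun t ht => ((hx t ⟨ht.1, ht.2.le⟩).sub_const _).mono_of_mem_nhdsWithin
      (Icc_mem_nhdsGE_of_mem ht)) (by simp [hx0]) fun t _ => by
      -- As the field vanishes at `z`, its Lipschitz bound gives speed at most `C` times the
      -- distance to `z`.
      have h := (hL ⟨⟨_, hp t⟩, ν t⟩).2 (x t : E d) z
      simp only [hretr, hz, sub_zero, dist_eq_norm] at h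
      exact h
  exact fun t ht => Subtype.ext (sub_eq_zero.1 (h0 t ht))

/-- Data with disjoint supports in an open hemisphere can be kept disjoint while attention acts in
feedback form at a point of one of the supports. -/
theorem exists_steers_attention (hd : 2 ≤ d) (hN : 0 < N) {c : S d}
    (μ₀ : Fin N → ProbabilityMeasure (S d)) (hc : ∀ i, ∀ x ∈ supp (μ₀ i), 0 < ⟪(c : E d), (x : E d)⟫)
    (hdisj : ∀ i j, i ≠ j → Disjoint (supp (μ₀ i)) (supp (μ₀ j))) {τ : ℝ} (hτ : 0 < τ) :
    ∃ (θ : ℝ → Params d) (μ : Fin N → ℝ → ProbabilityMeasure (S d)), Steers τ θ μ₀ μ ∧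
      (∀ i j, i ≠ j → Disjoint (supp (μ i τ)) (supp (μ j τ))) ∧
      ∃ k lam a z B, ∀ t ∈ Icc 0 τ, (θ t).B = B ∧ IsFeedback (θ t) (fun i => μ i t) k lam a z ∧
        z ∈ supp (μ k t) := by
  have hd0 : 0 < d := by omega
  have hne : (⋃ i, supp (μ₀ i)).Nonempty :=
    (supp_nonempty (μ₀ ⟨0, hN⟩)).mono (subset_iUnion (fun i => supp (μ₀ i)) _)
  -- A lowest point for `⟪c, ·⟫` can be cut off from the other supports by a hyperplane through the
  -- origin.
  obtain ⟨z, hz, hmin⟩ := (isCompact_iUnion fun i => isCompact_supp (μ₀ i)).exists_isMinOn hne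
    (f := fun x : S d => ⟪(c : E d), (x : E d)⟫) (by fun_prop)
  obtain ⟨k, hzk⟩ := mem_iUnion.1 hz
  have hothers : IsCompact (⋃ j, ⋃ (_ : j ≠ k), supp (μ₀ j)) :=
    isCompact_iUnion fun j => isCompact_iUnion fun _ => isCompact_supp (μ₀ j)
  have hmem : ∀ {x}, x ∈ (⋃ j, ⋃ (_ : j ≠ k), supp (μ₀ j)) → ∃ j, j ≠ k ∧ x ∈ supp (μ₀ j) :=
    fun hx => by simpa using hx
  have hκ : 0 < ⟪(c : E d), (z : E d)⟫ := hc k z hzk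
  -- `⟪a₀, ·⟫` vanishes at `z`. At another point `x` of the supports, minimality bounds it by `⟪c,
  -- z⟫(⟪z, x⟫ - 1) < 0`; this uses that the supports lie in the open hemisphere.
  let a₀ : E d := ⟪(c : E d), (z : E d)⟫ • (z : E d) - c
  have ha₀ : ∀ x : S d, ⟪a₀, (x : E d)⟫ =
      ⟪(c : E d), (z : E d)⟫ * ⟪(z : E d), (x : E d)⟫ - ⟪(c : E d), (x : E d)⟫ := fun x => by
    rw [inner_sub_left, real_inner_smul_left]
  obtain ⟨m₀, hm₀, hm₀'⟩ := hothers.exists_le_neg (f := fun x : S d => ⟪a₀, (x : E d)⟫)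
    (by fun_prop) fun x hx => by
      obtain ⟨j, hj, hxj⟩ := hmem hx
      have h1 : ⟪(c : E d), (z : E d)⟫ ≤ ⟪(c : E d), (x : E d)⟫ := hmin (mem_iUnion_of_mem j hxj)
      have h2 : (z : E d) ≠ x := fun h => by
        rw [← Subtype.ext h] at hxj
        exact disjoint_left.1 (hdisj j k hj) hxj hzk
      have h3 := (inner_lt_one_iff_real_of_norm_eq_one (norm_coe z) (norm_coe x)).2 h2
      rw [ha₀]
      nlinarith
  -- Tilting towards `z` by half the margin makes `z` strictly positive and keeps the other supports
  -- below `-m₀ / 2`.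
  let a₁ : E d := a₀ + (m₀ / 2) • (z : E d)
  have ha₁ : ∀ x : S d, ⟪a₁, (x : E d)⟫ = ⟪a₀, (x : E d)⟫ + m₀ / 2 * ⟪(z : E d), (x : E d)⟫ :=
    fun x => by rw [inner_add_left, real_inner_smul_left]
  have hzz : ⟪(z : E d), (z : E d)⟫ = 1 := by rw [real_inner_self_eq_norm_sq, norm_coe, one_pow]
  have ha₁z : 0 < ⟪a₁, (z : E d)⟫ := by
    rw [ha₁, ha₀, hzz]
    linarith
  have ha₁0 : a₁ ≠ 0 := fun h => by
    rw [h, inner_zero_left] at ha₁z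
    exact lt_irrefl _ ha₁z
  have hna : 0 < ‖a₁‖⁻¹ := inv_pos.2 (norm_pos_iff.2 ha₁0)
  let a : S d := ⟨‖a₁‖⁻¹ • a₁, by simp [norm_smul, ha₁0]⟩
  have ha : ∀ x : S d, ⟪(a : E d), (x : E d)⟫ = ‖a₁‖⁻¹ * ⟪a₁, (x : E d)⟫ := fun x =>
    real_inner_smul_left _ _ _
  have haz : 0 < ⟪(a : E d), (z : E d)⟫ := by
    rw [ha]
    exact mul_pos hna ha₁z
  obtain ⟨m₁, hm₁, hm₁'⟩ := hothers.exists_le_neg (f := fun x : S d => ⟪(a : E d), (x : E d)⟫)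
    (by fun_prop) fun x hx => by
      have h1 := hm₀' x hx
      have h2 := (abs_le.1 (abs_inner_le_one (norm_coe z) (norm_coe x))).2
      simp only [ha, ha₁] at h1 ⊢
      exact mul_neg_of_pos_of_neg hna (by nlinarith)
  obtain ⟨m₂, hm₂, hm₂'⟩ := (isCompact_iUnion fun i => isCompact_iUnion fun j =>
    isCompact_iUnion fun _ : i ≠ j => (isCompact_supp (μ₀ i)).prod (isCompact_supp (μ₀ j)))
    |>.exists_le_neg (f := fun q : S d × S d => -‖(q.1 : E d) - q.2‖) (by fun_prop) fun q hq => by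
      simp only [mem_iUnion, mem_prod] at hq
      obtain ⟨i, j, hij, h1, h2⟩ := hq
      refine neg_lt_zero.2 (norm_pos_iff.2 (sub_ne_zero.2 fun h => ?_))
      exact disjoint_left.1 (hdisj i j hij) h1 (Subtype.ext h ▸ h2)
  set α := ⟪(a : E d), (z : E d)⟫ with hα
  -- A displacement of `e / 2` per point preserves the half-space margin `m₁`, and two such
  -- displacements preserve the distance `m₂` between supports.
  set e := min m₁ (m₂ / 2) with he
  have he0 : 0 < e := lt_min hm₁ (by positivity)
  -- The speed is at most `lam + 2 * lam / α`, so over time `τ` the displacement is at most `e / 2`.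
  set lam := e / (2 * τ * (1 + 2 / α)) with hlam_def
  have hlam : 0 < lam := by positivity
  have hB : (1 : Matrix (Fin d) (Fin d) ℝ) ≠ 0 := fun h => by
    have := congrFun (congrFun h ⟨0, hd0⟩) ⟨0, hd0⟩
    simp at this
  let l : Loop d N := ⟨lam, 1, a, z, k, μ₀⟩
  obtain ⟨X, w, hwc, hX, hw, hv⟩ := exists_closedLoop hd0 l haz hτ
  have hwb : ∀ t, ‖w t‖ ≤ 2 * lam / α := fun t => norm_gain_le hlam.le haz (hw t)
  have hder : ∀ i x, ∀ t ∈ Icc 0 τ, HasDerivWithinAt (fun t => (X i t x : E d))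
      (vField (fbParams lam 1 (a : E d) (w t)) (push (μ₀ i) (X i t)) (X i t x)) (Icc 0 τ) t :=
    fun i x => by
    obtain ⟨v, hv⟩ := hv i
    exact hasDerivWithinAt_flow (u := fun t x =>
      vField (fbParams lam 1 (a : E d) (w t)) (push (μ₀ i) (X i t)) (X i t x)) hv x
  have hdisp : ∀ i x, ∀ t ∈ Icc 0 τ, ‖(X i t x : E d) - x‖ ≤ e / 2 := fun i x t ht => by
    have h := norm_image_sub_le_of_norm_deriv_le_segment' (C := lam + 2 * lam / α) (hder i x)
      (fun s _ => (norm_vField_fbParams_le hd0 hlam.le 1 a (w s) _ _).trans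
        (add_le_add_right (hwb s) _)) t ht
    rw [(hX i).init, sub_zero] at h
    refine h.trans ?_
    have e1 : (lam + 2 * lam / α) * τ = e / 2 := by
      rw [hlam_def]
      field_simp
    rw [← e1]
    gcongr
    exact ht.2
  have hneg : ∀ t ∈ Icc 0 τ, ∀ j, j ≠ k → ∀ x ∈ supp (μ₀ j), ⟪(a : E d), (X j t x : E d)⟫ < 0 :=
    fun t ht j hj x hx => by
    have h1 := hm₁' x (mem_iUnion₂.2 ⟨j, hj, hx⟩)
    have h2 := real_inner_le_norm (a : E d) ((X j t x : E d) - x)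
    rw [inner_sub_right, norm_coe, one_mul] at h2
    have h3 := hdisp j x t ht
    have h4 := min_le_left m₁ (m₂ / 2)
    linarith
  obtain ⟨hsteer, hfb⟩ := steers_loop hd0 l hlam hB haz hwc hX hw hneg
  -- The feedback law makes the unprojected velocity at `z` equal to `lam • z`, which the projection
  -- kills; so `z` stays put and remains in the support.
  have hstat : ∀ t ∈ Icc 0 τ, X k t z = z := by
    refine eq_of_vField_eq_zero (R := 1 + lam + 2 * lam / α) (lam := lam) (B := 1) (a := a) (w := w)
      (ν := fun t => push (μ₀ k) (X k t)) hd0 ?_ (fun i j => ?_) (fun t => ?_) ?_ ((hX k).init z)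
      (hder k z) fun t => ?_
    · rw [abs_of_pos hlam]
      have : 0 < 2 * lam / α := by positivity
      linarith
    · have h1 : 0 < 2 * lam / α := by positivity
      rw [Matrix.one_apply]
      split_ifs
      · rw [abs_one]; linarith
      · rw [abs_zero]; linarith
    · linarith [hwb t]
    · have : 0 < 2 * lam / α := by positivity
      linarith
    · have h1 : α • w t = lam • ((z : E d) - attention 1 (push (μ₀ k) (X k t)) z) := hw t
      rw [vField_fbParams hd0, max_eq_left haz.le, h1, smul_sub, add_sub_cancel, tanProj_smul,
        tanProj_self (norm_coe z), smul_zero]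
  refine ⟨_, _, hsteer, fun i j hij => ?_, k, lam, a, z, 1, fun t ht => ⟨rfl, hfb t ht, ?_⟩⟩
  · rw [disjoint_left]
    intro y hi hj
    obtain ⟨x, hx, rfl⟩ := supp_push_subset _ _ hi
    obtain ⟨x', hx', hxx'⟩ := supp_push_subset _ _ hj
    have hτm : τ ∈ Icc 0 τ := ⟨hτ.le, le_rfl⟩
    have h1 := hm₂' (x, x') (mem_iUnion.2 ⟨i, mem_iUnion₂.2 ⟨j, hij, hx, hx'⟩⟩)
    have h2 := hdisp i x τ hτm
    have h3 := hdisp j x' τ hτm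
    change X j τ x' = X i τ x at hxx'
    rw [hxx'] at h3
    have h4 := norm_sub_le_norm_sub_add_norm_sub (x : E d) (X i τ x : E d) x'
    rw [norm_sub_rev (x : E d) (X i τ x : E d)] at h4
    have h5 := min_le_right m₁ (m₂ / 2)
    simp only at h1
    linarith
  · have h := mem_supp_push (X k t) hzk
    rw [hstat t ht] at h
    exact h

end Transformer

end

theorem propositionC2 (d : ℕ) (hd : 2 ≤ d) (N : ℕ) (hN : 0 < N) (T : ℝ) (hT : 0 < T)
    (μ₀ : Fin N → ProbabilityMeasure (Transformer.S d))
    (hdistinct : ∀ i j, i ≠ j → μ₀ i ≠ μ₀ j)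
    (hhole : (⋃ i, Transformer.supp (μ₀ i)) ≠ Set.univ)
    (hbdry : ∀ i j, i ≠ j →
      Disjoint (frontier (Transformer.circleMarginal hd (μ₀ i)).support)
        (frontier (Transformer.circleMarginal hd (μ₀ j)).support)) :
    ∃ (θ : ℝ → Transformer.Params d) (μ : Fin N → ℝ → ProbabilityMeasure (Transformer.S d)),
      Transformer.IsLinfty T θ ∧
      -- `μ i` is the unique weak solution with data `μ₀ i`
      (∀ i, Transformer.IsWeakSolution T θ (μ₀ i) (μ i)) ∧
      (∀ i ν, Transformer.IsWeakSolution T θ (μ₀ i) ν → ∀ t ∈ Set.Icc 0 T, ν t = μ i t) ∧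
      -- attention is only used with `B ≠ 0` and `W` in feedback form
      (∀ᵐ t ∂(volume.restrict (Set.Ioo 0 T)), (θ t).V = 0 ∨
        ∃ k lam a z, Transformer.IsFeedback (θ t) (fun i => μ i t) k lam a z) ∧
      -- on some time interval it is used with a fixed `B`, at a point of the `k`-th support
      (∃ s₁ s₂ : ℝ, 0 ≤ s₁ ∧ s₁ < s₂ ∧ s₂ ≤ T ∧ ∃ k lam a z B, ∀ t ∈ Set.Ioo s₁ s₂,
        (θ t).B = B ∧ Transformer.IsFeedback (θ t) (fun i => μ i t) k lam a z ∧
        z ∈ Transformer.supp (μ k t)) ∧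
      -- the supports are disentangled at time `T`
      (∀ i j, i ≠ j → Disjoint (Transformer.supp (μ i T)) (Transformer.supp (μ j T))) := by
  obtain ⟨c, θ₁, μ₁, h₁, hpos, hdisj⟩ := Transformer.exists_steers_disjoint hd hN μ₀ hdistinct hhole
    (τ := T / 3) (by positivity)
  obtain ⟨θ₂, μ₂, h₂, hdisj₂, k, lam, a, z, B, hF⟩ := Transformer.exists_steers_attention hd hN
    (fun i => μ₁ i (T / 3 + T / 3)) hpos hdisj (τ := T / 3) (by positivity)
  -- Boost and clustering take a third each of the time, the attention phase the last third; the
  -- latter supplies the open interval.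
  have h := h₁.concat (by positivity) (by positivity) h₂
  have hT3 : T / 3 + T / 3 + T / 3 = T := by ring
  rw [hT3] at h
  refine ⟨_, _, h.linfty, h.weak, fun i ν hν => Transformer.IsWeakSolution.unique h.linfty hν (h.weak i),
    ?_, ⟨T / 3 + T / 3, T, by positivity, by linarith, le_rfl, k, lam, a, z, B, fun t ht => ?_⟩,
    fun i j hij => ?_⟩
  · filter_upwards [ae_restrict_mem measurableSet_Ioo] with t ht
    exact h.mode t (Set.Ioo_subset_Ioc_self ht)
  · simp only [Transformer.concat_of_lt _ _ ht.1]
    exact hF _ ⟨by linarith [ht.1], by linarith [ht.2]⟩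
  · have e : T - (T / 3 + T / 3) = T / 3 := by ring
    rw [Transformer.concat_of_lt _ _ (by linarith), Transformer.concat_of_lt _ _ (by linarith), e]
    exact hdisj₂ i j hij
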